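/- **Setting.** Let $p$ be a prime and $n\ge 0$ an integer. Let $\mathrm{biMod}$ be the category of pairs $(R;M)$ of a (unital, not necessarily commutative) ring $R$ and an $R$-bimodule $M$; a morphism $(R;M)\to(R';M')$ is a ring homomorphism $\alpha\colon R\to R'$ with an additive map $f\colon M\to M'$ satisfying $f(rm)=\alpha(r)f(m)$ and $f(mr)=f(m)\alpha(r)$. It is symmetric monoidal under $(R;M)\otimes(S;N)=(R\otimes_{\mathbb Z} S;M\otimes_{\mathbb Z} N)$, with unit $(\mathbb Z;\mathbb Z)$. Let $M^{\otimes_R k}$ be the $k$-fold tensor power ($M^{\otimes_R 0}=R$), and let $M^{\circledcirc_R k}=M^{\otimes_R k}/\langle ra-ar : r\in R,\ a\in M^{\otimes_R k}\rangle$ be the cyclic tensor power, on which the cyclic group $C_k=\langle\sigma\rangle$ acts by cyclically permuting the tensor factors. The shuffle $(m_1\otimes\dots\otimes m_k,\,n_1\otimes\dots\otimes n_k)\mapsto (m_1\otimes n_1)\otimes\dots\otimes(m_k\otimes n_k)$ induces pairings $M^{\circledcirc_R k}\otimes N^{\circledcirc_S k}\to (M\otimes N)^{\circledcirc_{R\otimes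 S}k}$, which together with the unit $1^{\otimes k}\in\mathbb Z^{\circledcirc_{\mathbb Z} k}$ make $(M^{\circledcirc_R k})^{C_k}$ a lax symmetric monoidal functor to abelian groups. *Power series side.* Let $\widehat S(R;M)=1\times\prod_{k\ge1}M^{\otimes_R k}$ be the multiplicative group of special units $1+m_1t+m_2t^2+\cdots$ of the completed tensor algebra, with the product topology of the discrete topologies. The abelian group $W_{\langle p^n\rangle}(R;M)$ is the quotient of $\widehat S(R;M)$ by the closed normal subgroup generated by the commutators, the elements $(1-rm\,t)(1-mr\,t)^{-1}$ for $r\in R$, $m\in M$, and the elements $1-m_1\otimes\dots\otimes m_k\,t^k$ with $k\ge 1$, $k\notin\{1,p,\dots,p^n\}$. Its standard lax symmetric monoidal structure has as unit the class of $1-t$, and a biadditive product $\star$ determined, for elementary tensors $x\in M^{\otimes_R p^i}$ and $y\in N^{\otimes_S p^j}$ with $i\le j\le n$, by $$[1-x\,t^{p^i}]\star[1-y\,t^{p^j}]=\sum_{\sigma\in C_{p^i}}\big[1-\big((\sigma x)^{\otimes p^{j-i}}\otimes y\big)t^{p^j}\big]$$ (where the two tensors of length $p^j$ are shuffled together) and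 by symmetry when $i>j$. The logarithmic derivative of $f=1+\sum_k f_kt^k\in\widehat S(R;M)$ has $t^N$-coefficient $$\mathrm{tlog}(f)_N=-\sum_{i+k=N}\ \sum_{0\le s<k}\sigma^s\big[(f^{-1})_i\otimes f_k\big]\in M^{\circledcirc_R N},$$ where $\sigma$ moves the last tensor factor to the front; $\mathrm{tlog}_{\langle p^n\rangle}$ denotes its components at $N=1,p,\dots,p^n$. *Witt coordinates side.* For $0\le j\le n$ let $w_j\colon\prod_{i=0}^nM^{\otimes_R p^i}\to(M^{\circledcirc_R p^j})^{C_{p^j}}$ be the ghost map $w_j(m_0,\dots,m_n)=\sum_{i=0}^j\mathrm{tr}_{C_{p^{j-i}}}^{C_{p^j}}\big(m_i^{\otimes p^{j-i}}\big)$, and $w=(w_0,\dots,w_n)$. A pair is free if it consists of a free ring $\mathbb Z\{X\}$ and a free bimodule over it. Given a free resolution of $(R;M)$, that is, a reflexive coequaliser diagram $f,g\colon(\overline S;\overline Q)\rightrightarrows(S;Q)\xrightarrow{\ \epsilon\ }(R;M)$ in $\mathrm{biMod}$ with $(S;Q)$ and $(\overline S;\overline Q)$ free, let $W_{n+1,p}(R;M)$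 be the quotient of $\prod_{i=0}^nM^{\otimes_R p^i}$ by the equivalence relation generated by: $a\sim b$ if there are $q,u\in\prod_iQ^{\otimes_S p^i}$ and $z\in\prod_i\overline Q^{\otimes_{\overline S}p^i}$ with $\epsilon_*q=a$, $\epsilon_*u=b$, $w(q)=w(f_*z)$ and $w(u)=w(g_*z)$. **Theorem.** Every $(R;M)$ has a free resolution; the map $\mathrm{tlog}_{\langle p^n\rangle}$ is well defined on $W_{\langle p^n\rangle}(R;M)$ with values in $\prod_{j=0}^n(M^{\circledcirc_R p^j})^{C_{p^j}}$; the standard lax symmetric monoidal structure on $W_{\langle p^n\rangle}$ exists; and $\mathrm{tlog}_{\langle p^n\rangle}$ is additive and symmetric monoidal for it. Moreover, for every choice of free resolutions: 1. $W_{n+1,p}$ is functorial on $\mathrm{biMod}$, by the maps induced on representatives, and $w$ descends to $W_{n+1,p}(R;M)\to\prod_{j=0}^n(M^{\circledcirc_R p^j})^{C_{p^j}}$. 2. The map $\gamma$ sending $(m_0,\dots,m_n)$ to the class of $\prod_{i=0}^n(1-m_it^{p^i})$ descends to a natural bijection $\gamma\colon W_{n+1,p}(R;M)\xrightarrow{\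 \cong\ }W_{\langle p^n\rangle}(R;M)$. 3. $\mathrm{tlog}_{\langle p^n\rangle}\circ\gamma=w$. 4. The abelian group structure and the lax symmetric monoidal structure on $W_{n+1,p}$ that correspond under $\gamma$ to those of $W_{\langle p^n\rangle}$ make the ghost maps $w_j\colon W_{n+1,p}(R;M)\to(M^{\circledcirc_R p^j})^{C_{p^j}}$, $0\le j\le n$, additive symmetric monoidal transformations, and they are the unique (natural) structures with this property; already the natural abelian group structure is unique with all $w_j$ additive. -/

import Mathlib

open TensorProduct MulOpposite CategoryTheory
open scoped DirectSum

universe u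

noncomputable section

namespace WittCoeff

/-! ### The category of bimodules -/

/-- A pair `(R; M)` of a (not necessarily commutative, unital) ring `R` and an `R`-bimodule `M`;
the right action is an action of `Rᵐᵒᵖ`, so `m r` is written `op r • m`. -/
structure BimodPair : Type (u + 1) where
  R : Type u
  M : Type u
  [ring : Ring R]
  [addCommGroup : AddCommGroup M]
  [left : Module R M]
  [right : Module Rᵐᵒᵖ M]
  [smulComm : SMulCommClass R Rᵐᵒᵖ M]

attribute [instance] BimodPair.ring BimodPair.addCommGroup BimodPair.left BimodPair.right
  BimodPair.smulComm

/-- A morphism `(R; M) ⟶ (R'; M')`: a ring homomorphism `α : R → R'` and an additive map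
`f : M → M'` with `f (r m) = α r f m` and `f (m r) = f m α r`. -/
@[ext]
structure BimodPair.Hom (B C : BimodPair.{u}) : Type u where
  ringHom : B.R →+* C.R
  addHom : B.M →+ C.M
  map_smul : ∀ (r : B.R) (m : B.M), addHom (r • m) = ringHom r • addHom m
  map_op_smul : ∀ (r : B.R) (m : B.M), addHom (op r • m) = op (ringHom r) • addHom m

instance : Category BimodPair.{u} where
  Hom := BimodPair.Hom
  id B := ⟨RingHom.id _, AddMonoidHom.id _, fun _ _ => rfl, fun _ _ => rfl⟩
  comp f g := ⟨g.ringHom.comp f.ringHom, g.addHom.comp f.addHom,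
    fun r m => by simp [f.map_smul, g.map_smul], fun r m => by simp [f.map_op_smul, g.map_op_smul]⟩

/-! ### Tensor product over a non-commutative ring -/

section BalTensor

variable (R : Type u) [Ring R] (N : Type u) [AddCommGroup N] [Module Rᵐᵒᵖ N]
  (M : Type u) [AddCommGroup M] [Module R M]

/-- The relations `n r ⊗ m = n ⊗ r m`. -/
def balRel : Submodule ℤ (N ⊗[ℤ] M) :=
  Submodule.span ℤ {x | ∃ (n : N) (r : R) (m : M), x = (op r • n) ⊗ₜ[ℤ] m - n ⊗ₜ[ℤ] (r • m)}

/-- The tensor product `N ⊗_R M` of a right module and a left module over `R`. -/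
def BalTensor : Type u := (N ⊗[ℤ] M) ⧸ balRel R N M

instance : AddCommGroup (BalTensor R N M) :=
  inferInstanceAs (AddCommGroup ((N ⊗[ℤ] M) ⧸ balRel R N M))

variable {N M}

/-- The class of `n ⊗ m` in `N ⊗_R M`. -/
def tm (n : N) (m : M) : BalTensor R N M := (balRel R N M).mkQ (n ⊗ₜ[ℤ] m)

variable {R}

theorem tm_add_left (n n' : N) (m : M) : tm R (n + n') m = tm R n m + tm R n' m := by
  simp only [tm, add_tmul, map_add]; rfl

theorem tm_add_right (n : N) (m m' : M) : tm R n (m + m') = tm R n m + tm R n m' := by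
  simp only [tm, tmul_add, map_add]; rfl

theorem tm_smul (n : N) (r : R) (m : M) : tm R (op r • n) m = tm R n (r • m) := by
  refine (Submodule.Quotient.eq _).2 (Submodule.subset_span ⟨n, r, m, rfl⟩)

theorem tm_zero_left (m : M) : tm R (0 : N) m = 0 := by
  simp only [tm, zero_tmul, map_zero]; rfl

theorem tm_zero_right (n : N) : tm R n (0 : M) = 0 := by
  simp only [tm, tmul_zero, map_zero]; rfl

theorem BalTensor.induction {P : BalTensor R N M → Prop} (x : BalTensor R N M)
    (zero : P 0) (tmul : ∀ n m, P (tm R n m)) (add : ∀ x y, P x → P y → P (x + y)) : P x := by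
  obtain ⟨y, rfl⟩ := Submodule.mkQ_surjective (balRel R N M) x
  induction y using TensorProduct.induction_on with
  | zero => rw [map_zero]; exact zero
  | tmul n m => exact tmul n m
  | add x y hx hy => rw [map_add]; exact add _ _ hx hy

/-- The universal property of `N ⊗_R M`. -/
def BalTensor.lift {X : Type u} [AddCommGroup X] (g : N →+ M →+ X)
    (h : ∀ n (r : R) m, g (op r • n) m = g n (r • m)) : BalTensor R N M →+ X :=
  ((balRel R N M).liftQ
    (TensorProduct.liftAddHom g (fun z n m => by simp)).toIntLinearMap
    (by
      rw [balRel, Submodule.span_le]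
      rintro _ ⟨n, r, m, rfl⟩
      simp [h])).toAddMonoidHom

@[simp]
theorem BalTensor.lift_tm {X : Type u} [AddCommGroup X] (g : N →+ M →+ X)
    (h : ∀ n (r : R) m, g (op r • n) m = g n (r • m)) (n : N) (m : M) :
    BalTensor.lift g h (tm R n m) = g n m := by
  rfl

theorem BalTensor.hom_ext {X : Type u} [AddCommGroup X] {f g : BalTensor R N M →+ X}
    (h : ∀ n m, f (tm R n m) = g (tm R n m)) : f = g := by
  ext x
  induction x using BalTensor.induction with
  | zero => simp
  | tmul n m => exact h n m
  | add x y hx hy => simp [hx, hy]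

/-- A function of two variables that is additive in each of them and balanced over `R` factors
through `N ⊗_R M`. -/
def BalTensor.lift' {X : Type u} [AddCommGroup X] (g : N → M → X)
    (hl : ∀ n n' m, g (n + n') m = g n m + g n' m)
    (hr : ∀ n m m', g n (m + m') = g n m + g n m')
    (h : ∀ n (r : R) m, g (op r • n) m = g n (r • m)) : BalTensor R N M →+ X :=
  BalTensor.lift (AddMonoidHom.mk' (fun n => AddMonoidHom.mk' (g n) (hr n))
    (fun n n' => by ext m; exact hl n n' m)) h

@[simp]
theorem BalTensor.lift'_tm {X : Type u} [AddCommGroup X] (g : N → M → X) (hl hr)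
    (h : ∀ n (r : R) m, g (op r • n) m = g n (r • m)) (n : N) (m : M) :
    BalTensor.lift' g hl hr h (tm R n m) = g n m := BalTensor.lift_tm _ _ _ _

section LeftAction

variable [Module R N] [SMulCommClass R Rᵐᵒᵖ N]

instance : SMul R (BalTensor R N M) where
  smul r := BalTensor.lift' (fun n m => tm R (r • n) m)
    (fun n n' m => by simp only [smul_add, tm_add_left]) (fun n m m' => tm_add_right _ _ _)
    (fun n s m => by rw [smul_comm, tm_smul])

@[simp]
theorem smul_tm (r : R) (n : N) (m : M) : r • tm R n m = tm R (r • n) m :=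
  BalTensor.lift'_tm _ _ _ _ _ _

theorem balSmul_add (r : R) (x y : BalTensor R N M) : r • (x + y) = r • x + r • y :=
  map_add (BalTensor.lift' _ _ _ _) x y

theorem balSmul_zero (r : R) : r • (0 : BalTensor R N M) = 0 :=
  map_zero (BalTensor.lift' _ _ _ _)

instance : Module R (BalTensor R N M) where
  one_smul x := by
    induction x using BalTensor.induction with
    | zero => rw [balSmul_zero]
    | tmul n m => simp
    | add x y hx hy => rw [balSmul_add, hx, hy]
  mul_smul r s x := by
    induction x using BalTensor.induction with
    | zero => simp only [balSmul_zero]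
    | tmul n m => simp [mul_smul]
    | add x y hx hy => simp only [balSmul_add, hx, hy]
  smul_zero := balSmul_zero
  smul_add := balSmul_add
  add_smul r s x := by
    induction x using BalTensor.induction with
    | zero => simp only [balSmul_zero, add_zero]
    | tmul n m => simp [add_smul, tm_add_left]
    | add x y hx hy => simp only [balSmul_add, hx, hy]; abel
  zero_smul x := by
    induction x using BalTensor.induction with
    | zero => rw [balSmul_zero]
    | tmul n m => simp [tm_zero_left]
    | add x y hx hy => rw [balSmul_add, hx, hy, add_zero]

end LeftAction

section RightAction

variable [Module Rᵐᵒᵖ M] [SMulCommClass R Rᵐᵒᵖ M]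

instance : SMul Rᵐᵒᵖ (BalTensor R N M) where
  smul r := BalTensor.lift' (fun n m => tm R n (r • m))
    (fun n n' m => by simp only [tm_add_left])
    (fun n m m' => by simp only [smul_add, tm_add_right])
    (fun n s m => by rw [← smul_comm, tm_smul])

@[simp]
theorem op_smul_tm (r : Rᵐᵒᵖ) (n : N) (m : M) : r • tm R n m = tm R n (r • m) :=
  BalTensor.lift'_tm _ _ _ _ _ _

theorem balOpSmul_add (r : Rᵐᵒᵖ) (x y : BalTensor R N M) : r • (x + y) = r • x + r • y :=
  map_add (BalTensor.lift' _ _ _ _) x y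

theorem balOpSmul_zero (r : Rᵐᵒᵖ) : r • (0 : BalTensor R N M) = 0 :=
  map_zero (BalTensor.lift' _ _ _ _)

instance : Module Rᵐᵒᵖ (BalTensor R N M) where
  one_smul x := by
    induction x using BalTensor.induction with
    | zero => rw [balOpSmul_zero]
    | tmul n m => simp
    | add x y hx hy => rw [balOpSmul_add, hx, hy]
  mul_smul r s x := by
    induction x using BalTensor.induction with
    | zero => simp only [balOpSmul_zero]
    | tmul n m => simp [mul_smul]
    | add x y hx hy => simp only [balOpSmul_add, hx, hy]
  smul_zero := balOpSmul_zero
  smul_add := balOpSmul_add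
  add_smul r s x := by
    induction x using BalTensor.induction with
    | zero => simp only [balOpSmul_zero, add_zero]
    | tmul n m => simp [add_smul, tm_add_right]
    | add x y hx hy => simp only [balOpSmul_add, hx, hy]; abel
  zero_smul x := by
    induction x using BalTensor.induction with
    | zero => rw [balOpSmul_zero]
    | tmul n m => simp [tm_zero_right]
    | add x y hx hy => rw [balOpSmul_add, hx, hy, add_zero]

end RightAction

instance [Module R N] [SMulCommClass R Rᵐᵒᵖ N] [Module Rᵐᵒᵖ M] [SMulCommClass R Rᵐᵒᵖ M] :
    SMulCommClass R Rᵐᵒᵖ (BalTensor R N M) where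
  smul_comm r s x := by
    induction x using BalTensor.induction with
    | zero => simp
    | tmul n m => simp
    | add x y hx hy => simp only [smul_add, hx, hy]

end BalTensor

/-! ### Tensor powers and the tensor algebra -/

/-- `R` itself as an `R`-bimodule. -/
def BimodPair.self (K : Type u) [Ring K] : BimodPair.{u} := ⟨K, K⟩

/-- Auxiliary bundled form of the tensor powers. -/
structure BimodOver (R : Type u) [Ring R] : Type (u + 1) where
  carrier : Type u
  [addCommGroup : AddCommGroup carrier]
  [left : Module R carrier]
  [right : Module Rᵐᵒᵖ carrier]
  [smulComm : SMulCommClass R Rᵐᵒᵖ carrier]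

attribute [instance] BimodOver.addCommGroup BimodOver.left BimodOver.right BimodOver.smulComm

/-- The bimodules `M^{⊗_R 0} = R` and `M^{⊗_R (k+1)} = M^{⊗_R k} ⊗_R M`. -/
def tensBimod (B : BimodPair.{u}) : ℕ → BimodOver B.R
  | 0 => ⟨B.R⟩
  | k + 1 => ⟨BalTensor B.R (tensBimod B k).carrier B.M⟩

/-- The tensor power `M^{⊗_R k}`, an `R`-bimodule. -/
abbrev Tens (B : BimodPair.{u}) (k : ℕ) : Type u := (tensBimod B k).carrier

variable {B C D : BimodPair.{u}}

/-- An element of `M^{⊗_R 0}`, seen in `R`. -/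
def scal (r : Tens B 0) : B.R := r

/-- The element `a ⊗ m` of `M^{⊗_R (k+1)}`. -/
def snoc {k : ℕ} (a : Tens B k) (m : B.M) : Tens B (k + 1) := tm B.R a m

theorem snoc_add_left {k : ℕ} (a a' : Tens B k) (m : B.M) :
    snoc (a + a') m = snoc a m + snoc a' m := tm_add_left a a' m

theorem snoc_add_right {k : ℕ} (a : Tens B k) (m m' : B.M) :
    snoc a (m + m') = snoc a m + snoc a m' := tm_add_right a m m'

theorem snoc_op_smul {k : ℕ} (a : Tens B k) (r : B.R) (m : B.M) :
    snoc (op r • a) m = snoc a (r • m) := tm_smul a r m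

@[simp]
theorem smul_snoc {k : ℕ} (r : B.R) (a : Tens B k) (m : B.M) :
    r • snoc a m = snoc (r • a) m := smul_tm r a m

@[simp]
theorem op_smul_snoc {k : ℕ} (r : B.Rᵐᵒᵖ) (a : Tens B k) (m : B.M) :
    r • snoc a m = snoc a (r • m) := op_smul_tm r a m

/-- Maps out of `M^{⊗_R (k+1)} = M^{⊗_R k} ⊗_R M`. -/
def snocLift {X : Type u} [AddCommGroup X] {k : ℕ} (g : Tens B k → B.M → X)
    (hl : ∀ n n' m, g (n + n') m = g n m + g n' m)
    (hr : ∀ n m m', g n (m + m') = g n m + g n m')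
    (h : ∀ n (r : B.R) m, g (op r • n) m = g n (r • m)) : Tens B (k + 1) →+ X :=
  BalTensor.lift' g hl hr h

@[simp]
theorem snocLift_snoc {X : Type u} [AddCommGroup X] {k : ℕ} (g : Tens B k → B.M → X) (hl hr)
    (h : ∀ n (r : B.R) m, g (op r • n) m = g n (r • m)) (a : Tens B k) (m : B.M) :
    snocLift g hl hr h (snoc a m) = g a m := BalTensor.lift'_tm _ _ _ _ _ _

theorem snoc_induction {k : ℕ} {P : Tens B (k + 1) → Prop} (x : Tens B (k + 1))
    (zero : P 0) (snoc : ∀ a m, P (snoc a m)) (add : ∀ x y, P x → P y → P (x + y)) : P x :=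
  BalTensor.induction (R := B.R) (N := Tens B k) (M := B.M) x zero snoc add

theorem snoc_hom_ext {X : Type u} [AddCommGroup X] {k : ℕ} {f g : Tens B (k + 1) →+ X}
    (h : ∀ a m, f (snoc a m) = g (snoc a m)) : f = g := BalTensor.hom_ext h

/-- An additive map that is compatible with right multiplication. -/
structure RightHom {R S : Type u} [Ring R] [Ring S] (σ : R →+* S) (N N' : Type u)
    [AddCommGroup N] [AddCommGroup N'] [Module Rᵐᵒᵖ N] [Module Sᵐᵒᵖ N'] where
  hom : N →+ N'
  map_op_smul : ∀ (r : R) (n : N), hom (op r • n) = op (σ r) • hom n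

/-- The map `φ ⊗ f : M^{⊗_R k} ⊗_R M → N' ⊗_S M'` for a right linear map `φ`. -/
def RightHom.snoc (f : B ⟶ C) {k l : ℕ} (φ : RightHom f.ringHom (Tens B k) (Tens C l)) :
    RightHom f.ringHom (Tens B (k + 1)) (Tens C (l + 1)) where
  hom := snocLift (fun a m => WittCoeff.snoc (φ.hom a) (f.addHom m))
    (fun a a' m => by rw [map_add, snoc_add_left])
    (fun a m m' => by rw [map_add, snoc_add_right])
    (fun a r m => by rw [φ.map_op_smul, snoc_op_smul, f.map_smul])
  map_op_smul r x := by
    induction x using snoc_induction with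
    | zero => simp
    | snoc a m => simp [f.map_op_smul]
    | add x y hx hy => simp only [smul_add, map_add, hx, hy]

theorem RightHom.snoc_hom (f : B ⟶ C) {k l : ℕ} (φ : RightHom f.ringHom (Tens B k) (Tens C l))
    (a : Tens B k) (m : B.M) :
    (φ.snoc f).hom (WittCoeff.snoc a m) = WittCoeff.snoc (φ.hom a) (f.addHom m) := by
  simp only [RightHom.snoc, snocLift_snoc]

/-- The map `M^{⊗_R k} → M'^{⊗_{R'} k}` induced by a morphism of bimodules. -/
def tensMapAux (f : B ⟶ C) : ∀ k : ℕ, RightHom f.ringHom (Tens B k) (Tens C k)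
  | 0 =>
    { hom := (f.ringHom.toAddMonoidHom : B.R →+ C.R)
      map_op_smul := fun r n => map_mul f.ringHom (scal n) r }
  | k + 1 => (tensMapAux f k).snoc f

/-- The map `M^{⊗_R k} → M'^{⊗_{R'} k}` induced by a morphism of bimodules. -/
def tensMap (f : B ⟶ C) (k : ℕ) : Tens B k →+ Tens C k := (tensMapAux f k).hom

@[simp]
theorem tensMap_snoc (f : B ⟶ C) {k : ℕ} (a : Tens B k) (m : B.M) :
    tensMap f (k + 1) (snoc a m) = snoc (tensMap f k a) (f.addHom m) :=
  (tensMapAux f k).snoc_hom f a m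

theorem tensMap_op_smul (f : B ⟶ C) {k : ℕ} (r : B.R) (a : Tens B k) :
    tensMap f k (op r • a) = op (f.ringHom r) • tensMap f k a := (tensMapAux f k).map_op_smul r a

/-- Left multiplication `M^{⊗_R j} → M^{⊗_R (i+j)}`, `b ↦ a ⊗ b`, by `a ∈ M^{⊗_R i}`. -/
def tensMulAux {i : ℕ} (a : Tens B i) :
    ∀ j : ℕ, RightHom (BimodPair.Hom.ringHom (𝟙 B)) (Tens B j) (Tens B (i + j))
  | 0 =>
    { hom := AddMonoidHom.mk' (fun r => (op (scal r) • a : Tens B i))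
        (fun r s => add_smul (op (scal r)) (op (scal s)) a)
      map_op_smul := fun r s => mul_smul (op r) (op (scal s)) a }
  | j + 1 => (tensMulAux a j).snoc (𝟙 B)

/-- The product `M^{⊗_R i} × M^{⊗_R j} → M^{⊗_R (i+j)}`. -/
def tensMul {i j : ℕ} (a : Tens B i) (b : Tens B j) : Tens B (i + j) := (tensMulAux a j).hom b

@[simp]
theorem tensMul_snoc {i j : ℕ} (a : Tens B i) (b : Tens B j) (m : B.M) :
    tensMul a (snoc b m) = (snoc (tensMul a b) m : Tens B (i + j + 1)) :=
  (tensMulAux a j).snoc_hom (𝟙 B) b m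

theorem tensMul_add {i j : ℕ} (a : Tens B i) (b b' : Tens B j) :
    tensMul a (b + b') = tensMul a b + tensMul a b' := map_add _ _ _

theorem tensMul_zero {i j : ℕ} (a : Tens B i) : tensMul a (0 : Tens B j) = 0 := map_zero _

theorem tensMul_op_smul {i j : ℕ} (a : Tens B i) (r : B.R) (b : Tens B j) :
    tensMul a (op r • b) = op r • tensMul a b := (tensMulAux a j).map_op_smul r b

theorem add_tensMul {i : ℕ} : ∀ {j : ℕ} (a a' : Tens B i) (b : Tens B j),
    tensMul (a + a') b = tensMul a b + tensMul a' b
  | 0, a, a', b => smul_add (op (scal b)) a a'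
  | j + 1, a, a', b => by
    induction b using snoc_induction with
    | zero => simp only [tensMul_zero, add_zero]
    | snoc b m => rw [tensMul_snoc, tensMul_snoc, tensMul_snoc, add_tensMul a a' b, snoc_add_left]
    | add x y hx hy => simp only [tensMul_add, hx, hy]; abel

theorem zero_tensMul {i j : ℕ} (b : Tens B j) : tensMul (0 : Tens B i) b = 0 := by
  have := add_tensMul (0 : Tens B i) 0 b
  simpa using this

theorem smul_tensMul {i : ℕ} : ∀ {j : ℕ} (r : B.R) (a : Tens B i) (b : Tens B j),
    tensMul (r • a) b = r • tensMul a b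
  | 0, r, a, b => (smul_comm r (op (scal b)) a).symm
  | j + 1, r, a, b => by
    induction b using snoc_induction with
    | zero => simp only [tensMul_zero, smul_zero]
    | snoc b m =>
      rw [tensMul_snoc, tensMul_snoc, smul_tensMul r a b]; exact (smul_snoc _ _ _).symm
    | add x y hx hy => simp only [tensMul_add, hx, hy, smul_add]

theorem tensMap_tensMul (f : B ⟶ C) {i : ℕ} : ∀ {j : ℕ} (a : Tens B i) (b : Tens B j),
    tensMap f (i + j) (tensMul a b) = tensMul (tensMap f i a) (tensMap f j b)
  | 0, a, b => tensMap_op_smul f (scal b) a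
  | j + 1, a, b => by
    induction b using snoc_induction with
    | zero => simp only [tensMul_zero, map_zero]
    | snoc b m =>
      rw [tensMul_snoc, tensMap_snoc, tensMul_snoc, ← tensMap_tensMul f a b]
      exact tensMap_snoc f _ m
    | add x y hx hy => simp only [tensMul_add, map_add, hx, hy]

/-- Transport of tensor powers along an equality of exponents. -/
def tensCast {i j : ℕ} (h : i = j) : Tens B i →+ Tens B j := h ▸ AddMonoidHom.id _

theorem tensCast_rfl {i : ℕ} (a : Tens B i) : tensCast rfl a = a := rfl

theorem tensCast_snoc {i j : ℕ} (h : i = j) (h' : i + 1 = j + 1) (a : Tens B i) (m : B.M) :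
    tensCast h' (snoc a m) = snoc (tensCast h a) m := by
  subst h; rfl

theorem gradedMk_eq {i j : ℕ} (h : i = j) {a : Tens B i} {b : Tens B j} (e : tensCast h a = b) :
    (GradedMonoid.mk i a : GradedMonoid (Tens B)) = GradedMonoid.mk j b := by
  subst h; rw [← e]; rfl

/-- The unit of the tensor algebra. -/
def tensOne (B : BimodPair.{u}) : Tens B 0 := (1 : B.R)

theorem one_tensMul : ∀ {j : ℕ} (b : Tens B j),
    tensCast (Nat.zero_add j) (tensMul (tensOne B) b) = b
  | 0, b => one_mul (scal b)
  | j + 1, b => by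
    induction b using snoc_induction with
    | zero => simp only [tensMul_zero, map_zero]
    | snoc b m =>
      rw [tensMul_snoc]
      exact (tensCast_snoc (Nat.zero_add j) _ _ m).trans (by rw [one_tensMul])
    | add x y hx hy => simp only [tensMul_add, map_add, hx, hy]

theorem tensMul_assoc {i j : ℕ} : ∀ {k : ℕ} (a : Tens B i) (b : Tens B j) (c : Tens B k),
    tensCast (Nat.add_assoc i j k) (tensMul (tensMul a b) c) = tensMul a (tensMul b c)
  | 0, a, b, c => (tensMul_op_smul a (scal c) b).symm
  | k + 1, a, b, c => by
    induction c using snoc_induction with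
    | zero => simp only [tensMul_zero, map_zero]
    | snoc c m =>
      rw [tensMul_snoc, tensMul_snoc]
      refine (tensCast_snoc (Nat.add_assoc i j k) _ _ m).trans ?_
      rw [tensMul_assoc]
      exact (tensMul_snoc a _ m).symm
    | add x y hx hy =>
      simp only [tensMul_add, map_add, hx, hy]

instance (B : BimodPair.{u}) : GradedMonoid.GMul (Tens B) where
  mul a b := tensMul a b

instance (B : BimodPair.{u}) : GradedMonoid.GOne (Tens B) where
  one := tensOne B

instance (B : BimodPair.{u}) : DirectSum.GRing (Tens B) where
  mul_zero a := tensMul_zero a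
  zero_mul b := zero_tensMul b
  mul_add a b c := tensMul_add a b c
  add_mul a b c := add_tensMul a b c
  one_mul a := gradedMk_eq (Nat.zero_add _) (one_tensMul a.2)
  mul_one a := gradedMk_eq (Nat.add_zero _) (one_smul B.Rᵐᵒᵖ a.2)
  mul_assoc a b c := gradedMk_eq (Nat.add_assoc _ _ _) (tensMul_assoc a.2 b.2 c.2)
  natCast n := (n : B.R)
  natCast_zero := Nat.cast_zero (R := B.R)
  natCast_succ n := Nat.cast_succ (R := B.R) n
  intCast n := (n : B.R)
  intCast_ofNat n := Int.cast_natCast (R := B.R) n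
  intCast_negSucc_ofNat n := Int.cast_negSucc (R := B.R) n

/-- The tensor algebra `T(R; M) = ⨁ M^{⊗_R k}`. -/
abbrev TAlg (B : BimodPair.{u}) : Type u := ⨁ k, Tens B k

/-- The inclusion of `M^{⊗_R k}` into the tensor algebra. -/
abbrev tof {B : BimodPair.{u}} (k : ℕ) : Tens B k →+ TAlg B := DirectSum.of (Tens B) k

/-- The elementary tensor `m 0 ⊗ ⋯ ⊗ m (k - 1)` in `M^{⊗_R k}`. -/
def tprod (m : ℕ → B.M) : ∀ k : ℕ, Tens B k
  | 0 => tensOne B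
  | k + 1 => snoc (tprod m k) (m k)

/-- The ring homomorphism of tensor algebras induced by a morphism of bimodules. -/
def tAlgMap (f : B ⟶ C) : TAlg B →+* TAlg C :=
  DirectSum.toSemiring (fun k => (tof k).comp (tensMap f k))
    (congrArg (tof 0) (map_one f.ringHom))
    (fun {i j} a b => by
      change tof (i + j) (tensMap f (i + j) (tensMul a b)) = tof i _ * tof j _
      rw [tensMap_tensMul, DirectSum.of_mul_of]
      rfl)

theorem tAlgMap_of (f : B ⟶ C) (k : ℕ) (a : Tens B k) :
    tAlgMap f (tof k a) = tof k (tensMap f k a) :=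
  DirectSum.toSemiring_of _ _ _ _ _

/-! ### Cyclic tensor powers -/

/-- The map `M^{⊗_R k} → M^{⊗_R (k+1)}`, `a ↦ m ⊗ a`. -/
def consAux (m : B.M) : ∀ k : ℕ,
    RightHom (BimodPair.Hom.ringHom (𝟙 B)) (Tens B k) (Tens B (k + 1))
  | 0 =>
    { hom := AddMonoidHom.mk' (fun r => (snoc (tensOne B) (op (scal r) • m) : Tens B 1))
        (fun r s => by
          rw [← snoc_add_right]
          exact congrArg _ (add_smul (op (scal r)) (op (scal s)) m))
      map_op_smul := fun r s => by
        refine Eq.trans ?_ (op_smul_snoc (op r) (tensOne B) (op (scal s) • m)).symm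
        exact congrArg (fun x => (snoc (tensOne B) x : Tens B 1)) (mul_smul (op r) (op (scal s)) m) }
  | k + 1 => (consAux m k).snoc (𝟙 B)

/-- The element `m ⊗ a` of `M^{⊗_R (k+1)}`. -/
def cons {k : ℕ} (m : B.M) (a : Tens B k) : Tens B (k + 1) := (consAux m k).hom a

@[simp]
theorem cons_snoc {k : ℕ} (m : B.M) (a : Tens B k) (m' : B.M) :
    cons m (snoc a m') = snoc (cons m a) m' := (consAux m k).snoc_hom (𝟙 B) a m'

theorem cons_add {k : ℕ} (m : B.M) (a a' : Tens B k) : cons m (a + a') = cons m a + cons m a' :=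
  map_add _ _ _

theorem cons_zero {k : ℕ} (m : B.M) : cons m (0 : Tens B k) = 0 := map_zero _

theorem cons_op_smul {k : ℕ} (m : B.M) (r : B.R) (a : Tens B k) :
    cons m (op r • a) = op r • cons m a := (consAux m k).map_op_smul r a

theorem add_cons : ∀ {k : ℕ} (m m' : B.M) (a : Tens B k),
    cons (m + m') a = cons m a + cons m' a
  | 0, m, m', a => by
    change snoc _ (op (scal a) • (m + m')) = _
    rw [smul_add, snoc_add_right]; rfl
  | k + 1, m, m', a => by
    induction a using snoc_induction with
    | zero => simp only [cons_zero, add_zero]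
    | snoc b m'' => rw [cons_snoc, cons_snoc, cons_snoc, add_cons m m' b, snoc_add_left]
    | add x y hx hy => simp only [cons_add, hx, hy]; abel

theorem cons_smul : ∀ {k : ℕ} (m : B.M) (r : B.R) (a : Tens B k),
    cons m (r • a) = cons (op r • m) a
  | 0, m, r, a => by
    change snoc _ (op (r * scal a) • m) = snoc _ (op (scal a) • op r • m)
    rw [op_mul, mul_smul]
  | k + 1, m, r, a => by
    induction a using snoc_induction with
    | zero => rw [smul_zero, cons_zero, cons_zero]
    | snoc b m'' => rw [smul_snoc, cons_snoc, cons_snoc, cons_smul m r b]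
    | add x y hx hy => rw [smul_add, cons_add, cons_add, hx, hy]

theorem smul_cons : ∀ {k : ℕ} (m : B.M) (r : B.R) (a : Tens B k),
    cons (r • m) a = r • cons m a
  | 0, m, r, a => by
    change snoc _ (op (scal a) • r • m) = r • snoc (tensOne B) (op (scal a) • m)
    rw [smul_snoc, ← smul_comm, ← snoc_op_smul]
    refine congrArg (fun x => snoc x (op (scal a) • m)) ?_
    exact (one_mul r).trans (mul_one r).symm
  | k + 1, m, r, a => by
    induction a using snoc_induction with
    | zero => rw [cons_zero, cons_zero, smul_zero]
    | snoc b m'' => rw [cons_snoc, cons_snoc, smul_snoc, smul_cons m r b]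
    | add x y hx hy => rw [cons_add, cons_add, smul_add, hx, hy]

/-- The subgroup `[R, M^{⊗_R k}]` generated by the elements `r a - a r`. -/
def commSub (B : BimodPair.{u}) (k : ℕ) : AddSubgroup (Tens B k) :=
  AddSubgroup.closure {x | ∃ (r : B.R) (a : Tens B k), x = r • a - op r • a}

/-- The cyclic tensor power `M^{⊚_R k} = M^{⊗_R k} / [R, M^{⊗_R k}]`. -/
abbrev Cyc (B : BimodPair.{u}) (k : ℕ) : Type u := Tens B k ⧸ commSub B k

/-- The projection `M^{⊗_R k} → M^{⊚_R k}`. -/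
abbrev cycMk {k : ℕ} : Tens B k →+ Cyc B k := QuotientAddGroup.mk' (commSub B k)

theorem cycMk_smul {k : ℕ} (r : B.R) (a : Tens B k) : cycMk (r • a) = cycMk (op r • a) := by
  rw [← sub_eq_zero, ← map_sub]
  exact (QuotientAddGroup.eq_zero_iff _).2 (AddSubgroup.subset_closure ⟨r, a, rfl⟩)

/-- The generator of the cyclic group `C_k`, acting on `M^{⊚_R k}` by
`m_1 ⊗ ⋯ ⊗ m_k ↦ m_k ⊗ m_1 ⊗ ⋯ ⊗ m_{k-1}` (the identity for `k = 0`). -/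
def rot (B : BimodPair.{u}) : ∀ k : ℕ, Cyc B k →+ Cyc B k
  | 0 => AddMonoidHom.id _
  | k + 1 =>
    QuotientAddGroup.lift (commSub B (k + 1))
      (snocLift (fun a m => cycMk (cons m a))
        (fun a a' m => by rw [cons_add, map_add])
        (fun a m m' => by rw [add_cons, map_add])
        (fun a r m => by rw [cons_op_smul, smul_cons, cycMk_smul]))
      (by
        intro x hx
        refine (AddSubgroup.closure_le (AddMonoidHom.ker _)).2 ?_ hx
        clear hx x
        rintro _ ⟨r, a, rfl⟩
        change _ = _
        rw [map_sub, sub_eq_zero]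
        induction a using snoc_induction with
        | zero => simp
        | snoc a m => rw [smul_snoc, op_smul_snoc, snocLift_snoc, snocLift_snoc, cons_smul]
        | add x y hx hy =>
          rw [smul_add, smul_add, map_add, map_add, hx, hy])

theorem rot_mk_snoc {k : ℕ} (a : Tens B k) (m : B.M) :
    rot B (k + 1) (cycMk (snoc a m)) = cycMk (cons m a) := by
  simp only [rot, QuotientAddGroup.mk'_apply, QuotientAddGroup.lift_mk, snocLift_snoc]

/-- The subgroup `(M^{⊚_R k})^{C_k}` of invariants. -/
def cycInv (B : BimodPair.{u}) (k : ℕ) : AddSubgroup (Cyc B k) :=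
  AddMonoidHom.ker (rot B k - AddMonoidHom.id _)

/-- The sum `∑ σ^s x` over `0 ≤ s < d`, where `σ` generates `C_k`. For `d ∣ k` and `x` invariant
under the subgroup `C_{k/d}`, generated by `σ^d`, this is the transfer of `x` from `C_{k/d}`
to `C_k`. -/
def transfer (B : BimodPair.{u}) (k d : ℕ) (x : Cyc B k) : Cyc B k :=
  ∑ s ∈ Finset.range d, (rot B k)^[s] x

/-! ### Special units of the completed tensor algebra -/

/-- The monoid `1 × ∏_{k ≥ 1} M^{⊗_R k}` of special units in the completed tensor algebra
`∏_k M^{⊗_R k}`, realised as the power series `1 + m_1 t + m_2 t^2 + ⋯` over the tensor algebra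
with `m_k` in `M^{⊗_R k}`. -/
def specialUnits (B : BimodPair.{u}) : Submonoid (PowerSeries (TAlg B)) where
  carrier := {f | PowerSeries.coeff 0 f = 1 ∧ ∀ k, PowerSeries.coeff k f ∈ (tof (B := B) k).range}
  one_mem' := by
    refine ⟨by simp, fun k => ?_⟩
    rw [PowerSeries.coeff_one]
    split_ifs with h
    · subst h; exact ⟨tensOne B, rfl⟩
    · exact zero_mem _
  mul_mem' := by
    rintro f g ⟨hf, hf'⟩ ⟨hg, hg'⟩
    refine ⟨by simp_all, fun k => ?_⟩
    rw [PowerSeries.coeff_mul]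
    refine sum_mem fun x hx => ?_
    obtain ⟨i, j⟩ := x
    obtain rfl : i + j = k := Finset.HasAntidiagonal.mem_antidiagonal.1 hx
    obtain ⟨a, ha⟩ := hf' i
    obtain ⟨b, hb⟩ := hg' j
    exact ⟨tensMul a b, by rw [← ha, ← hb]; exact (DirectSum.of_mul_of _ _).symm⟩

theorem invOfUnit_mem {f : PowerSeries (TAlg B)} (hf : f ∈ specialUnits B) :
    PowerSeries.invOfUnit f 1 ∈ specialUnits B := by
  refine ⟨by simp [PowerSeries.coeff_invOfUnit], fun k => ?_⟩
  induction k using Nat.strong_induction_on with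
  | _ k ih =>
    rw [PowerSeries.coeff_invOfUnit]
    split_ifs with h
    · subst h; exact ⟨tensOne B, by simp; rfl⟩
    · rw [inv_one, Units.val_one, neg_mul, one_mul]
      refine neg_mem (sum_mem fun x hx => ?_)
      obtain ⟨i, j⟩ := x
      obtain rfl : i + j = k := Finset.HasAntidiagonal.mem_antidiagonal.1 hx
      dsimp only
      split_ifs with hj
      · obtain ⟨a, ha⟩ := hf.2 i
        obtain ⟨b, hb⟩ := ih j hj
        exact ⟨tensMul a b, by rw [← ha, ← hb]; exact (DirectSum.of_mul_of _ _).symm⟩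
      · exact zero_mem _

instance (B : BimodPair.{u}) : Group (specialUnits B) :=
  { (inferInstance : Monoid (specialUnits B)) with
    inv := fun f => ⟨PowerSeries.invOfUnit f.1 1, invOfUnit_mem f.2⟩
    inv_mul_cancel := fun f => Subtype.ext (PowerSeries.invOfUnit_mul f.1 1
      (by rw [← PowerSeries.coeff_zero_eq_constantCoeff_apply]; exact f.2.1)) }

/-- The product topology on `1 × ∏_{k ≥ 1} M^{⊗_R k}`, each factor being discrete. -/
instance (B : BimodPair.{u}) : TopologicalSpace (specialUnits B) :=
  TopologicalSpace.induced (fun f k => PowerSeries.coeff k f.1)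
    (@Pi.topologicalSpace ℕ (fun _ => TAlg B) (fun _ => ⊥))

/-- The special unit `1 - a t^k`, for `k ≠ 0` and `a ∈ M^{⊗_R k}`. -/
def oneSub {k : ℕ} (hk : k ≠ 0) (a : Tens B k) : specialUnits B :=
  ⟨1 - PowerSeries.monomial k (tof k a), by
    refine ⟨by rw [map_sub, PowerSeries.coeff_monomial, if_neg hk.symm]; simp, fun l => ?_⟩
    rw [map_sub]
    refine sub_mem ((one_mem (specialUnits B)).2 l) ?_
    rw [PowerSeries.coeff_monomial]
    split_ifs with h
    · subst h; exact ⟨a, rfl⟩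
    · exact zero_mem _⟩

/-- The special unit `τ(m) = 1 - m t`. -/
def tau (m : B.M) : specialUnits B := oneSub one_ne_zero (snoc (tensOne B) m)

/-- The homomorphism of groups of special units induced by a morphism of bimodules. -/
def suMap (f : B ⟶ C) : specialUnits B →* specialUnits C where
  toFun x := ⟨PowerSeries.map (tAlgMap f) x.1, by
    refine ⟨?_, fun k => ?_⟩
    · rw [PowerSeries.coeff_map, x.2.1, map_one]
    · rw [PowerSeries.coeff_map]
      obtain ⟨a, ha⟩ := x.2.2 k
      exact ⟨tensMap f k a, by rw [← ha, tAlgMap_of]⟩⟩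
  map_one' := Subtype.ext (map_one _)
  map_mul' x y := Subtype.ext (map_mul _ _ _)

theorem continuous_suMap (f : B ⟶ C) : Continuous (suMap f) := by
  let : TopologicalSpace (TAlg B) := ⊥
  let : TopologicalSpace (TAlg C) := ⊥
  have : DiscreteTopology (TAlg B) := ⟨rfl⟩
  refine continuous_induced_rng.2 (continuous_pi fun k => ?_)
  have h0 : Continuous fun (x : specialUnits B) (k : ℕ) => PowerSeries.coeff k x.1 :=
    continuous_induced_dom
  have h1 : Continuous fun x : specialUnits B => PowerSeries.coeff k x.1 :=
    (continuous_apply k).comp h0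
  have h2 : Continuous (tAlgMap f) := continuous_of_discreteTopology
  convert h2.comp h1 using 2 with x
  exact PowerSeries.coeff_map _ _ _

theorem suMap_oneSub (f : B ⟶ C) {k : ℕ} (hk : k ≠ 0) (a : Tens B k) :
    suMap f (oneSub hk a) = oneSub hk (tensMap f k a) := by
  refine Subtype.ext ?_
  change PowerSeries.map (tAlgMap f) (1 - PowerSeries.monomial k (tof k a)) = 1 - _
  rw [map_sub, map_one]
  congr 1
  refine PowerSeries.ext fun l => ?_
  rw [PowerSeries.coeff_map, PowerSeries.coeff_monomial, PowerSeries.coeff_monomial]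
  split_ifs
  · rw [tAlgMap_of]
  · exact map_zero (tAlgMap f)

theorem suMap_tau (f : B ⟶ C) (m : B.M) : suMap f (tau m) = tau (f.addHom m) := by
  rw [tau, suMap_oneSub]
  refine congrArg (oneSub one_ne_zero) ((tensMap_snoc f (tensOne B) m).trans ?_)
  refine congrArg (fun x => snoc x (f.addHom m)) ?_
  exact map_one f.ringHom

theorem tensMap_tprod (f : B ⟶ C) (m : ℕ → B.M) : ∀ k : ℕ,
    tensMap f k (tprod m k) = tprod (fun i => f.addHom (m i)) k
  | 0 => map_one f.ringHom
  | k + 1 => by rw [tprod, tensMap_snoc, tensMap_tprod f m k, tprod]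

/-! ### Witt vectors with coefficients, through power series -/

/-- The elements that are killed in `W_{⟨p^n⟩}(R; M)`: commutators, the quotients
`τ(r m) / τ(m r)`, and the series `1 - m_1 ⊗ ⋯ ⊗ m_k t^k` for `k ≥ 1` outside
`{1, p, …, p^n}`. -/
def wittRel (p n : ℕ) (B : BimodPair.{u}) : Set (specialUnits B) :=
  {x | (∃ a b : specialUnits B, x = a * b * a⁻¹ * b⁻¹) ∨ (∃ (r : B.R) (m : B.M), x = tau (r • m) * (tau (op r • m))⁻¹) ∨
    ∃ (k : ℕ) (hk : k ≠ 0) (m : ℕ → B.M), (∀ i ≤ n, k ≠ p ^ i) ∧ x = oneSub hk (tprod m k)}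

/-- The smallest closed normal subgroup containing `wittRel`. -/
def wittSub (p n : ℕ) (B : BimodPair.{u}) : Subgroup (specialUnits B) :=
  sInf {H | H.Normal ∧ IsClosed (H : Set (specialUnits B)) ∧ wittRel p n B ⊆ H}

instance (p n : ℕ) (B : BimodPair.{u}) : (wittSub p n B).Normal where
  conj_mem x hx g := by
    rw [wittSub, Subgroup.mem_sInf] at hx ⊢
    exact fun H hH => hH.1.conj_mem x (hx H hH) g

theorem wittRel_subset (p n : ℕ) (B : BimodPair.{u}) : wittRel p n B ⊆ wittSub p n B :=
  fun _ hx => Subgroup.mem_sInf.2 fun _ hH => hH.2.2 hx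

/-- The group `W_{⟨p^n⟩}(R; M)` of `p`-typical `(n+1)`-truncated Witt vectors of `R` with
coefficients in `M`, written additively: the abelian Hausdorff quotient of the group of special
units by the closed normal subgroup generated by the relations `wittRel`. -/
def WittTrunc (p n : ℕ) (B : BimodPair.{u}) : Type u :=
  Additive (specialUnits B ⧸ wittSub p n B)

instance (p n : ℕ) (B : BimodPair.{u}) : AddCommGroup (WittTrunc p n B) :=
  { (inferInstance : AddGroup (Additive (specialUnits B ⧸ wittSub p n B))) with
    add_comm := fun x y => by
      change specialUnits B ⧸ wittSub p n B at x y
      induction x using QuotientGroup.induction_on with | H x => ?_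
      induction y using QuotientGroup.induction_on with | H y => ?_
      change ((x * y : specialUnits B) : specialUnits B ⧸ wittSub p n B) = (y * x : specialUnits B)
      refine (QuotientGroup.eq.2 (wittRel_subset p n B (Or.inl ⟨x⁻¹, y⁻¹, ?_⟩))).symm
      group }

/-- The class in `W_{⟨p^n⟩}(R; M)` of a special unit. -/
def wMk (p n : ℕ) (x : specialUnits B) : WittTrunc p n B :=
  Additive.ofMul (QuotientGroup.mk' (wittSub p n B) x)

theorem wittSub_le_comap (p n : ℕ) (f : B ⟶ C) :
    wittSub p n B ≤ (wittSub p n C).comap (suMap f) := by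
  intro x hx
  rw [Subgroup.mem_comap, wittSub, Subgroup.mem_sInf]
  intro H hH
  refine Subgroup.mem_sInf.1 hx (H.comap (suMap f)) ⟨hH.1.comap _, ?_, ?_⟩
  · exact hH.2.1.preimage (continuous_suMap f)
  · rintro _ (⟨a, b, rfl⟩ | ⟨r, m, rfl⟩ | ⟨k, hk, m, h, rfl⟩) <;> refine hH.2.2 ?_
    · exact Or.inl ⟨suMap f a, suMap f b, by simp only [map_mul, map_inv]⟩
    · exact Or.inr (Or.inl ⟨f.ringHom r, f.addHom m, by
        rw [map_mul, map_inv, suMap_tau, suMap_tau, f.map_smul, f.map_op_smul]⟩)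
    · exact Or.inr (Or.inr ⟨k, hk, _, h, by rw [suMap_oneSub, tensMap_tprod]⟩)

/-- The functoriality of `W_{⟨p^n⟩}`. -/
def wMap (p n : ℕ) (f : B ⟶ C) : WittTrunc p n B →+ WittTrunc p n C :=
  MonoidHom.toAdditive
    (QuotientGroup.map (wittSub p n B) (wittSub p n C) (suMap f) (wittSub_le_comap p n f))

/-- The coefficient of `t^N` in the logarithmic derivative `- f⁻¹ · t df` of a special unit
`f = 1 + ∑ f_k t^k`, where `d` inserts the transfer: it is
`- ∑_{i + k = N} ∑_{0 ≤ s < k} σ^s [(f⁻¹)_i ⊗ f_k]` in `M^{⊚_R N}`. -/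
def tlogCoeff (x : specialUnits B) (N : ℕ) : Cyc B N :=
  - ∑ ik ∈ Finset.HasAntidiagonal.antidiagonal N,
    transfer B N ik.2 (cycMk ((PowerSeries.coeff ik.1 (x⁻¹ : specialUnits B).1 * PowerSeries.coeff ik.2 x.1) N))

/-! ### Witt vectors with coefficients, through Witt coordinates -/

/-- The product `∏_{0 ≤ i < N} M^{⊗_R p^i}`. -/
abbrev Coord (p N : ℕ) (B : BimodPair.{u}) : Type u := ∀ i : Fin N, Tens B (p ^ (i : ℕ))

/-- The map of products of tensor powers induced by a morphism of bimodules. -/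
def coordMap (p N : ℕ) (f : B ⟶ C) (a : Coord p N B) : Coord p N C := fun i => tensMap f _ (a i)

/-- The ghost map: its `j`-th component is the sum over `i ≤ j` of the transfers from `C_{p^{j-i}}`
to `C_{p^j}` of the class of `(m_i)^{⊗ p^{j-i}}`; this power is taken in the tensor algebra, where
it is homogeneous of degree `p^j`. -/
def ghost (p N : ℕ) (m : Coord p N B) (j : Fin N) : Cyc B (p ^ (j : ℕ)) :=
  ∑ i : Fin N with i ≤ j, transfer B (p ^ (j : ℕ)) (p ^ (i : ℕ))
    (cycMk ((tof (p ^ (i : ℕ)) (m i) ^ p ^ ((j : ℕ) - (i : ℕ)) : TAlg B) (p ^ (j : ℕ))))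

/-- The pair `(R; M)` is free: `R` is a free (non-commutative) ring `ℤ{X}` and `M` is a free
`R`-bimodule, that is, a free module over `R ⊗ Rᵐᵒᵖ`. -/
def BimodPair.IsFree (B : BimodPair.{u}) : Prop :=
  (∃ X : Type u, Nonempty (FreeAlgebra ℤ X ≃+* B.R)) ∧
    letI : Module (B.R ⊗[ℤ] B.Rᵐᵒᵖ) B.M := TensorProduct.Algebra.module
    Module.Free (B.R ⊗[ℤ] B.Rᵐᵒᵖ) B.M

/-- A free resolution of `(R; M)`: a reflexive coequaliser diagram
`S₁ ⇉ S₀ → (R; M)` of bimodules in which `S₀` and `S₁` are free pairs. -/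
structure FreeResolution (B : BimodPair.{u}) where
  S₁ : BimodPair.{u}
  S₀ : BimodPair.{u}
  free₁ : S₁.IsFree
  free₀ : S₀.IsFree
  f : S₁ ⟶ S₀
  g : S₁ ⟶ S₀
  s : S₀ ⟶ S₁
  ε : S₀ ⟶ B
  s_f : s ≫ f = 𝟙 S₀
  s_g : s ≫ g = 𝟙 S₀
  w : f ≫ ε = g ≫ ε
  isCoequalizer : Nonempty (Limits.IsColimit (Limits.Cofork.ofπ ε w))

/-- The relation on `∏_{0 ≤ i < N} M^{⊗_R p^i}` whose generated equivalence relation defines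
`W_{N,p}(R; M)`. -/
def coordRel (p N : ℕ) {B : BimodPair.{u}} (P : FreeResolution B) (a b : Coord p N B) : Prop :=
  ∃ (q v : Coord p N P.S₀) (z : Coord p N P.S₁),
    coordMap p N P.ε q = a ∧ coordMap p N P.ε v = b ∧
    ghost p N q = ghost p N (coordMap p N P.f z) ∧ ghost p N v = ghost p N (coordMap p N P.g z)

/-- The set `W_{N,p}(R; M)`, computed with a free resolution of `(R; M)`: the quotient of
`∏_{0 ≤ i < N} M^{⊗_R p^i}` by the equivalence relation generated by `coordRel`. -/
def WittCoord (p N : ℕ) {B : BimodPair.{u}} (P : FreeResolution B) : Type u := Quot (coordRel p N P)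

/-- The class in `W_{N,p}(R; M)` of a tuple. -/
def coordMk (p N : ℕ) {B : BimodPair.{u}} (P : FreeResolution B) (a : Coord p N B) :
    WittCoord p N P := Quot.mk _ a

/-- The class in `W_{⟨p^n⟩}(R; M)` of the product `∏_{i=0}^n (1 - m_i t^{p^i})`. -/
def gammaRep (p n : ℕ) [hp : Fact p.Prime] (m : Coord p (n + 1) B) : WittTrunc p n B :=
  wMk p n (List.ofFn fun i : Fin (n + 1) => oneSub (pow_ne_zero i hp.out.ne_zero) (m i)).prod

/-! ### The symmetric monoidal structure on bimodules -/

section Tensor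

/-- The action of `R ⊗ S` on `M ⊗ N`, given by `(r ⊗ s) (m ⊗ n) = r m ⊗ s n`. -/
def tensorAction (R S M N : Type u) [Ring R] [Ring S] [AddCommGroup M] [AddCommGroup N]
    [Module R M] [Module S N] : R ⊗[ℤ] S →+* Module.End ℤ (M ⊗[ℤ] N) :=
  ((Module.endTensorEndAlgHom (R := ℤ) (S := ℤ) (A := ℤ) (M := M) (N := N)).comp
    (Algebra.TensorProduct.map (Algebra.lsmul ℤ ℤ M : R →ₐ[ℤ] Module.End ℤ M)
      (Algebra.lsmul ℤ ℤ N : S →ₐ[ℤ] Module.End ℤ N))).toRingHom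

theorem tensorAction_tmul {R S M N : Type u} [Ring R] [Ring S] [AddCommGroup M] [AddCommGroup N]
    [Module R M] [Module S N] (r : R) (s : S) (m : M) (n : N) :
    tensorAction R S M N (r ⊗ₜ s) (m ⊗ₜ n) = (r • m) ⊗ₜ (s • n) := rfl

/-- The right action of `R ⊗ S` on `M ⊗ N`, given by `(m ⊗ n) (r ⊗ s) = m r ⊗ n s`. -/
def tensorOpAction (R S M N : Type u) [Ring R] [Ring S] [AddCommGroup M] [AddCommGroup N]
    [Module Rᵐᵒᵖ M] [Module Sᵐᵒᵖ N] : (R ⊗[ℤ] S)ᵐᵒᵖ →+* Module.End ℤ (M ⊗[ℤ] N) :=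
  (tensorAction Rᵐᵒᵖ Sᵐᵒᵖ M N).comp
    (Algebra.TensorProduct.opAlgEquiv ℤ ℤ R S).symm.toRingEquiv.toRingHom

theorem tensorOpAction_tmul {R S M N : Type u} [Ring R] [Ring S] [AddCommGroup M] [AddCommGroup N]
    [Module Rᵐᵒᵖ M] [Module Sᵐᵒᵖ N] (r : R) (s : S) (m : M) (n : N) :
    tensorOpAction R S M N (op (r ⊗ₜ s)) (m ⊗ₜ n) = (op r • m) ⊗ₜ (op s • n) := rfl

/-- The tensor product `(R ⊗ S; M ⊗ N)` of bimodules, taken over `ℤ` in both components. -/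
def BimodPair.tensor (B C : BimodPair.{u}) : BimodPair.{u} :=
  letI : Module (B.R ⊗[ℤ] C.R) (B.M ⊗[ℤ] C.M) :=
    Module.compHom _ (tensorAction B.R C.R B.M C.M)
  letI : Module (B.R ⊗[ℤ] C.R)ᵐᵒᵖ (B.M ⊗[ℤ] C.M) :=
    Module.compHom _ (tensorOpAction B.R C.R B.M C.M)
  { R := B.R ⊗[ℤ] C.R
    M := B.M ⊗[ℤ] C.M
    smulComm := ⟨fun x y z => by
      change tensorAction B.R C.R B.M C.M x (tensorOpAction B.R C.R B.M C.M y z) =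
        tensorOpAction B.R C.R B.M C.M y (tensorAction B.R C.R B.M C.M x z)
      induction y using MulOpposite.rec' with | h y => ?_
      induction x with
      | zero => simp
      | add x x' hx hx' => simp only [map_add, LinearMap.add_apply, hx, hx']
      | tmul r s =>
        induction y with
        | zero => simp
        | add y y' hy hy' => rw [MulOpposite.op_add, map_add, LinearMap.add_apply, LinearMap.add_apply, map_add, hy, hy']
        | tmul r' s' =>
          induction z with
          | zero => simp
          | add z z' hz hz' => simp only [map_add, hz, hz']
          | tmul m n =>
            change (r • op r' • m) ⊗ₜ[ℤ] (s • op s' • n) = (op r' • r • m) ⊗ₜ[ℤ] (op s' • s • n)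
            rw [smul_comm r, smul_comm s]⟩ }

/-- The element `m ⊗ n` of the bimodule `M ⊗ N`. -/
def mtmul (m : B.M) (n : C.M) : (B.tensor C).M := m ⊗ₜ[ℤ] n

/-- The element `r ⊗ s` of the ring `R ⊗ S`. -/
def rtmul (r : B.R) (s : C.R) : (B.tensor C).R := r ⊗ₜ[ℤ] s

theorem rtmul_smul (r : B.R) (s : C.R) (m : B.M) (n : C.M) :
    rtmul r s • mtmul m n = mtmul (r • m) (s • n) := rfl

theorem op_rtmul_smul (r : B.R) (s : C.R) (m : B.M) (n : C.M) :
    op (rtmul r s) • mtmul m n = mtmul (op r • m) (op s • n) := rfl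

theorem mtmul_induction {P : (B.tensor C).M → Prop} (x : (B.tensor C).M) (zero : P 0)
    (tmul : ∀ m n, P (mtmul m n)) (add : ∀ x y, P x → P y → P (x + y)) : P x :=
  TensorProduct.induction_on (R := ℤ) (M := B.M) (N := C.M) x zero tmul add

theorem rtmul_induction {P : (B.tensor C).R → Prop} (x : (B.tensor C).R) (zero : P 0)
    (tmul : ∀ r s, P (rtmul r s)) (add : ∀ x y, P x → P y → P (x + y)) : P x :=
  TensorProduct.induction_on (R := ℤ) (M := B.R) (N := C.R) x zero tmul add

theorem add_rtmul (r r' : B.R) (s : C.R) : rtmul (r + r') s = rtmul r s + rtmul r' s :=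
  TensorProduct.add_tmul r r' s

theorem zero_rtmul (s : C.R) : rtmul (0 : B.R) s = 0 := TensorProduct.zero_tmul _ s

theorem add_mtmul (m m' : B.M) (n : C.M) : mtmul (m + m') n = mtmul m n + mtmul m' n :=
  TensorProduct.add_tmul m m' n

theorem mtmul_add (m : B.M) (n n' : C.M) : mtmul m (n + n') = mtmul m n + mtmul m n' :=
  TensorProduct.tmul_add m n n'

theorem zero_mtmul (n : C.M) : mtmul (0 : B.M) n = 0 := TensorProduct.zero_tmul _ n

/-- To give a morphism out of `(R ⊗ S; M ⊗ N)` it is enough to check the compatibilities on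
elementary tensors. -/
def homOfTensor (φ : (B.tensor C).R →+* D.R) (ψ : (B.tensor C).M →+ D.M)
    (h : ∀ r s m n, ψ (rtmul r s • mtmul m n) = φ (rtmul r s) • ψ (mtmul m n))
    (h' : ∀ r s m n, ψ (op (rtmul r s) • mtmul m n) = op (φ (rtmul r s)) • ψ (mtmul m n)) :
    B.tensor C ⟶ D where
  ringHom := φ
  addHom := ψ
  map_smul r m := by
    induction r using rtmul_induction with
    | zero => simp
    | add x y hx hy => rw [add_smul, map_add, map_add, add_smul, hx, hy]
    | tmul r s =>
      induction m using mtmul_induction with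
      | zero => simp
      | add x y hx hy => rw [smul_add, map_add, map_add, smul_add, hx, hy]
      | tmul m n => exact h r s m n
  map_op_smul r m := by
    induction r using rtmul_induction with
    | zero => simp
    | add x y hx hy => rw [MulOpposite.op_add, add_smul, map_add, map_add, MulOpposite.op_add, add_smul, hx, hy]
    | tmul r s =>
      induction m using mtmul_induction with
      | zero => simp
      | add x y hx hy => rw [smul_add, map_add, map_add, smul_add, hx, hy]
      | tmul m n => exact h' r s m n

/-- The tensor product of two morphisms. -/
def tensorHom {B' C' : BimodPair.{u}} (f : B ⟶ B') (g : C ⟶ C') : B.tensor C ⟶ B'.tensor C' :=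
  homOfTensor (D := B'.tensor C')
    (Algebra.TensorProduct.map f.ringHom.toIntAlgHom g.ringHom.toIntAlgHom).toRingHom
    (TensorProduct.map f.addHom.toIntLinearMap g.addHom.toIntLinearMap).toAddMonoidHom
    (fun r s m n => congrArg₂ mtmul (f.map_smul r m) (g.map_smul s n))
    (fun r s m n => congrArg₂ mtmul (f.map_op_smul r m) (g.map_op_smul s n))

/-- The symmetry `(R ⊗ S; M ⊗ N) → (S ⊗ R; N ⊗ M)`. -/
def braiding (B C : BimodPair.{u}) : B.tensor C ⟶ C.tensor B :=
  homOfTensor (D := C.tensor B)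
    (Algebra.TensorProduct.comm ℤ B.R C.R).toAlgHom.toRingHom
    (TensorProduct.comm ℤ B.M C.M).toLinearMap.toAddMonoidHom
    (fun _ _ _ _ => rfl) (fun _ _ _ _ => rfl)

/-- The associativity isomorphism on rings. -/
def assocRing (B C D : BimodPair.{u}) :
    ((B.tensor C).tensor D).R →+* (B.tensor (C.tensor D)).R :=
  (Algebra.TensorProduct.assoc ℤ ℤ ℤ B.R C.R D.R).toAlgHom.toRingHom

/-- The associativity isomorphism on bimodules. -/
def assocAdd (B C D : BimodPair.{u}) :
    ((B.tensor C).tensor D).M →+ (B.tensor (C.tensor D)).M :=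
  (TensorProduct.assoc ℤ B.M C.M D.M).toLinearMap.toAddMonoidHom

/-- The associativity isomorphism of the tensor product of bimodules. -/
def associator (B C D : BimodPair.{u}) : (B.tensor C).tensor D ⟶ B.tensor (C.tensor D) :=
  homOfTensor (B := B.tensor C) (C := D) (D := B.tensor (C.tensor D))
    (assocRing B C D) (assocAdd B C D)
    (fun r s m n => by
      induction r using rtmul_induction with
      | zero => simp only [zero_rtmul, zero_smul, map_zero]
      | add x y hx hy => simp only [add_rtmul, add_smul, map_add, hx, hy]
      | tmul r r' =>
        induction m using mtmul_induction with
        | zero => simp only [zero_mtmul, smul_zero, map_zero]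
        | add x y hx hy => simp only [add_mtmul, smul_add, map_add, hx, hy]
        | tmul m m' => rfl)
    (fun r s m n => by
      induction r using rtmul_induction with
      | zero => simp only [zero_rtmul, op_zero, zero_smul, map_zero]
      | add x y hx hy => simp only [add_rtmul, MulOpposite.op_add, add_smul, map_add, hx, hy]
      | tmul r r' =>
        induction m using mtmul_induction with
        | zero => simp only [zero_mtmul, smul_zero, map_zero]
        | add x y hx hy => simp only [add_mtmul, smul_add, map_add, hx, hy]
        | tmul m m' => rfl)

/-- The monoidal unit `(ℤ; ℤ)`. -/
def unitPair : BimodPair.{u} := BimodPair.self (ULift.{u} ℤ)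

/-- The unit isomorphism `(ℤ ⊗ R; ℤ ⊗ M) → (R; M)`. -/
def leftUnitor (B : BimodPair.{u}) : unitPair.tensor B ⟶ B :=
  homOfTensor (B := unitPair) (C := B) (D := B)
    ((Algebra.TensorProduct.lid ℤ B.R).toAlgHom.comp
      (Algebra.TensorProduct.map (ULift.ringEquiv (R := ℤ)).toRingHom.toIntAlgHom
        (AlgHom.id ℤ B.R))).toRingHom
    ((TensorProduct.lid ℤ B.M).toLinearMap.comp
      (TensorProduct.map (AddEquiv.ulift (α := ℤ)).toAddMonoidHom.toIntLinearMap
        LinearMap.id)).toAddMonoidHom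
    (fun r s m n => by
      change (r.down * m.down) • (s • n) = (r.down • s) • (m.down • n)
      rw [smul_assoc, mul_smul, smul_comm s m.down n])
    (fun r s m n => by
      change (m.down * r.down) • (op s • n) = op (r.down • s) • (m.down • n)
      rw [MulOpposite.op_smul, smul_assoc, smul_comm (op s) m.down n, mul_comm, mul_smul])

/-- The unit isomorphism `(R ⊗ ℤ; M ⊗ ℤ) → (R; M)`. -/
def rightUnitor (B : BimodPair.{u}) : B.tensor unitPair ⟶ B := braiding B unitPair ≫ leftUnitor B

end Tensor

/-! ### Multiplicative structure of the cyclic tensor powers -/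

/-- A biadditive map `M^{⊗_R k} × N^{⊗_S k} → (M ⊗ N)^{⊗_{R ⊗ S} k}` that is compatible with right
multiplication. -/
structure RightPairing (B C : BimodPair.{u}) (k : ℕ) where
  hom : Tens B k →+ Tens C k →+ Tens (B.tensor C) k
  map_op_smul : ∀ (a : Tens B k) (b : Tens C k) (r : B.R) (s : C.R),
    hom (op r • a) (op s • b) = op (rtmul r s) • hom a b

namespace RightPairing

variable {k : ℕ} (g : RightPairing B C k)

theorem op_smul_left (a : Tens B k) (b : Tens C k) (r : B.R) :
    g.hom (op r • a) b = op (rtmul r (1 : C.R)) • g.hom a b := by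
  have := g.map_op_smul a b r 1
  rwa [op_one, one_smul] at this

theorem op_smul_right (a : Tens B k) (b : Tens C k) (s : C.R) :
    g.hom a (op s • b) = op (rtmul (1 : B.R) s) • g.hom a b := by
  have := g.map_op_smul a b 1 s
  rwa [op_one, one_smul] at this

/-- The map `b ⊗ n ↦ g(a, b) ⊗ (m ⊗ n)`. -/
def snocRight (a : Tens B k) (m : B.M) : Tens C (k + 1) →+ Tens (B.tensor C) (k + 1) :=
  snocLift (fun b n => snoc (g.hom a b) (mtmul m n))
    (fun b b' n => by rw [map_add, snoc_add_left])
    (fun b n n' => by rw [mtmul_add, snoc_add_right])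
    (fun b s n => by rw [g.op_smul_right, snoc_op_smul, rtmul_smul, one_smul])

theorem snocRight_snoc (a : Tens B k) (m : B.M) (b : Tens C k) (n : C.M) :
    g.snocRight a m (snoc b n) = snoc (g.hom a b) (mtmul m n) := by
  simp only [snocRight, snocLift_snoc]

/-- The map `(a ⊗ m, b ⊗ n) ↦ g(a, b) ⊗ (m ⊗ n)`. -/
def snocHom : Tens B (k + 1) →+ Tens C (k + 1) →+ Tens (B.tensor C) (k + 1) :=
  snocLift (fun a m => g.snocRight a m)
    (fun a a' m => snoc_hom_ext fun b n => by
      rw [AddMonoidHom.add_apply, snocRight_snoc, snocRight_snoc, snocRight_snoc, map_add,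
        AddMonoidHom.add_apply, snoc_add_left])
    (fun a m m' => snoc_hom_ext fun b n => by
      rw [AddMonoidHom.add_apply, snocRight_snoc, snocRight_snoc, snocRight_snoc, add_mtmul,
        snoc_add_right])
    (fun a r m => snoc_hom_ext fun b n => by
      rw [snocRight_snoc, snocRight_snoc, g.op_smul_left, snoc_op_smul, rtmul_smul, one_smul])

theorem snocHom_snoc (a : Tens B k) (m : B.M) (b : Tens C k) (n : C.M) :
    g.snocHom (snoc a m) (snoc b n) = snoc (g.hom a b) (mtmul m n) := by
  simp only [snocHom, snocLift_snoc, snocRight_snoc]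

/-- The pairing `(a ⊗ m, b ⊗ n) ↦ g(a, b) ⊗ (m ⊗ n)`. -/
def snoc : RightPairing B C (k + 1) where
  hom := g.snocHom
  map_op_smul a b r s := by
    induction a using snoc_induction with
    | zero => rw [smul_zero, map_zero, AddMonoidHom.zero_apply, AddMonoidHom.zero_apply, smul_zero]
    | add x y hx hy =>
      rw [smul_add, map_add, map_add, AddMonoidHom.add_apply, AddMonoidHom.add_apply, hx, hy,
        smul_add]
    | snoc a m =>
      induction b using snoc_induction with
      | zero => rw [smul_zero, map_zero, map_zero, smul_zero]
      | add x y hx hy => rw [smul_add, map_add, map_add, hx, hy, smul_add]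
      | snoc b n =>
        rw [op_smul_snoc, op_smul_snoc, snocHom_snoc, snocHom_snoc, op_smul_snoc, op_rtmul_smul]

end RightPairing

/-- The pairing `R × S → R ⊗ S`. -/
def pairingZero (B C : BimodPair.{u}) : Tens B 0 →+ Tens C 0 →+ Tens (B.tensor C) 0 :=
  AddMonoidHom.mk' (fun r => AddMonoidHom.mk' (fun s => (rtmul (scal r) (scal s) : (B.tensor C).R))
      (fun s s' => TensorProduct.tmul_add (scal r) (scal s) (scal s')))
    (fun r r' => AddMonoidHom.ext fun s => add_rtmul (scal r) (scal r') (scal s))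

theorem rtmul_mul (r r' : B.R) (s s' : C.R) :
    rtmul r s * rtmul r' s' = rtmul (r * r') (s * s') :=
  Algebra.TensorProduct.tmul_mul_tmul (R := ℤ) r r' s s'

/-- The shuffle pairing, with its right linearity. -/
def shuffleAux (B C : BimodPair.{u}) : ∀ k : ℕ, RightPairing B C k
  | 0 => ⟨pairingZero B C, fun a b r s => (rtmul_mul (scal a) r (scal b) s).symm⟩
  | k + 1 => (shuffleAux B C k).snoc

/-- The shuffle pairing `M^{⊗_R k} × N^{⊗_S k} → (M ⊗ N)^{⊗_{R ⊗ S} k}`, which sends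
`(m_1 ⊗ ⋯ ⊗ m_k, n_1 ⊗ ⋯ ⊗ n_k)` to `(m_1 ⊗ n_1) ⊗ ⋯ ⊗ (m_k ⊗ n_k)`. -/
def shuffle (k : ℕ) : Tens B k →+ Tens C k →+ Tens (B.tensor C) k := (shuffleAux B C k).hom

theorem shuffle_op_smul {k : ℕ} (a : Tens B k) (b : Tens C k) (r : B.R) (s : C.R) :
    shuffle k (op r • a) (op s • b) = op (rtmul r s) • shuffle k a b := (shuffleAux B C k).map_op_smul a b r s

theorem shuffle_snoc {k : ℕ} (a : Tens B k) (b : Tens C k) (m : B.M) (n : C.M) :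
    shuffle (k + 1) (snoc a m) (snoc b n) = snoc (shuffle k a b) (mtmul m n) :=
  (shuffleAux B C k).snocHom_snoc a m b n

theorem shuffle_smul : ∀ {k : ℕ} (a : Tens B k) (b : Tens C k) (r : B.R) (s : C.R),
    shuffle k (r • a) (s • b) = rtmul r s • shuffle k a b
  | 0, a, b, r, s => (rtmul_mul r (scal a) s (scal b)).symm
  | k + 1, a, b, r, s => by
    induction a using snoc_induction with
    | zero => simp
    | add x y hx hy => simp only [smul_add, map_add, AddMonoidHom.add_apply, hx, hy]
    | snoc a m =>
      induction b using snoc_induction with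
      | zero => simp
      | add x y hx hy => simp only [smul_add, map_add, hx, hy]
      | snoc b n =>
        rw [smul_snoc, smul_snoc, shuffle_snoc, shuffle_snoc, smul_snoc, shuffle_smul a b r s]

/-- The pairing `M^{⊚_R k} × N^{⊚_S k} → (M ⊗ N)^{⊚_{R ⊗ S} k}` induced by the shuffle. -/
def cycShuffle (k : ℕ) : Cyc B k →+ Cyc C k →+ Cyc (B.tensor C) k :=
  QuotientAddGroup.lift (commSub B k)
    (AddMonoidHom.mk' (fun a => QuotientAddGroup.lift (commSub C k) (cycMk.comp (shuffle k a))
      (by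
        intro b hb
        refine (AddSubgroup.closure_le (AddMonoidHom.ker _)).2 ?_ hb
        rintro _ ⟨s, b, rfl⟩
        have h₁ := shuffle_smul a b 1 s
        have h₂ := shuffle_op_smul a b 1 s
        rw [one_smul] at h₁
        rw [op_one, one_smul] at h₂
        change cycMk (shuffle k a (s • b - op s • b)) = 0
        rw [map_sub, h₁, h₂, map_sub, cycMk_smul, sub_self]))
      (fun a a' => by
        ext b
        change cycMk (shuffle k (a + a') b) = cycMk (shuffle k a b) + cycMk (shuffle k a' b)
        rw [map_add, AddMonoidHom.add_apply, map_add]))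
    (by
      intro a ha
      refine (AddSubgroup.closure_le (AddMonoidHom.ker _)).2 ?_ ha
      rintro _ ⟨r, a, rfl⟩
      refine AddMonoidHom.mem_ker.2 ?_
      ext b
      have h₁ := shuffle_smul a b r 1
      have h₂ := shuffle_op_smul a b r 1
      rw [one_smul] at h₁
      rw [op_one, one_smul] at h₂
      change cycMk (shuffle k (r • a - op r • a) b) = 0
      rw [map_sub, AddMonoidHom.sub_apply, h₁, h₂, map_sub, cycMk_smul, sub_self])

theorem cycShuffle_mk {k : ℕ} (a : Tens B k) (b : Tens C k) :
    cycShuffle k (cycMk a) (cycMk b) = cycMk (shuffle k a b) := rfl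

/-- The unit `1 ⊗ ⋯ ⊗ 1` of `ℤ^{⊚_ℤ k}`. -/
def cycOne (k : ℕ) : Cyc unitPair.{u} k := cycMk (tprod (fun _ => (⟨1⟩ : ULift.{u} ℤ)) k)

/-! ### Lax symmetric monoidal structures -/

/-- A lift of a functor `F` from bimodules to sets (given by its action on objects and morphisms)
to a lax symmetric monoidal functor with values in abelian groups. -/
@[ext]
structure LaxStructure (F : BimodPair.{u} → Type u)
    (map : ∀ {B C : BimodPair.{u}}, (B ⟶ C) → F B → F C) where
  addCommGroup : ∀ B, AddCommGroup (F B)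
  map_add : ∀ {B C : BimodPair.{u}} (f : B ⟶ C) (x y : F B), map f (x + y) = map f x + map f y
  unit : F unitPair
  mul : ∀ {B C : BimodPair.{u}}, F B → F C → F (B.tensor C)
  add_mul : ∀ {B C : BimodPair.{u}} (x x' : F B) (y : F C), mul (x + x') y = mul x y + mul x' y
  mul_add : ∀ {B C : BimodPair.{u}} (x : F B) (y y' : F C), mul x (y + y') = mul x y + mul x y'
  map_mul : ∀ {B B' C C' : BimodPair.{u}} (f : B ⟶ B') (g : C ⟶ C') (x : F B) (y : F C),
    map (tensorHom f g) (mul x y) = mul (map f x) (map g y)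
  mul_assoc : ∀ {B C D : BimodPair.{u}} (x : F B) (y : F C) (z : F D),
    map (associator B C D) (mul (mul x y) z) = mul x (mul y z)
  unit_mul : ∀ {B : BimodPair.{u}} (x : F B), map (leftUnitor B) (mul unit x) = x
  mul_unit : ∀ {B : BimodPair.{u}} (x : F B), map (rightUnitor B) (mul x unit) = x
  mul_comm : ∀ {B C : BimodPair.{u}} (x : F B) (y : F C),
    map (braiding B C) (mul x y) = mul y x

/-- A family of maps `F(R; M) → ∏_j M^{⊚_R p^j}` with values in the invariants is additive and
symmetric monoidal for a given lax symmetric monoidal structure on `F`. -/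
structure LaxStructure.IsCompatible {F : BimodPair.{u} → Type u}
    {map : ∀ {B C : BimodPair.{u}}, (B ⟶ C) → F B → F C} (L : LaxStructure F map) (p N : ℕ)
    (w : ∀ B, F B → ∀ j : Fin N, cycInv B (p ^ (j : ℕ))) : Prop where
  map_add : ∀ (B : BimodPair.{u}) (x y : F B),
    w B (letI := L.addCommGroup B; x + y) = w B x + w B y
  map_unit : ∀ j : Fin N, (w unitPair L.unit j : Cyc unitPair (p ^ (j : ℕ))) = cycOne _
  map_mul : ∀ (B C : BimodPair.{u}) (x : F B) (y : F C) (j : Fin N),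
    (w (B.tensor C) (L.mul x y) j : Cyc (B.tensor C) (p ^ (j : ℕ))) =
      cycShuffle _ (w B x j : Cyc B (p ^ (j : ℕ))) (w C y j : Cyc C (p ^ (j : ℕ)))

/-- A lax symmetric monoidal structure on `W_{⟨p^n⟩}` is the standard one if it lives on the given
abelian groups, its unit is the class of `1 - t`, and its product is given on the generators
`1 - x_1 ⊗ ⋯ ⊗ x_{p^i} t^{p^i}` and `1 - y_1 ⊗ ⋯ ⊗ y_{p^j} t^{p^j}` with `i ≤ j` by the sum over
`σ ∈ C_{p^i}` of the classes of `1 - ((σ x)^{⊗ p^{j-i}} ⊗ y) t^{p^j}`, where `(σ x)^{⊗ p^{j-i}}`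
and `y` are shuffled together. (The products with `i ≥ j` follow by symmetry, and these generators
generate the abelian group `W_{⟨p^n⟩}(R; M)`, so this describes the product completely.) -/
structure LaxStructure.IsStandard (p n : ℕ) [hp : Fact p.Prime]
    (L : LaxStructure (WittTrunc.{u} p n) (fun f => wMap p n f)) : Prop where
  addCommGroup_eq : ∀ B, L.addCommGroup B = (inferInstance : AddCommGroup (WittTrunc p n B))
  unit_eq : L.unit = wMk p n (tau (B := unitPair.{u}) (⟨1⟩ : ULift.{u} ℤ))
  mul_eq : ∀ (B C : BimodPair.{u}) (i j : ℕ), i ≤ j → j ≤ n → ∀ (x : ℕ → B.M) (y : ℕ → C.M),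
    L.mul (wMk p n (oneSub (pow_ne_zero i hp.out.ne_zero) (tprod x (p ^ i))))
        (wMk p n (oneSub (pow_ne_zero j hp.out.ne_zero) (tprod y (p ^ j)))) =
      ∑ s ∈ Finset.range (p ^ i), wMk p n (oneSub (pow_ne_zero j hp.out.ne_zero)
        (tprod (fun l => mtmul (x ((l + s) % p ^ i)) (y l)) (p ^ j)))

end WittCoeff

end

open WittCoeff CategoryTheory

noncomputable section

namespace WittCoeff

/-! ### Words and rotations in the tensor algebra -/

section

variable {B C D : BimodPair.{u}}

/-! ### Elementary tensors in the tensor algebra -/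

/-! Filter the Witt vectors `WittTrunc` by the powers of t. The elementary tensors outside the
degrees 1, p, …, p^n are relations, so the filtration only jumps in these degrees (`wFil_le_succ`),
and since the subgroup of relations is closed nothing survives beyond p^n (`congSub_le_wittSub`).
The filtration is therefore finite, and peeling off leading coefficients writes every class in Witt
coordinates (`gammaRep_surjective`). Commutators and the quotients τ(rm)/τ(mr) kill, modulo the next
step, every leading coefficient whose cyclic class has the form y - σy (`mem_leadSub_of_rot`). In
its own degree k, tlog sends the class of 1 - a t^k to the norm of a over C_k. Hence tlog is
injective as soon as the kernel of the norm is the image of 1 - σ, that is, Ĥ⁻¹(C_k; M^{⊚k}) = 0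
(`NormExact`, `tlogW_injective`).

This vanishing holds if R is a free abelian group and M a free bimodule: M^{⊚k} then has a ℤ-basis
of words that σ permutes (`BimodBasis.normExact`). The condition used is `BimodBasis` and not
freeness of the pair, because a tensor product of free rings is in general not a free ring, whereas
the two basis conditions pass to tensor products (`BimodBasis.tensor`).

General pairs are reached through reflexive coequalisers. For a free resolution P of B, the map on
Witt vectors induced by ε is surjective, and two classes with the same image come from one class
over `P.S₁` (`FreeResolution.exists_of_wMap_eq`). Over `P.S₀` equality of ghost vectors is equality
of Witt vectors, so `coordRel` is precisely equality of the classes `gammaRep`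
(`FreeResolution.coordRel_iff`). This yields the bijection γ, and tlog ∘ γ = w is the geometric
series for 1 - a t^k (`tlogCoeff_oneSub`).

For the product, Frobenius reciprocity for transfers shows that the prescribed formula on generators
has as tlog the shuffle product of the two tlogs (`sum_tlogCoeff_eq_cycShuffle`). So any two classes
have a candidate product, characterised by its tlog; it is unique over the tensor product of two
free covers, and its push-forward along the counits does not depend on the lifts
(`wMap_counit_eq_of_isProduct`). The axioms are proved over free covers, as identities between
cyclic tensors or by lifting products. Uniqueness of the structures is the same principle: every
class lifts to a free cover, where w is injective, and naturality carries the operations down. -/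

theorem tof_mul {i j : ℕ} (a : Tens B i) (b : Tens B j) :
    tof i a * tof j b = tof (i + j) (tensMul a b) := DirectSum.of_mul_of _ _

theorem tof_tensOne : tof 0 (tensOne B) = 1 := rfl

/-- Casts between tensor powers become invisible in the tensor algebra; this removes the cast along
0 + i = i. -/
theorem tof_smul_tensCast {i j : ℕ} (h : i = j) (r : B.R) (a : Tens B i) :
    tof j (r • tensCast h a) = tof i (r • a) := by
  subst h; rfl

theorem tof_zero_mul {i : ℕ} (b : Tens B 0) (a : Tens B i) :
    tof 0 b * tof i a = tof i (scal b • a) := by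
  have h : b = scal b • tensOne B := (mul_one (scal b)).symm
  conv_lhs => rw [h, tof_mul, smul_tensMul, ← tof_smul_tensCast (Nat.zero_add i), one_tensMul]

/-- An element of `M`, seen in degree one of the tensor algebra. -/
def iota (m : B.M) : TAlg B := tof 1 (snoc (tensOne B) m)

/-- Together with `tof_cons`, this turns appending and prepending a factor into right and left
multiplication by `iota m`, so that rotations become computations in an associative ring. -/
theorem tof_snoc {k : ℕ} (a : Tens B k) (m : B.M) :
    tof (k + 1) (snoc a m) = tof k a * iota m := by
  rw [iota, tof_mul, tensMul_snoc]
  congr 2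
  exact (one_smul B.Rᵐᵒᵖ a).symm

theorem tof_cons : ∀ {k : ℕ} (m : B.M) (a : Tens B k),
    tof (k + 1) (cons m a) = iota m * tof k a
  | 0, m, a => by
    rw [iota, tof_mul]
    refine congrArg (tof (B := B) 1) ?_
    exact (op_smul_snoc (op (scal a)) (tensOne B) m).symm
  | k + 1, m, a => by
    induction a using snoc_induction with
    | zero => rw [cons_zero, map_zero, map_zero, mul_zero]
    | snoc a m' => rw [cons_snoc, tof_snoc, tof_cons m a, tof_snoc, mul_assoc]
    | add x y hx hy => rw [cons_add, map_add, hx, hy, map_add, mul_add]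

theorem tprod_congr : ∀ {k : ℕ} {m m' : ℕ → B.M}, (∀ i < k, m i = m' i) →
    tprod m k = tprod m' k
  | 0, _, _, _ => rfl
  | k + 1, m, m', h => by
    rw [tprod, tprod, tprod_congr fun i hi => h i (hi.trans k.lt_succ_self), h k k.lt_succ_self]

theorem tof_tprod_mul_tof_tprod (m m' : ℕ → B.M) (i : ℕ) : ∀ j : ℕ,
    tof i (tprod m i) * tof j (tprod m' j) =
      tof (i + j) (tprod (fun l => if l < i then m l else m' (l - i)) (i + j))
  | 0 => by
    rw [show tprod m' 0 = tensOne B from rfl, tof_tensOne, mul_one]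
    exact congrArg _ (tprod_congr fun l hl => (if_pos hl).symm)
  | j + 1 => by
    rw [show tprod m' (j + 1) = snoc (tprod m' j) (m' j) from rfl, tof_snoc, ← mul_assoc,
      tof_tprod_mul_tof_tprod m m' i j, ← tof_snoc]
    refine congrArg (tof (B := B) (i + j + 1)) ?_
    refine congrArg (snoc _) (Eq.symm ?_)
    change (if i + j < i then m (i + j) else m' (i + j - i)) = m' j
    rw [if_neg (by omega), Nat.add_sub_cancel_left]

theorem tof_tprod_pow (m : ℕ → B.M) (k : ℕ) : ∀ e : ℕ,
    tof k (tprod m k) ^ e = tof (k * e) (tprod (fun l => m (l % k)) (k * e))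
  | 0 => by rw [pow_zero]; rfl
  | e + 1 => by
    rw [pow_succ, tof_tprod_pow m k e, tof_tprod_mul_tof_tprod]
    refine congrArg (tof (B := B) (k * e + k)) (tprod_congr fun l hl => ?_)
    split_ifs with h
    · rfl
    · obtain ⟨t, rfl⟩ := Nat.exists_eq_add_of_le (not_lt.1 h)
      rw [Nat.add_sub_cancel_left, Nat.mul_add_mod, Nat.mod_eq_of_lt (by omega)]

/-- The elementary tensors span `M^{⊗_R k}` for `k ≠ 0`. -/
theorem tprod_induction {k : ℕ} (hk : k ≠ 0) {P : Tens B k → Prop} (zero : P 0)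
    (tprod : ∀ m, P (tprod m k)) (add : ∀ x y, P x → P y → P (x + y)) (x : Tens B k) : P x := by
  obtain ⟨k, rfl⟩ := Nat.exists_eq_succ_of_ne_zero hk
  clear hk
  induction k with
  | zero =>
    induction x using snoc_induction with
    | zero => exact zero
    | add x y hx hy => exact add x y hx hy
    | snoc a m =>
      have h : a = op (scal a) • tensOne B := (one_mul (scal a)).symm
      rw [h, snoc_op_smul]
      exact tprod fun _ => scal a • m
  | succ k ih =>
    induction x using snoc_induction with
    | zero => exact zero
    | add x y hx hy => exact add x y hx hy
    | snoc a m =>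
      refine ih (P := fun a => P (snoc a m)) ?_ (fun x => ?_) (fun x y hx hy => ?_) a
      · have : snoc (0 : Tens B (k + 1)) m = 0 := tm_zero_left m
        rw [this]; exact zero
      · have := tprod fun i => if i < k + 1 then x i else m
        rw [WittCoeff.tprod, if_neg (lt_irrefl _),
          tprod_congr (m' := x) fun i hi => if_pos hi] at this
        exact this
      · rw [snoc_add_left]; exact add _ _ hx hy

theorem tens_hom_ext {k : ℕ} (hk : k ≠ 0) {X : Type*} [AddCommGroup X] {f g : Tens B k →+ X}
    (h : ∀ m, f (tprod m k) = g (tprod m k)) : f = g := by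
  ext x
  induction x using tprod_induction hk with
  | zero => rw [map_zero, map_zero]
  | tprod m => exact h m
  | add x y hx hy => rw [map_add, map_add, hx, hy]

theorem cycMk_surjective (k : ℕ) : Function.Surjective (cycMk : Tens B k →+ Cyc B k) :=
  QuotientAddGroup.mk'_surjective _

theorem cyc_induction {k : ℕ} (hk : k ≠ 0) {P : Cyc B k → Prop} (zero : P 0)
    (tprod : ∀ m, P (cycMk (tprod m k))) (add : ∀ x y, P x → P y → P (x + y)) (x : Cyc B k) :
    P x := by
  obtain ⟨a, rfl⟩ := cycMk_surjective k x
  induction a using tprod_induction hk with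
  | zero => rw [map_zero]; exact zero
  | tprod m => exact tprod m
  | add x y hx hy => rw [map_add]; exact add _ _ hx hy

theorem cyc_hom_ext {k : ℕ} (hk : k ≠ 0) {X : Type*} [AddCommGroup X] {f g : Cyc B k →+ X}
    (h : ∀ m, f (cycMk (tprod m k)) = g (cycMk (tprod m k))) : f = g := by
  ext x
  exact DFunLike.congr_fun (tens_hom_ext (f := f.comp cycMk) (g := g.comp cycMk) hk h) x

theorem cons_tprod (m : B.M) (x : ℕ → B.M) : ∀ k : ℕ,
    cons m (tprod x k) = tprod (fun i => if i = 0 then m else x (i - 1)) (k + 1)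
  | 0 => by
    change snoc (tensOne B) (op (1 : B.R) • m) = snoc (tensOne B) m
    rw [op_one, one_smul]
  | k + 1 => by rw [tprod, cons_snoc, cons_tprod m x k, tprod]; rfl

theorem rot_tprod (x : ℕ → B.M) {k : ℕ} (hk : k ≠ 0) :
    rot B k (cycMk (tprod x k)) =
      cycMk (tprod (fun i => if i = 0 then x (k - 1) else x (i - 1)) k) := by
  obtain ⟨k, rfl⟩ := Nat.exists_eq_succ_of_ne_zero hk
  rw [tprod, rot_mk_snoc, cons_tprod]; rfl

/-! ### Components of the tensor algebra in the cyclic tensor powers -/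

/-- The class in `M^{⊚_R N}` of the component of degree `N`. -/
def cycComp (N : ℕ) : TAlg B →+ Cyc B N :=
  cycMk.comp (DFinsupp.evalAddMonoidHom N : TAlg B →+ Tens B N)

theorem cycComp_tof (N : ℕ) (a : Tens B N) : cycComp N (tof N a) = cycMk a := by
  change cycMk ((DirectSum.of (Tens B) N a) N) = _
  rw [DirectSum.of_eq_same]

theorem cycComp_tof_of_ne {k N : ℕ} (h : k ≠ N) (a : Tens B k) : cycComp N (tof k a) = 0 := by
  change cycMk ((DirectSum.of (Tens B) k a) N) = _
  rw [DirectSum.of_eq_of_ne _ _ _ h.symm, map_zero]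

/-- One rotation moves a last factor to the front. In degrees other than k + 1 both sides vanish, so
no relation between k and N is needed. -/
theorem cycComp_iota_mul {N k : ℕ} (m : B.M) (a : Tens B k) :
    cycComp N (iota m * tof k a) = rot B N (cycComp N (tof k a * iota m)) := by
  rw [← tof_snoc, ← tof_cons]
  by_cases h : k + 1 = N
  · subst h
    rw [cycComp_tof, cycComp_tof, rot_mk_snoc]
  · rw [cycComp_tof_of_ne h, cycComp_tof_of_ne h, map_zero]

/-- Rotating `a ⊗ b` by the length of `b` gives `b ⊗ a`. -/
theorem rot_iterate_cycComp_mul (N : ℕ) {i : ℕ} (a : Tens B i) : ∀ {k : ℕ} (b : Tens B k),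
    (rot B N)^[k] (cycComp N (tof i a * tof k b)) = cycComp N (tof k b * tof i a)
  | 0, b => by
    have h₁ : tof i a * tof 0 b = tof i (op (scal b) • a) := tof_mul a b
    have h₂ := tof_zero_mul b a
    -- A factor of degree 0 is a scalar, and moving it around is the defining relation ra = ar of
    -- the cyclic tensor power.
    rw [Function.iterate_zero, id, h₁, h₂]
    by_cases h : i = N
    · subst h
      rw [cycComp_tof, cycComp_tof, cycMk_smul]
    · rw [cycComp_tof_of_ne h, cycComp_tof_of_ne h]
  | k + 1, b => by
    induction b using snoc_induction with
    | zero => simp only [map_zero, mul_zero, zero_mul, iterate_map_zero]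
    | add x y hx hy => simp only [map_add, mul_add, add_mul, iterate_map_add, hx, hy]
    | snoc b m =>
      -- The first rotation moves m in front of a; the other k rotations move b around m ⊗ a, which
      -- is the induction hypothesis.
      rw [tof_snoc, Function.iterate_succ_apply, ← mul_assoc, tof_mul, ← cycComp_iota_mul,
        ← tof_mul, ← mul_assoc, ← tof_cons, rot_iterate_cycComp_mul, tof_cons, mul_assoc]

end

/-! ### The logarithmic derivative of special units -/

section

variable {B C D : BimodPair.{u}}

/-! ### Functoriality of the cyclic tensor powers -/

theorem tensMap_smul (f : B ⟶ C) : ∀ {k : ℕ} (r : B.R) (a : Tens B k),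
    tensMap f k (r • a) = f.ringHom r • tensMap f k a
  | 0, r, a => map_mul f.ringHom r (scal a)
  | k + 1, r, a => by
    induction a using snoc_induction with
    | zero => simp
    | add x y hx hy => simp only [smul_add, map_add, hx, hy]
    | snoc a m => rw [smul_snoc, tensMap_snoc, tensMap_smul, tensMap_snoc, smul_snoc]

/-- The map of cyclic tensor powers induced by a morphism of bimodules. -/
def cycMap (f : B ⟶ C) (k : ℕ) : Cyc B k →+ Cyc C k :=
  QuotientAddGroup.map (commSub B k) (commSub C k) (tensMap f k) (by
    rw [commSub, AddSubgroup.closure_le]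
    rintro _ ⟨r, a, rfl⟩
    refine AddSubgroup.subset_closure ⟨f.ringHom r, tensMap f k a, ?_⟩
    rw [map_sub, tensMap_smul, tensMap_op_smul])

theorem cycMap_mk (f : B ⟶ C) {k : ℕ} (a : Tens B k) :
    cycMap f k (cycMk a) = cycMk (tensMap f k a) := rfl

theorem cycMap_tprod (f : B ⟶ C) {k : ℕ} (m : ℕ → B.M) :
    cycMap f k (cycMk (tprod m k)) = cycMk (tprod (fun i => f.addHom (m i)) k) := by
  rw [cycMap_mk, tensMap_tprod]

theorem cycMap_rot (f : B ⟶ C) (k : ℕ) (x : Cyc B k) :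
    cycMap f k (rot B k x) = rot C k (cycMap f k x) := by
  rcases eq_or_ne k 0 with rfl | hk
  · rfl
  · refine DFunLike.congr_fun (f := (cycMap f k).comp (rot B k))
      (g := (rot C k).comp (cycMap f k)) (cyc_hom_ext hk fun m => ?_) x
    rw [AddMonoidHom.comp_apply, AddMonoidHom.comp_apply, rot_tprod m hk, cycMap_tprod,
      cycMap_tprod, rot_tprod _ hk]
    congr 2
    ext i
    split_ifs <;> rfl

theorem tAlgMap_homogeneous (f : B ⟶ C) (u : TAlg B) (N : ℕ) :
    tAlgMap f u N = tensMap f N (u N) := by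
  induction u using DirectSum.induction_on with
  | zero => rw [map_zero, DirectSum.zero_apply, DirectSum.zero_apply, map_zero]
  | add x y hx hy => rw [map_add, DirectSum.add_apply, hx, hy, DirectSum.add_apply, map_add]
  | of k a =>
    rw [tAlgMap_of]
    rcases eq_or_ne k N with rfl | h
    · rw [DirectSum.of_eq_same, DirectSum.of_eq_same]
    · rw [DirectSum.of_eq_of_ne _ _ _ h.symm, DirectSum.of_eq_of_ne _ _ _ h.symm, map_zero]

theorem cycMap_cycComp (f : B ⟶ C) (N : ℕ) (u : TAlg B) :
    cycMap f N (cycComp N u) = cycComp N (tAlgMap f u) := by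
  change cycMap f N (cycMk (u N)) = cycMk (tAlgMap f u N)
  rw [tAlgMap_homogeneous, cycMap_mk]

/-! ### Transfers -/

theorem transfer_add_apply (N d : ℕ) (x y : Cyc B N) :
    transfer B N d (x + y) = transfer B N d x + transfer B N d y := by
  simp only [transfer, iterate_map_add, Finset.sum_add_distrib]

/-- The transfer as a homomorphism. -/
def transferHom (B : BimodPair.{u}) (N d : ℕ) : Cyc B N →+ Cyc B N :=
  AddMonoidHom.mk' (transfer B N d) (transfer_add_apply N d)

@[simp]
theorem transferHom_apply (N d : ℕ) (x : Cyc B N) : transferHom B N d x = transfer B N d x := rfl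

theorem transfer_zero_apply (N d : ℕ) : transfer B N d 0 = 0 := map_zero (transferHom B N d)

theorem transfer_zero (N : ℕ) (x : Cyc B N) : transfer B N 0 x = 0 := rfl

/-- For a product of tensors of lengths k and l, the first l rotations move the right-hand factor
and the remaining k the left-hand one. This is the source of the Leibniz rule `bracket_mul_right`.
-/
theorem transfer_add (N k l : ℕ) (x : Cyc B N) :
    transfer B N (k + l) x = transfer B N l x + transfer B N k ((rot B N)^[l] x) := by
  rw [add_comm k l, transfer, Finset.sum_range_add]
  congr 1
  refine Finset.sum_congr rfl fun s _ => ?_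
  rw [add_comm, Function.iterate_add_apply]

/-- Applying σ shifts the range of summation by one, so the difference telescopes. -/
theorem rot_transfer_sub (N k : ℕ) (x : Cyc B N) :
    rot B N (transfer B N k x) - transfer B N k x = (rot B N)^[k] x - x := by
  have h := Finset.sum_range_succ (fun s => (rot B N)^[s] x) k
  rw [Finset.sum_range_succ'] at h
  rw [transfer, map_sum]
  simp only [Function.iterate_succ_apply', Function.iterate_zero, id] at h
  rw [sub_eq_sub_iff_add_eq_add, h, add_comm]

theorem cycMap_transfer (f : B ⟶ C) (N d : ℕ) (x : Cyc B N) :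
    cycMap f N (transfer B N d x) = transfer C N d (cycMap f N x) := by
  rw [transfer, transfer, map_sum]
  refine Finset.sum_congr rfl fun s _ => ?_
  exact Function.Semiconj.iterate_right (f := cycMap f N) (cycMap_rot f N) s x

/-! ### The logarithmic derivative -/

/-- The coefficient of `t^N` in `F · t dG`. -/
def bracket (N : ℕ) (F G : PowerSeries (TAlg B)) : Cyc B N :=
  ∑ ik ∈ Finset.HasAntidiagonal.antidiagonal N,
    transfer B N ik.2 (cycComp N (PowerSeries.coeff ik.1 F * PowerSeries.coeff ik.2 G))

theorem tlogCoeff_eq_neg_bracket (x : specialUnits B) (N : ℕ) :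
    tlogCoeff x N = -bracket N (x⁻¹ : specialUnits B).1 x.1 := rfl

theorem bracket_sub_right (N : ℕ) (F G H : PowerSeries (TAlg B)) :
    bracket N F (G - H) = bracket N F G - bracket N F H := by
  simp only [bracket, map_sub, mul_sub, ← transferHom_apply, Finset.sum_sub_distrib]

theorem sum_antidiagonal_assoc {A : Type*} [AddCommMonoid A] (N : ℕ) (f : ℕ → ℕ → ℕ → A) :
    ∑ x ∈ Finset.HasAntidiagonal.antidiagonal N,
        ∑ y ∈ Finset.HasAntidiagonal.antidiagonal x.2, f x.1 y.1 y.2 =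
      ∑ x ∈ Finset.HasAntidiagonal.antidiagonal N,
        ∑ y ∈ Finset.HasAntidiagonal.antidiagonal x.1, f y.1 y.2 x.2 := by
  rw [Finset.sum_sigma', Finset.sum_sigma']
  refine Finset.sum_nbij' (fun ⟨⟨i, _⟩, ⟨k, l⟩⟩ => ⟨(i + k, l), (i, k)⟩)
    (fun ⟨⟨_, l⟩, ⟨i, k⟩⟩ => ⟨(i, k + l), (k, l)⟩) ?_ ?_ ?_ ?_ ?_ <;>
  · simp only [Finset.mem_sigma, Finset.HasAntidiagonal.mem_antidiagonal, Sigma.forall, Prod.forall]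
    rintro a b c d ⟨rfl, rfl⟩
    simp [add_assoc]

/-- Both sides run over all i + k + l = N; the right-hand side groups l with i, as the cyclic order
l, i, k requires. -/
theorem sum_antidiagonal_rotate {A : Type*} [AddCommMonoid A] (N : ℕ) (f : ℕ → ℕ → ℕ → A) :
    ∑ x ∈ Finset.HasAntidiagonal.antidiagonal N,
        ∑ y ∈ Finset.HasAntidiagonal.antidiagonal x.2, f x.1 y.1 y.2 =
      ∑ x ∈ Finset.HasAntidiagonal.antidiagonal N,
        ∑ y ∈ Finset.HasAntidiagonal.antidiagonal x.1, f y.2 x.2 y.1 := by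
  rw [Finset.sum_sigma', Finset.sum_sigma']
  refine Finset.sum_nbij' (fun ⟨⟨i, _⟩, ⟨k, l⟩⟩ => ⟨(l + i, k), (l, i)⟩)
    (fun ⟨⟨_, k⟩, ⟨l, i⟩⟩ => ⟨(i, k + l), (k, l)⟩) ?_ ?_ ?_ ?_ ?_ <;>
  · simp only [Finset.mem_sigma, Finset.HasAntidiagonal.mem_antidiagonal, Sigma.forall, Prod.forall]
    rintro a b c d ⟨rfl, rfl⟩
    simp [add_comm, add_left_comm]

/-- The coefficients of a special unit are homogeneous. -/
theorem exists_coeff_eq (x : specialUnits B) (k : ℕ) :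
    ∃ a : Tens B k, PowerSeries.coeff k x.1 = tof k a := by
  obtain ⟨a, ha⟩ := x.2.2 k
  exact ⟨a, ha.symm⟩

/-- The product rule F d(GH) = (FG) dH + (HF) dG: in the term that differentiates G, the factor H is
rotated to the front, which makes sense only in the cyclic tensor power. The series are special
units so that their coefficients are homogeneous and `rot_iterate_cycComp_mul` applies. -/
theorem bracket_mul_right (N : ℕ) (F G H : specialUnits B) :
    bracket N F.1 (G.1 * H.1) = bracket N (F.1 * G.1) H.1 + bracket N (H.1 * F.1) G.1 := by
  let T : ℕ → ℕ → ℕ → TAlg B := fun i k l =>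
    PowerSeries.coeff i F.1 * PowerSeries.coeff k G.1 * PowerSeries.coeff l H.1
  have hT : ∀ i k l, (rot B N)^[l] (cycComp N (T i k l)) = cycComp N
      (PowerSeries.coeff l H.1 * PowerSeries.coeff i F.1 * PowerSeries.coeff k G.1) := by
    intro i k l
    obtain ⟨a, ha⟩ := exists_coeff_eq F i
    obtain ⟨b, hb⟩ := exists_coeff_eq G k
    obtain ⟨c, hc⟩ := exists_coeff_eq H l
    simp only [T]
    rw [ha, hb, hc, tof_mul, rot_iterate_cycComp_mul, ← tof_mul, mul_assoc]
  have h₁ : bracket N F.1 (G.1 * H.1) = ∑ x ∈ Finset.HasAntidiagonal.antidiagonal N,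
      ∑ y ∈ Finset.HasAntidiagonal.antidiagonal x.2,
        (transfer B N y.2 (cycComp N (T x.1 y.1 y.2)) +
          transfer B N y.1 ((rot B N)^[y.2] (cycComp N (T x.1 y.1 y.2)))) := by
    refine Finset.sum_congr rfl fun x _ => ?_
    rw [PowerSeries.coeff_mul, Finset.mul_sum, map_sum, ← transferHom_apply, map_sum]
    refine Finset.sum_congr rfl fun y hy => ?_
    rw [← Finset.HasAntidiagonal.mem_antidiagonal.1 hy, transferHom_apply, transfer_add,
      ← mul_assoc]
  rw [h₁]
  simp only [Finset.sum_add_distrib]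
  congr 1
  · rw [sum_antidiagonal_assoc N fun i k l => transfer B N l (cycComp N (T i k l))]
    refine Finset.sum_congr rfl fun x _ => ?_
    rw [PowerSeries.coeff_mul, Finset.sum_mul, map_sum, ← transferHom_apply, map_sum]
    rfl
  · simp only [hT]
    rw [sum_antidiagonal_rotate N fun i k l => transfer B N k (cycComp N
      (PowerSeries.coeff l H.1 * PowerSeries.coeff i F.1 * PowerSeries.coeff k G.1))]
    refine Finset.sum_congr rfl fun x _ => ?_
    rw [PowerSeries.coeff_mul, Finset.sum_mul, map_sum, ← transferHom_apply, map_sum]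
    rfl

/-- In the product rule with F = (xy)⁻¹ the outer factors cancel to (xy)⁻¹x = y⁻¹ and y(xy)⁻¹ = x⁻¹,
so no commutativity is involved. -/
theorem tlogCoeff_mul (x y : specialUnits B) (N : ℕ) :
    tlogCoeff (x * y) N = tlogCoeff x N + tlogCoeff y N := by
  have h := bracket_mul_right N (x * y)⁻¹ x y
  have h₁ : ((x * y)⁻¹ * x : specialUnits B) = y⁻¹ := by group
  have h₂ : (y * (x * y)⁻¹ : specialUnits B) = x⁻¹ := by group
  have h₁' := congrArg Subtype.val h₁
  have h₂' := congrArg Subtype.val h₂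
  rw [Submonoid.coe_mul] at h₁' h₂'
  rw [h₁', h₂'] at h
  rw [tlogCoeff_eq_neg_bracket, tlogCoeff_eq_neg_bracket, tlogCoeff_eq_neg_bracket,
    Submonoid.coe_mul, h]
  abel

/-- The logarithmic derivative takes values in the invariants. -/
theorem tlogCoeff_mem_cycInv (x : specialUnits B) (N : ℕ) : tlogCoeff x N ∈ cycInv B N := by
  -- The failure of invariance of F dG telescopes to the coefficient of GF - FG, which is zero when
  -- F and G are inverse to each other.
  have key : ∀ F G : specialUnits B, rot B N (bracket N F.1 G.1) - bracket N F.1 G.1 =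
      cycComp N (PowerSeries.coeff N (G * F).1) - cycComp N (PowerSeries.coeff N (F * G).1) := by
    intro F G
    have h := Finset.Nat.sum_antidiagonal_swap (n := N) (f := fun x =>
      cycComp N (PowerSeries.coeff x.1 G.1 * PowerSeries.coeff x.2 F.1))
    rw [Submonoid.coe_mul, Submonoid.coe_mul, PowerSeries.coeff_mul, PowerSeries.coeff_mul,
      map_sum, map_sum, bracket, map_sum, ← Finset.sum_sub_distrib, ← h, ← Finset.sum_sub_distrib]
    refine Finset.sum_congr rfl fun x _ => ?_
    obtain ⟨a, ha⟩ := exists_coeff_eq F x.1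
    obtain ⟨b, hb⟩ := exists_coeff_eq G x.2
    rw [Prod.fst_swap, Prod.snd_swap, rot_transfer_sub, ha, hb, rot_iterate_cycComp_mul]
  rw [cycInv, AddMonoidHom.mem_ker, tlogCoeff_eq_neg_bracket, map_neg, AddMonoidHom.sub_apply,
    AddMonoidHom.id_apply, key, mul_inv_cancel, inv_mul_cancel, sub_self, neg_zero]

/-- The logarithmic derivative as a homomorphism. -/
def tlogHom (B : BimodPair.{u}) (N : ℕ) : specialUnits B →* Multiplicative (Cyc B N) where
  toFun x := Multiplicative.ofAdd (tlogCoeff x N)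
  map_one' := by
    have := tlogCoeff_mul (1 : specialUnits B) 1 N
    rw [mul_one, left_eq_add] at this
    rw [this]; rfl
  map_mul' x y := by rw [tlogCoeff_mul]; rfl

theorem tlogCoeff_inv (x : specialUnits B) (N : ℕ) : tlogCoeff x⁻¹ N = -tlogCoeff x N :=
  map_inv (tlogHom B N) x

theorem tlogCoeff_suMap (f : B ⟶ C) (x : specialUnits B) (N : ℕ) :
    tlogCoeff (suMap f x) N = cycMap f N (tlogCoeff x N) := by
  rw [tlogCoeff_eq_neg_bracket, tlogCoeff_eq_neg_bracket, map_neg, bracket, bracket, map_sum,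
    ← map_inv]
  congr 1
  refine Finset.sum_congr rfl fun ik _ => ?_
  change transfer C N ik.2 (cycComp N (PowerSeries.coeff ik.1 (PowerSeries.map (tAlgMap f) _) *
    PowerSeries.coeff ik.2 (PowerSeries.map (tAlgMap f) _))) = _
  rw [PowerSeries.coeff_map, PowerSeries.coeff_map, ← map_mul, cycMap_transfer, cycMap_cycComp]

theorem coeff_oneSub {k : ℕ} (hk : k ≠ 0) (a : Tens B k) (N : ℕ) :
    PowerSeries.coeff N (oneSub hk a).1 =
      (if N = 0 then 1 else 0) - if N = k then tof k a else 0 := by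
  change PowerSeries.coeff N (1 - PowerSeries.monomial k (tof k a)) = _
  rw [map_sub, PowerSeries.coeff_one, PowerSeries.coeff_monomial]

theorem coeff_mul_monomial (F : PowerSeries (TAlg B)) (k : ℕ) (A : TAlg B) (N : ℕ) :
    PowerSeries.coeff N (F * PowerSeries.monomial k A) =
      if k ≤ N then PowerSeries.coeff (N - k) F * A else 0 := by
  rw [PowerSeries.coeff_mul]
  split_ifs with h
  · rw [Finset.sum_eq_single (N - k, k)]
    · rw [PowerSeries.coeff_monomial_same]
    · rintro ⟨i, j⟩ hij hne
      rw [PowerSeries.coeff_monomial, if_neg, mul_zero]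
      rintro rfl
      have := Finset.HasAntidiagonal.mem_antidiagonal.1 hij
      exact hne (Prod.ext (by simp at this ⊢; omega) rfl)
    · intro h'
      exact absurd (Finset.HasAntidiagonal.mem_antidiagonal.2 (Nat.sub_add_cancel h)) h'
  · refine Finset.sum_eq_zero fun x hx => ?_
    have := Finset.HasAntidiagonal.mem_antidiagonal.1 hx
    rw [PowerSeries.coeff_monomial, if_neg (by omega), mul_zero]

/-- Against a monomial of degree k only the transfer of length k occurs, so it can be taken out of
the sum. -/
theorem bracket_monomial (F : PowerSeries (TAlg B)) (k : ℕ) (A : TAlg B) (N : ℕ) :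
    bracket N F (PowerSeries.monomial k A) =
      transfer B N k (cycComp N (PowerSeries.coeff N (F * PowerSeries.monomial k A))) := by
  rw [PowerSeries.coeff_mul, map_sum, ← transferHom_apply, map_sum, bracket]
  refine Finset.sum_congr rfl fun x _ => ?_
  rw [PowerSeries.coeff_monomial]
  split_ifs with h
  · rw [h, transferHom_apply]
  · rw [mul_zero, map_zero, map_zero, transfer_zero_apply]

/-- The geometric series. -/
theorem coeff_inv_oneSub {k : ℕ} (hk : k ≠ 0) (a : Tens B k) (N : ℕ) :
    PowerSeries.coeff N ((oneSub hk a)⁻¹ : specialUnits B).1 =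
      if k ∣ N then tof k a ^ (N / k) else 0 := by
  have h : (oneSub hk a)⁻¹.1 = 1 + (oneSub hk a)⁻¹.1 * PowerSeries.monomial k (tof k a) := by
    have h := congrArg Subtype.val (inv_mul_cancel (oneSub hk a))
    rw [Submonoid.coe_mul, Submonoid.coe_one] at h
    change _ * (1 - PowerSeries.monomial k (tof k a)) = _ at h
    rw [← h, mul_sub, mul_one, sub_add_cancel]
  induction N using Nat.strong_induction_on with
  | _ N ih =>
    rw [h, map_add, coeff_mul_monomial, PowerSeries.coeff_one]
    rcases eq_or_ne N 0 with rfl | hN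
    · rw [if_pos rfl, if_neg (by omega), add_zero, if_pos (dvd_zero k), Nat.zero_div, pow_zero]
    · rw [if_neg hN, zero_add]
      split_ifs with h₁ h₂ h₂
      · obtain ⟨e, rfl⟩ := h₂
        obtain ⟨e, rfl⟩ := Nat.exists_eq_succ_of_ne_zero (right_ne_zero_of_mul hN)
        have hk' := Nat.pos_of_ne_zero hk
        rw [ih _ (by omega), Nat.succ_eq_add_one, Nat.mul_add, mul_one, Nat.add_sub_cancel,
          if_pos (dvd_mul_right k e), Nat.mul_div_cancel_left _ hk', Nat.add_div_right _ hk',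
          Nat.mul_div_cancel_left _ hk', pow_succ]
      · rw [ih _ (by omega), if_neg, zero_mul]
        exact fun h => h₂ ((Nat.dvd_sub_iff_left h₁ dvd_rfl).1 h)
      · exact absurd (Nat.le_of_dvd (Nat.pos_of_ne_zero hN) h₂) h₁
      · rfl

/-- For f = 1 - a t^k one has -f⁻¹ df = f⁻¹ d(a t^k), and f⁻¹ · a t^k = f⁻¹ - 1 is a geometric
series. With k = p^i and N = p^j this is the summand of index i of the ghost component of index j.
-/
theorem tlogCoeff_oneSub {k : ℕ} (hk : k ≠ 0) (a : Tens B k) {N : ℕ} (hN : N ≠ 0) :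
    tlogCoeff (oneSub hk a) N =
      transfer B N k (cycComp N (if k ∣ N then tof k a ^ (N / k) else 0)) := by
  have h : (oneSub hk a)⁻¹.1 * PowerSeries.monomial k (tof k a) = (oneSub hk a)⁻¹.1 - 1 := by
    have h := congrArg Subtype.val (inv_mul_cancel (oneSub hk a))
    rw [Submonoid.coe_mul, Submonoid.coe_one] at h
    change _ * (1 - PowerSeries.monomial k (tof k a)) = _ at h
    rw [← h, mul_sub, mul_one, sub_sub_cancel]
  rw [tlogCoeff_eq_neg_bracket]
  change -bracket N _ (1 - PowerSeries.monomial k (tof k a)) = _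
  rw [bracket_sub_right, bracket_monomial, h, map_sub, PowerSeries.coeff_one, if_neg hN, sub_zero,
    coeff_inv_oneSub]
  have h₁ : bracket N (oneSub hk a)⁻¹.1 1 = 0 := by
    refine Finset.sum_eq_zero fun x _ => ?_
    rw [PowerSeries.coeff_one]
    split_ifs with h
    · rw [h, transfer_zero]
    · rw [mul_zero, map_zero, transfer_zero_apply]
  rw [h₁, zero_sub, neg_neg]

end

/-! ### The t-adic filtration and generators of the Witt vectors -/

section

variable {B C D : BimodPair.{u}}

/-! ### The filtration of the group of special units -/

/-- The subgroup of special units that are congruent to `1` modulo `t^N`. -/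
def congSub (B : BimodPair.{u}) (N : ℕ) : Subgroup (specialUnits B) where
  carrier := {x | (PowerSeries.X ^ N : PowerSeries (TAlg B)) ∣ x.1 - 1}
  one_mem' := by
    change _ ∣ (1 : PowerSeries (TAlg B)) - 1
    rw [sub_self]; exact dvd_zero _
  mul_mem' {x y} hx hy := by
    change _ ∣ x.1 * y.1 - 1
    have h : x.1 * y.1 - 1 = (x.1 - 1) * y.1 + (y.1 - 1) := by noncomm_ring
    rw [h]
    exact dvd_add (dvd_mul_of_dvd_left hx _) hy
  inv_mem' {x} hx := by
    change _ ∣ (x⁻¹ : specialUnits B).1 - 1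
    have h : x.1 * (x⁻¹ : specialUnits B).1 = 1 := congrArg Subtype.val (mul_inv_cancel x)
    have h' : (x⁻¹ : specialUnits B).1 - 1 = -((x.1 - 1) * (x⁻¹ : specialUnits B).1) := by
      rw [sub_mul, h, one_mul, neg_sub]
    rw [h']
    exact (dvd_mul_of_dvd_left hx _).neg_right

theorem mem_congSub {N : ℕ} {x : specialUnits B} :
    x ∈ congSub B N ↔ ∀ k < N, k ≠ 0 → PowerSeries.coeff k x.1 = 0 := by
  change _ ∣ x.1 - 1 ↔ _
  rw [PowerSeries.X_pow_dvd_iff]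
  refine forall_congr' fun k => forall_congr' fun _ => ?_
  rw [map_sub, PowerSeries.coeff_one]
  split_ifs with h
  · subst h; simp [x.2.1]
  · simp [h]

/-- Divisibility only provides right multiples of the divisor; powers of t are central, so left
factors do no harm. -/
theorem X_pow_dvd_mul {F : PowerSeries (TAlg B)} {N : ℕ} (h : PowerSeries.X ^ N ∣ F)
    (G : PowerSeries (TAlg B)) : PowerSeries.X ^ N ∣ G * F := by
  obtain ⟨c, rfl⟩ := h
  refine ⟨G * c, ?_⟩
  rw [← mul_assoc, ← mul_assoc, ((PowerSeries.commute_X_pow G N).eq)]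

theorem coeff_eq_of_mem_congSub {N : ℕ} {y : specialUnits B} (hy : y ∈ congSub B N)
    (x : specialUnits B) {k : ℕ} (hk : k < N) :
    PowerSeries.coeff k (x * y).1 = PowerSeries.coeff k x.1 := by
  have h : PowerSeries.X ^ N ∣ (x * y).1 - x.1 := by
    have h : (x * y).1 - x.1 = x.1 * (y.1 - 1) := by rw [mul_sub, mul_one]; rfl
    rw [h]; exact X_pow_dvd_mul hy _
  have := PowerSeries.X_pow_dvd_iff.1 h k hk
  rwa [map_sub, sub_eq_zero] at this

theorem mul_inv_mem_congSub {N : ℕ} {x y : specialUnits B}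
    (h : ∀ k < N, PowerSeries.coeff k x.1 = PowerSeries.coeff k y.1) : x * y⁻¹ ∈ congSub B N := by
  change _ ∣ x.1 * (y⁻¹ : specialUnits B).1 - 1
  have hy : y.1 * (y⁻¹ : specialUnits B).1 = 1 := congrArg Subtype.val (mul_inv_cancel y)
  rw [← hy, ← sub_mul]
  refine dvd_mul_of_dvd_left (PowerSeries.X_pow_dvd_iff.2 fun k hk => ?_) _
  rw [map_sub, h k hk, sub_self]

theorem congSub_anti {M N : ℕ} (h : M ≤ N) : congSub B N ≤ congSub B M :=
  fun _ hx => mem_congSub.2 fun k hk => mem_congSub.1 hx k (hk.trans_le h)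

theorem congSub_one : congSub B 1 = ⊤ :=
  top_unique fun _ _ => mem_congSub.2 fun _ hk hk' => absurd (Nat.lt_one_iff.1 hk) hk'

theorem oneSub_mem_congSub {k : ℕ} (hk : k ≠ 0) (a : Tens B k) : oneSub hk a ∈ congSub B k :=
  mem_congSub.2 fun l hl hl' => by
    rw [coeff_oneSub, if_neg hl', if_neg hl.ne, sub_zero]

theorem mul_oneSub_inv_mem_congSub {k : ℕ} (hk : k ≠ 0) {x : specialUnits B}
    (hx : x ∈ congSub B k) {a : Tens B k} (ha : PowerSeries.coeff k x.1 = -tof k a) :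
    x * (oneSub hk a)⁻¹ ∈ congSub B (k + 1) := by
  refine mul_inv_mem_congSub fun l hl => ?_
  rw [coeff_oneSub]
  rcases eq_or_ne l 0 with rfl | hl'
  · rw [x.2.1, if_pos rfl, if_neg hk.symm, sub_zero]
  · rw [if_neg hl']
    split_ifs with h
    · rw [h, ha, zero_sub]
    · rw [mem_congSub.1 hx l (by omega) hl', sub_zero]

theorem exists_coeff_eq_neg (x : specialUnits B) (k : ℕ) :
    ∃ a : Tens B k, PowerSeries.coeff k x.1 = -tof k a := by
  obtain ⟨a, ha⟩ := exists_coeff_eq x k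
  exact ⟨-a, by rw [map_neg, neg_neg, ha]⟩

/-- If x ≡ 1 mod t^k, then (x - 1)(y - 1) is divisible by t^{k+1}, because y ≡ 1 mod t; hence
coefficients of degree k add up. -/
theorem coeff_mul_of_mem_congSub {k : ℕ} (hk : k ≠ 0) {x : specialUnits B}
    (hx : x ∈ congSub B k) (y : specialUnits B) :
    PowerSeries.coeff k (x * y).1 = PowerSeries.coeff k x.1 + PowerSeries.coeff k y.1 := by
  have h : PowerSeries.X ^ (k + 1) ∣ (x.1 - 1) * (y.1 - 1) := by
    obtain ⟨c, hc⟩ := hx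
    have hy : y ∈ congSub B 1 := congSub_one (B := B) ▸ Subgroup.mem_top y
    rw [pow_add, hc, mul_assoc]
    exact mul_dvd_mul_left _ (X_pow_dvd_mul hy c)
  have := PowerSeries.X_pow_dvd_iff.1 h k k.lt_succ_self
  have h' : (x.1 - 1) * (y.1 - 1) = (x * y).1 - x.1 - y.1 + 1 := by
    rw [Submonoid.coe_mul]; noncomm_ring
  rw [h', map_add, map_sub, map_sub, PowerSeries.coeff_one, if_neg hk, add_zero] at this
  rw [← sub_eq_zero, ← this]; abel

theorem coeff_oneSub_self {k : ℕ} (hk : k ≠ 0) (a : Tens B k) :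
    PowerSeries.coeff k (oneSub hk a).1 = -tof k a := by
  rw [coeff_oneSub, if_neg hk, if_pos rfl, zero_sub]

theorem tlogCoeff_of_mem_congSub {N : ℕ} {x : specialUnits B} (hx : x ∈ congSub B (N + 1)) :
    tlogCoeff x N = 0 := by
  rw [tlogCoeff_eq_neg_bracket, bracket, Finset.sum_eq_zero, neg_zero]
  intro y hy
  have := Finset.HasAntidiagonal.mem_antidiagonal.1 hy
  -- A factor of degree 0 has an empty transfer, and the coefficients of x in degrees 1, …, N
  -- vanish.
  rcases eq_or_ne y.2 0 with h | h
  · rw [h, transfer_zero]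
  · rw [mem_congSub.1 hx y.2 (by omega) h, mul_zero, map_zero, transfer_zero_apply]

/-! ### Closed subgroups -/

/-- Membership in H depends only on the coefficients below N, so H is the preimage of a subset of a
finite product of discrete spaces. -/
theorem isClosed_of_congSub_le {H : Subgroup (specialUnits B)} {N : ℕ} (h : congSub B N ≤ H) :
    IsClosed (H : Set (specialUnits B)) := by
  let : TopologicalSpace (TAlg B) := ⊥
  have : DiscreteTopology (TAlg B) := ⟨rfl⟩
  let c : specialUnits B → Fin N → TAlg B := fun x k => PowerSeries.coeff k x.1
  have hc : Continuous c := by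
    have h0 : Continuous fun (x : specialUnits B) (k : ℕ) => PowerSeries.coeff k x.1 :=
      continuous_induced_dom
    exact continuous_pi fun k => (continuous_apply (k : ℕ)).comp h0
  have hH : (H : Set (specialUnits B)) = c ⁻¹' (c '' H) := by
    refine Set.Subset.antisymm (Set.subset_preimage_image _ _) ?_
    rintro x ⟨y, hy, hxy⟩
    have h' : x * y⁻¹ ∈ H := h (mul_inv_mem_congSub fun k hk => (congrFun hxy ⟨k, hk⟩).symm)
    have := H.mul_mem h' hy
    rwa [inv_mul_cancel_right] at this
  rw [hH]
  exact (isClosed_discrete _).preimage hc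

/-- Approximations that agree with x in more and more coefficients converge to x in the product
topology. -/
theorem mem_of_isClosed {s : Set (specialUnits B)} (hs : IsClosed s) {x : specialUnits B}
    (h : ∀ N, ∃ y ∈ s, ∀ k < N, PowerSeries.coeff k y.1 = PowerSeries.coeff k x.1) : x ∈ s := by
  let : TopologicalSpace (TAlg B) := ⊥
  choose y hy hyx using h
  refine hs.mem_of_tendsto (f := y) (b := Filter.atTop) ?_ (Filter.Eventually.of_forall hy)
  rw [(Topology.IsInducing.induced
    (fun (f : specialUnits B) (k : ℕ) => PowerSeries.coeff k f.1)).tendsto_nhds_iff,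
    tendsto_pi_nhds]
  intro k
  refine tendsto_const_nhds.congr' ?_
  filter_upwards [Filter.eventually_gt_atTop k] with N hN
  exact (hyx N k hN).symm

variable (p n : ℕ)

theorem isClosed_wittSub (B : BimodPair.{u}) : IsClosed (wittSub p n B : Set (specialUnits B)) := by
  rw [wittSub, Subgroup.coe_sInf]
  exact isClosed_biInter fun H hH => hH.2.1

/-- A normal subgroup that contains the relations and all special units that are congruent to `1`
modulo some power of `t` contains the closed normal subgroup generated by the relations. -/
theorem wittSub_le {H : Subgroup (specialUnits B)} [hn : H.Normal] {N : ℕ} (hN : congSub B N ≤ H)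
    (h : wittRel p n B ⊆ H) : wittSub p n B ≤ H :=
  sInf_le ⟨hn, isClosed_of_congSub_le hN, h⟩

/-! ### The filtration of the Witt vectors -/

variable {p n}

theorem wMk_surjective (w : WittTrunc p n B) : ∃ x, wMk p n x = w :=
  QuotientGroup.mk'_surjective (wittSub p n B) w

theorem wMk_mul (x y : specialUnits B) : wMk p n (x * y) = wMk p n x + wMk p n y := rfl

theorem wMk_one : wMk p n (1 : specialUnits B) = 0 := rfl

theorem wMk_inv (x : specialUnits B) : wMk p n x⁻¹ = -wMk p n x := rfl

theorem wMap_wMk (f : B ⟶ C) (x : specialUnits B) :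
    wMap p n f (wMk p n x) = wMk p n (suMap f x) := rfl

theorem wMk_eq_zero {x : specialUnits B} : wMk p n x = 0 ↔ x ∈ wittSub p n B :=
  QuotientGroup.eq_one_iff x

/-- The filtration of the Witt vectors that is induced by the powers of `t`. -/
def wFil (p n : ℕ) (B : BimodPair.{u}) (k : ℕ) : AddSubgroup (WittTrunc p n B) where
  carrier := {w | ∃ x ∈ congSub B k, wMk p n x = w}
  zero_mem' := ⟨1, one_mem _, rfl⟩
  add_mem' := by
    rintro _ _ ⟨x, hx, rfl⟩ ⟨y, hy, rfl⟩
    exact ⟨x * y, mul_mem hx hy, rfl⟩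
  neg_mem' := by
    rintro _ ⟨x, hx, rfl⟩
    exact ⟨x⁻¹, inv_mem hx, rfl⟩

theorem wMk_mem_wFil {k : ℕ} {x : specialUnits B} (hx : x ∈ congSub B k) :
    wMk p n x ∈ wFil p n B k := ⟨x, hx, rfl⟩

theorem wFil_one : wFil p n B 1 = ⊤ := by
  refine top_unique fun w _ => ?_
  obtain ⟨x, rfl⟩ := wMk_surjective w
  exact wMk_mem_wFil (congSub_one (B := B) ▸ Subgroup.mem_top x)

theorem exists_sub_mem_wFil {k : ℕ} (hk : k ≠ 0) {w : WittTrunc p n B} (hw : w ∈ wFil p n B k) :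
    ∃ a : Tens B k, w - wMk p n (oneSub hk a) ∈ wFil p n B (k + 1) := by
  obtain ⟨x, hx, rfl⟩ := hw
  obtain ⟨a, ha⟩ := exists_coeff_eq_neg x k
  refine ⟨a, ?_⟩
  rw [sub_eq_add_neg, ← wMk_inv, ← wMk_mul]
  exact wMk_mem_wFil (mul_oneSub_inv_mem_congSub hk hx ha)

theorem wMk_sub_oneSub_mem_wFil {k : ℕ} (hk : k ≠ 0) {x : specialUnits B} (hx : x ∈ congSub B k)
    {a : Tens B k} (ha : PowerSeries.coeff k x.1 = -tof k a) :
    wMk p n x - wMk p n (oneSub hk a) ∈ wFil p n B (k + 1) := by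
  rw [sub_eq_add_neg, ← wMk_inv, ← wMk_mul]
  exact wMk_mem_wFil (mul_oneSub_inv_mem_congSub hk hx ha)

/-- Leading coefficients multiply additively. So modulo the next step the class of 1 - a t^k is
additive in a, which makes `leadSub` a subgroup and allows reduction to elementary tensors. -/
theorem oneSub_add_sub_mem_wFil {k : ℕ} (hk : k ≠ 0) (a b : Tens B k) :
    wMk p n (oneSub hk a) + wMk p n (oneSub hk b) - wMk p n (oneSub hk (a + b)) ∈
      wFil p n B (k + 1) := by
  rw [← wMk_mul]
  refine wMk_sub_oneSub_mem_wFil hk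
    (mul_mem (oneSub_mem_congSub hk a) (oneSub_mem_congSub hk b)) ?_
  rw [coeff_mul_of_mem_congSub hk (oneSub_mem_congSub hk a),
    coeff_oneSub_self, coeff_oneSub_self, map_add, neg_add]

theorem oneSub_zero {k : ℕ} (hk : k ≠ 0) : oneSub hk (0 : Tens B k) = 1 := by
  refine Subtype.ext ?_
  change 1 - PowerSeries.monomial k (tof k 0) = (1 : PowerSeries (TAlg B))
  rw [map_zero, map_zero, sub_zero]

/-- The elements `a` of `M^{⊗_R k}` for which the class of `1 - a t^k` lies in a subgroup that
contains the next step of the filtration. -/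
def leadSub {k : ℕ} (hk : k ≠ 0) (H : AddSubgroup (WittTrunc p n B))
    (hH : wFil p n B (k + 1) ≤ H) : AddSubgroup (Tens B k) where
  carrier := {a | wMk p n (oneSub hk a) ∈ H}
  zero_mem' := by
    change wMk p n (oneSub hk 0) ∈ H
    rw [oneSub_zero, wMk_one]; exact zero_mem _
  add_mem' {a b} ha hb := by
    have := sub_mem (add_mem (show wMk p n (oneSub hk a) ∈ H from ha)
      (show wMk p n (oneSub hk b) ∈ H from hb)) (hH (oneSub_add_sub_mem_wFil hk a b))
    rwa [sub_sub_cancel] at this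
  neg_mem' {a} ha := by
    have h := hH (oneSub_add_sub_mem_wFil (p := p) (n := n) hk a (-a))
    rw [add_neg_cancel, oneSub_zero, wMk_one, sub_zero] at h
    have := sub_mem h (show wMk p n (oneSub hk a) ∈ H from ha)
    rwa [add_sub_cancel_left] at this

theorem mem_leadSub {k : ℕ} {hk : k ≠ 0} {H : AddSubgroup (WittTrunc p n B)}
    {hH : wFil p n B (k + 1) ≤ H} {a : Tens B k} :
    a ∈ leadSub hk H hH ↔ wMk p n (oneSub hk a) ∈ H := Iff.rfl

theorem leadSub_eq_top {k : ℕ} {hk : k ≠ 0} {H : AddSubgroup (WittTrunc p n B)}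
    {hH : wFil p n B (k + 1) ≤ H} (h : ∀ m, tprod m k ∈ leadSub hk H hH) (a : Tens B k) :
    a ∈ leadSub hk H hH := by
  induction a using tprod_induction hk with
  | zero => exact zero_mem _
  | tprod m => exact h m
  | add x y hx hy => exact add_mem hx hy

/-- In such a degree 1 - a t^k is a relation for elementary tensors a, and these span all leading
coefficients. -/
theorem wFil_le_succ {k : ℕ} (hk : k ≠ 0) (h : ∀ i ≤ n, k ≠ p ^ i) :
    wFil p n B k ≤ wFil p n B (k + 1) := by
  intro w hw
  obtain ⟨a, ha⟩ := exists_sub_mem_wFil hk hw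
  have h' : a ∈ leadSub hk (wFil p n B (k + 1)) le_rfl := leadSub_eq_top (fun m => by
    rw [mem_leadSub, wMk_eq_zero.2 (wittRel_subset p n B (Or.inr (Or.inr ⟨k, hk, m, h, rfl⟩)))]
    exact zero_mem _) a
  have := add_mem ha (mem_leadSub.1 h')
  rwa [sub_add_cancel] at this

/-- Induction along the filtration of the Witt vectors, from the last step to the first. -/
theorem filtration_induction {P : ℕ → Prop} (last : P (p ^ n + 1))
    (pow : ∀ i ≤ n, P (p ^ i + 1) → P (p ^ i))
    (ne : ∀ k ≠ 0, (∀ i ≤ n, k ≠ p ^ i) → P (k + 1) → P k) : P 1 := by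
  refine Nat.decreasingInduction' (n := p ^ n + 1) (m := 1) (fun k _ hk ih => ?_) (by omega) last
  by_cases h : ∃ i ≤ n, k = p ^ i
  · obtain ⟨i, hi, rfl⟩ := h
    exact pow i hi ih
  · push Not at h
    exact ne k (by omega) h ih

variable [hp : Fact p.Prime]

/-- Beyond degree p^n the filtration of the quotient is constant, so every special unit that is 1
modulo t^{p^n+1} is approximated arbitrarily well by relations; closedness then gives membership.
This is the only use of the closure in the definition of `wittSub`. -/
theorem congSub_le_wittSub (p n : ℕ) [hp : Fact p.Prime] (B : BimodPair.{u}) :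
    congSub B (p ^ n + 1) ≤ wittSub p n B := by
  have key : ∀ d, wFil p n B (p ^ n + 1) ≤ wFil p n B (p ^ n + 1 + d) := by
    intro d
    induction d with
    | zero => exact le_rfl
    | succ d ih =>
      refine ih.trans (wFil_le_succ (by omega) fun i hi h => ?_)
      have := Nat.pow_le_pow_right hp.out.pos hi
      omega
  intro x hx
  refine mem_of_isClosed (isClosed_wittSub p n B) fun N => ?_
  -- Here y has the same class as x but is 1 to high order; x y⁻¹ is a relation that still agrees
  -- with x below degree N.
  obtain ⟨y, hy, hyx⟩ := key N (wMk_mem_wFil hx)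
  refine ⟨x * y⁻¹, ?_, fun k hk => coeff_eq_of_mem_congSub (inv_mem hy) x (by omega)⟩
  change _ ∈ wittSub p n B
  rw [← wMk_eq_zero, wMk_mul, wMk_inv, hyx, add_neg_cancel]

theorem wFil_eq_bot : wFil p n B (p ^ n + 1) = ⊥ := by
  refine bot_unique ?_
  rintro _ ⟨x, hx, rfl⟩
  exact wMk_eq_zero.2 (congSub_le_wittSub p n B hx)

/-- The classes of `1 - m_1 ⊗ ⋯ ⊗ m_k t^k` with `k = p^i` and `i ≤ n` generate the Witt vectors. -/
theorem witt_induction {P : WittTrunc p n B → Prop} (zero : P 0)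
    (add : ∀ x y, P x → P y → P (x + y))
    (neg : ∀ x, P x → P (-x)) (tprod : ∀ i ≤ n, ∀ m : ℕ → B.M,
      P (wMk p n (oneSub (pow_ne_zero i hp.out.ne_zero) (tprod m (p ^ i))))) (w) : P w := by
  let H : AddSubgroup (WittTrunc p n B) :=
    { carrier := {w | P w}
      zero_mem' := zero
      add_mem' := fun {x y} => add x y
      neg_mem' := fun {x} => neg x }
  have h : wFil p n B 1 ≤ H := by
    refine filtration_induction (P := fun k => wFil p n B k ≤ H) (p := p) (n := n) ?_ ?_ ?_
    · rw [wFil_eq_bot]; exact bot_le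
    · intro i hi ih w hw
      obtain ⟨a, ha⟩ := exists_sub_mem_wFil (pow_ne_zero i hp.out.ne_zero) hw
      have h' : a ∈ leadSub (pow_ne_zero i hp.out.ne_zero) H ih :=
        leadSub_eq_top (fun m => mem_leadSub.2 (tprod i hi m)) a
      have := add_mem (ih ha) (mem_leadSub.1 h')
      rwa [sub_add_cancel] at this
    · exact fun k hk h ih => (wFil_le_succ hk h).trans ih
  rw [wFil_one] at h
  exact h (AddSubgroup.mem_top w)

/-- `wMk` as a homomorphism. -/
def wHom (p n : ℕ) (B : BimodPair.{u}) : specialUnits B →* Multiplicative (WittTrunc p n B) :=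
  QuotientGroup.mk' (wittSub p n B)

theorem gammaRep_eq_sum (m : Coord p (n + 1) B) :
    gammaRep p n m = ∑ i : Fin (n + 1), wMk p n (oneSub (pow_ne_zero i hp.out.ne_zero) (m i)) := by
  change Multiplicative.toAdd (wHom p n B _) = _
  rw [map_list_prod, List.map_ofFn, List.prod_ofFn, toAdd_prod]
  rfl

/-- The leading coefficient in degree p^i becomes the coordinate of index i. The induction also
records that coordinates of degree below the current step are zero, so that they are still free to
be set. -/
theorem gammaRep_surjective (w : WittTrunc p n B) :
    ∃ m : Coord p (n + 1) B, gammaRep p n m = w := by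
  have h : ∀ w ∈ wFil p n B 1, ∃ m : Coord p (n + 1) B,
      (∀ i : Fin (n + 1), p ^ (i : ℕ) < 1 → m i = 0) ∧ gammaRep p n m = w := by
    refine filtration_induction (p := p) (n := n) (P := fun k => ∀ w ∈ wFil p n B k,
      ∃ m : Coord p (n + 1) B, (∀ i : Fin (n + 1), p ^ (i : ℕ) < k → m i = 0) ∧
        gammaRep p n m = w) ?_ ?_ ?_
    · intro w hw
      rw [wFil_eq_bot, AddSubgroup.mem_bot] at hw
      refine ⟨fun _ => 0, fun _ _ => rfl, ?_⟩
      rw [gammaRep_eq_sum, hw]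
      exact Finset.sum_eq_zero fun i _ => by rw [oneSub_zero, wMk_one]
    · intro i hi ih w hw
      obtain ⟨a, ha⟩ := exists_sub_mem_wFil (pow_ne_zero i hp.out.ne_zero) hw
      obtain ⟨m, hm, hmw⟩ := ih _ ha
      let i' : Fin (n + 1) := ⟨i, by omega⟩
      -- By the induction hypothesis the coordinate `i'` of m is zero, so overwriting it adds
      -- exactly the class of 1 - a t^{p^i}.
      refine ⟨Function.update m i' a, fun j hj => ?_, ?_⟩
      · have : j ≠ i' := by rintro rfl; exact lt_irrefl _ hj
        rw [Function.update_of_ne this]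
        exact hm j (by omega)
      · rw [eq_sub_iff_add_eq] at hmw
        rw [← hmw, ← sub_eq_iff_eq_add', gammaRep_eq_sum, gammaRep_eq_sum,
          ← Finset.sum_sub_distrib, Finset.sum_eq_single i']
        · rw [Function.update_self, hm i' (Nat.lt_succ_self _), oneSub_zero, wMk_one, sub_zero]
        · intro j _ hj
          rw [Function.update_of_ne hj, sub_self]
        · intro h; exact absurd (Finset.mem_univ _) h
    · intro k hk h ih w hw
      obtain ⟨m, hm, hmw⟩ := ih w (wFil_le_succ hk h hw)
      exact ⟨m, fun j hj => hm j (by omega), hmw⟩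
  obtain ⟨m, -, hm⟩ := h w (by rw [wFil_one]; exact AddSubgroup.mem_top w)
  exact ⟨m, hm⟩

end

/-! ### Graded pieces and injectivity of the logarithmic derivative -/

section

variable {B C D : BimodPair.{u}} {p n : ℕ}

/-! ### Leading coefficients that vanish in the Witt vectors -/

/-- The commutator of 1 - u t^i and 1 - v t^j is trivial in the Witt vectors and has leading term
(uv - vu) t^{i+j}. The tensors a and b are given through their images in the tensor algebra, which
avoids a cast between i + j and j + i. -/
theorem tensMul_sub_mem_leadSub {i j : ℕ} (hi : i ≠ 0) (hj : j ≠ 0) (u : Tens B i) (v : Tens B j)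
    {k : ℕ} (hk : k ≠ 0) {a b : Tens B k} (ha : tof k a = tof i u * tof j v)
    (hb : tof k b = tof j v * tof i u) (hij : i + j = k) :
    a - b ∈ leadSub hk (wFil p n B (k + 1)) le_rfl := by
  have hd : (oneSub hi u * oneSub hj v).1 - (oneSub hj v * oneSub hi u).1 =
      PowerSeries.monomial k (tof k a - tof k b) := by
    change (1 - PowerSeries.monomial i (tof i u)) * (1 - PowerSeries.monomial j (tof j v)) -
      (1 - PowerSeries.monomial j (tof j v)) * (1 - PowerSeries.monomial i (tof i u)) = _
    have h₁ := PowerSeries.monomial_mul_monomial i j (tof i u) (tof j v)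
    have h₂ := PowerSeries.monomial_mul_monomial j i (tof j v) (tof i u)
    rw [add_comm] at h₂
    rw [map_sub, ha, hb, ← hij, ← h₁, ← h₂]
    noncomm_ring
  have hc : ∀ l, PowerSeries.coeff l (oneSub hi u * oneSub hj v).1 -
      PowerSeries.coeff l (oneSub hj v * oneSub hi u).1 =
        if l = k then tof k a - tof k b else 0 := fun l => by
    rw [← map_sub, hd, PowerSeries.coeff_monomial]
  set x := oneSub hi u * oneSub hj v
  set y := oneSub hj v * oneSub hi u
  have hz : x * y⁻¹ ∈ congSub B k := mul_inv_mem_congSub fun l hl => by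
    have := hc l
    rwa [if_neg hl.ne, sub_eq_zero] at this
  have hz' : PowerSeries.coeff k (x * y⁻¹).1 = -tof k (b - a) := by
    have h := coeff_mul_of_mem_congSub hk hz y
    rw [inv_mul_cancel_right] at h
    have h' := hc k
    rw [if_pos rfl, h, add_sub_cancel_right] at h'
    rw [h', map_sub, neg_sub]
  have h := wMk_sub_oneSub_mem_wFil (p := p) (n := n) hk hz hz'
  have h0 : wMk p n (x * y⁻¹) = 0 := by
    rw [wMk_mul, wMk_inv, wMk_mul, wMk_mul, add_comm, neg_add_eq_zero, add_comm]
  rw [h0, zero_sub, neg_mem_iff, ← mem_leadSub (hH := le_rfl)] at h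
  have := neg_mem h
  rwa [neg_sub] at this

/-- For k > 0 this comes from a commutator. For k = 0 the tensor a is a scalar, and the relation
τ(rm)/τ(mr) takes its place. -/
theorem snoc_sub_cons_mem_leadSub {k : ℕ} (a : Tens B k) (m : B.M) :
    snoc a m - cons m a ∈ leadSub k.succ_ne_zero (wFil p n B (k + 1 + 1)) le_rfl := by
  rcases eq_or_ne k 0 with rfl | hk
  · have h : a = op (scal a) • tensOne B := (one_mul (scal a)).symm
    have h₁ : snoc a m = snoc (tensOne B) (scal a • m) := by rw [← snoc_op_smul, ← h]
    have h₂ : cons m a = snoc (tensOne B) (op (scal a) • m) := rfl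
    have h₃ := oneSub_add_sub_mem_wFil (p := p) (n := n) (Nat.succ_ne_zero 0)
      (snoc a m - cons m a) (cons m a)
    have h₄ : wMk p n (tau (scal a • m)) = wMk p n (tau (op (scal a) • m)) := by
      rw [← sub_eq_zero, sub_eq_add_neg, ← wMk_inv, ← wMk_mul, wMk_eq_zero]
      exact wittRel_subset p n B (Or.inr (Or.inl ⟨_, _, rfl⟩))
    rw [sub_add_cancel] at h₃
    have h₅ : wMk p n (oneSub (Nat.succ_ne_zero 0) (snoc a m)) =
        wMk p n (oneSub (Nat.succ_ne_zero 0) (cons m a)) := by rw [h₁, h₂]; exact h₄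
    rw [h₅, add_sub_cancel_right] at h₃
    exact h₃
  · refine tensMul_sub_mem_leadSub hk one_ne_zero a (snoc (tensOne B) m) _ (tof_snoc a m)
      (tof_cons m a) rfl

/-- Two rotations suffice: r(a ⊗ m) is equivalent to m ⊗ ra = mr ⊗ a, and this to a ⊗ mr = (a ⊗ m)r.
-/
theorem commSub_le_leadSub {k : ℕ} (hk : k ≠ 0) :
    commSub B k ≤ leadSub hk (wFil p n B (k + 1)) le_rfl := by
  obtain ⟨k, rfl⟩ := Nat.exists_eq_succ_of_ne_zero hk
  rw [commSub, AddSubgroup.closure_le]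
  rintro _ ⟨r, a, rfl⟩
  induction a using snoc_induction with
  | zero => rw [smul_zero, smul_zero, sub_zero]; exact zero_mem _
  | add x y hx hy =>
    have := add_mem hx hy
    rwa [sub_add_sub_comm, ← smul_add, ← smul_add] at this
  | snoc a m =>
    have h₁ := snoc_sub_cons_mem_leadSub (p := p) (n := n) (r • a) m
    have h₂ := snoc_sub_cons_mem_leadSub (p := p) (n := n) a (op r • m)
    rw [cons_smul] at h₁
    have := sub_mem h₁ h₂
    rwa [sub_sub_sub_cancel_right, ← smul_snoc, ← op_smul_snoc] at this

/-- Lift y - σy to a sum of differences a ⊗ m - m ⊗ a; another lift differs from it by an element of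
`commSub`. Thus the graded piece of degree k is a quotient of the C_k-coinvariants of the cyclic
tensor power. -/
theorem mem_leadSub_of_rot {k : ℕ} (hk : k ≠ 0) {a : Tens B k} {y : Cyc B k}
    (h : cycMk a = y - rot B k y) : a ∈ leadSub hk (wFil p n B (k + 1)) le_rfl := by
  have key : ∀ b : Tens B k, ∃ c : Tens B k, cycMk c = cycMk b - rot B k (cycMk b) ∧
      c ∈ leadSub hk (wFil p n B (k + 1)) le_rfl := by
    obtain ⟨k, rfl⟩ := Nat.exists_eq_succ_of_ne_zero hk
    intro b
    induction b using snoc_induction with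
    | zero => exact ⟨0, by simp only [map_zero, sub_zero], zero_mem _⟩
    | add x y hx hy =>
      obtain ⟨c, hc, hc'⟩ := hx
      obtain ⟨d, hd, hd'⟩ := hy
      exact ⟨c + d, by rw [map_add, map_add, map_add, hc, hd]; abel, add_mem hc' hd'⟩
    | snoc a m =>
      exact ⟨snoc a m - cons m a, by rw [map_sub, rot_mk_snoc], snoc_sub_cons_mem_leadSub a m⟩
  obtain ⟨b, rfl⟩ := cycMk_surjective k y
  obtain ⟨c, hc, hc'⟩ := key b
  have h' : a - c ∈ commSub B k := by
    rw [← QuotientAddGroup.eq_zero_iff]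
    change cycMk (a - c) = 0
    rw [map_sub, h, hc, sub_self]
  have := add_mem (commSub_le_leadSub (p := p) (n := n) hk h') hc'
  rwa [sub_add_cancel] at this

/-- The vanishing of the Tate cohomology group `Ĥ⁻¹(C_k; M^{⊚_R k})` for all `k`. -/
def NormExact (B : BimodPair.{u}) : Prop :=
  ∀ k ≠ 0, ∀ x : Cyc B k, transfer B k k x = 0 → ∃ y, x = y - rot B k y

/-! ### The logarithmic derivative on the Witt vectors -/

/-- An element of `R`, seen in `M^{⊗_R 0}`. -/
def ofRing (r : B.R) : Tens B 0 := r

theorem iota_smul (r : B.R) (m : B.M) : iota (r • m) = tof 0 (ofRing r) * iota m := by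
  have h : ofRing r = op r • tensOne B := (one_mul r).symm
  rw [iota, ← snoc_op_smul, tof_snoc, ← h]

theorem iota_op_smul (r : B.R) (m : B.M) : iota (op r • m) = iota m * tof 0 (ofRing r) := by
  rw [iota, ← op_smul_snoc]
  exact (tof_mul (snoc (tensOne B) m) (ofRing r)).symm

theorem tlogCoeff_tau (m : B.M) {N : ℕ} (hN : N ≠ 0) :
    tlogCoeff (tau m) N = cycComp N (iota m ^ N) := by
  rw [tau, tlogCoeff_oneSub _ _ hN, if_pos (one_dvd N), Nat.div_one, transfer,
    Finset.sum_range_one]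
  rfl

/-- One has (rm)^{N+1} = r · (mr)^N m and (mr)^{N+1} = (mr)^N m · r, which agree cyclically; r has
degree 0, so no rotation is needed. -/
theorem tlogCoeff_tau_smul (r : B.R) (m : B.M) {N : ℕ} (hN : N ≠ 0) :
    tlogCoeff (tau (r • m)) N = tlogCoeff (tau (op r • m)) N := by
  obtain ⟨N, rfl⟩ := Nat.exists_eq_succ_of_ne_zero hN
  rw [tlogCoeff_tau _ hN, tlogCoeff_tau _ hN]
  have h : iota (r • m) ^ (N + 1) =
      tof 0 (ofRing r) * (iota (op r • m) ^ N * iota m) := by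
    rw [iota_smul, iota_op_smul, pow_succ', mul_assoc, mul_pow_mul]
  have h' : iota (op r • m) ^ N = tof (1 * N) (tprod (fun _ => op r • m) (1 * N)) :=
    tof_tprod_pow (fun _ => op r • m) 1 N
  have h'' : iota (op r • m) ^ (N + 1) =
      iota (op r • m) ^ N * iota m * tof 0 (ofRing r) := by
    rw [pow_succ, mul_assoc, ← iota_op_smul]
  rw [Nat.succ_eq_add_one, h, h'', h', ← tof_snoc]
  exact (rot_iterate_cycComp_mul _ _ _).symm

variable [hp : Fact p.Prime]

/-- The kernel of tlog in degree p^j is normal and contains all units that are 1 modulo t^{p^n+1},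
so only the relations must be checked. Those of the third kind contribute only if k divides p^j, and
every such k is an excluded power of p. -/
theorem tlogCoeff_of_mem_wittSub {x : specialUnits B} (hx : x ∈ wittSub p n B) {j : ℕ}
    (hj : j ≤ n) : tlogCoeff x (p ^ j) = 0 := by
  refine wittSub_le p n (H := (tlogHom B (p ^ j)).ker) (N := p ^ n + 1) ?_ ?_ hx
  · intro x hx
    refine tlogCoeff_of_mem_congSub (congSub_anti ?_ hx)
    have := Nat.pow_le_pow_right hp.out.pos hj
    omega
  · have hN : p ^ j ≠ 0 := pow_ne_zero j hp.out.ne_zero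
    rintro _ (⟨a, b, rfl⟩ | ⟨r, m, rfl⟩ | ⟨k, hk, m, h, rfl⟩)
    · rw [SetLike.mem_coe, MonoidHom.mem_ker, map_mul, map_mul, map_mul, map_inv, map_inv,
        mul_inv_cancel_comm, mul_inv_cancel]
    · change tlogCoeff _ _ = 0
      rw [tlogCoeff_mul, tlogCoeff_inv, tlogCoeff_tau_smul r m hN, add_neg_cancel]
    · change tlogCoeff _ _ = 0
      rw [tlogCoeff_oneSub hk _ hN, if_neg, map_zero, transfer_zero_apply]
      intro hd
      obtain ⟨i, hi, rfl⟩ := (Nat.dvd_prime_pow hp.out).1 hd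
      exact h i (hi.trans hj) rfl

/-- The logarithmic derivative `tlog_{⟨p^n⟩}`. -/
def tlogW (p n : ℕ) [hp : Fact p.Prime] (B : BimodPair.{u}) :
    WittTrunc p n B →+ ∀ j : Fin (n + 1), cycInv B (p ^ (j : ℕ)) :=
  MonoidHom.toAdditiveLeft (QuotientGroup.lift (wittSub p n B)
    (MonoidHom.mk' (fun x => Multiplicative.ofAdd fun j : Fin (n + 1) =>
        (⟨tlogCoeff x (p ^ (j : ℕ)), tlogCoeff_mem_cycInv x _⟩ : cycInv B (p ^ (j : ℕ))))
      (fun x y => congrArg Multiplicative.ofAdd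
        (funext fun j => Subtype.ext (tlogCoeff_mul x y _))))
    (fun x hx => congrArg Multiplicative.ofAdd
      (funext fun j => Subtype.ext (tlogCoeff_of_mem_wittSub hx (by omega)))))

theorem tlogW_wMk (x : specialUnits B) (j : Fin (n + 1)) :
    (tlogW p n B (wMk p n x) j : Cyc B (p ^ (j : ℕ))) = tlogCoeff x (p ^ (j : ℕ)) := rfl

theorem tlogW_wMap (f : B ⟶ C) (w : WittTrunc p n B) (j : Fin (n + 1)) :
    (tlogW p n C (wMap p n f w) j : Cyc C (p ^ (j : ℕ))) =
      cycMap f _ (tlogW p n B w j : Cyc B (p ^ (j : ℕ))) := by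
  obtain ⟨x, rfl⟩ := wMk_surjective w
  rw [wMap_wMk, tlogW_wMk, tlogW_wMk, tlogCoeff_suMap]

/-- The factor 1 - m_i t^{p^i} gives the i-th summand of the ghost component; for i > j it gives
nothing, as p^i does not divide p^j. -/
theorem tlogW_gammaRep (m : Coord p (n + 1) B) (j : Fin (n + 1)) :
    (tlogW p n B (gammaRep p n m) j : Cyc B (p ^ (j : ℕ))) = ghost p (n + 1) m j := by
  rw [gammaRep_eq_sum, map_sum, Finset.sum_apply, AddSubgroup.val_finsetSum, ghost,
    Finset.sum_filter]
  refine Finset.sum_congr rfl fun i _ => ?_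
  rw [tlogW_wMk, tlogCoeff_oneSub _ _ (pow_ne_zero _ hp.out.ne_zero)]
  split_ifs with h₁ h₂ h₂
  · rw [Nat.pow_div h₂ hp.out.pos]; rfl
  · exact absurd ((Nat.pow_dvd_pow_iff_le_right hp.out.one_lt).1 h₁) h₂
  · exact absurd ((Nat.pow_dvd_pow_iff_le_right hp.out.one_lt).2 h₂) h₁
  · rw [map_zero, transfer_zero_apply]

/-! ### Injectivity of the logarithmic derivative -/

/-- A class killed by tlog is pushed down the finite filtration step by step: its leading
coefficient has norm zero, hence is y - σy cyclically, hence is absorbed by the next step. -/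
theorem tlogW_injective (hB : NormExact B) : Function.Injective (tlogW p n B) := by
  have h : ∀ w ∈ wFil p n B 1, tlogW p n B w = 0 → w = 0 := by
    refine filtration_induction (p := p) (n := n)
      (P := fun k => ∀ w ∈ wFil p n B k, tlogW p n B w = 0 → w = 0) ?_ ?_ ?_
    · intro w hw _
      rwa [wFil_eq_bot] at hw
    · intro i hi ih w hw h0
      have hk : p ^ i ≠ 0 := pow_ne_zero i hp.out.ne_zero
      obtain ⟨a, y, hy, hya⟩ := exists_sub_mem_wFil hk hw
      -- The remainder y is 1 modulo t^{p^i+1} and does not contribute in degree p^i, so the leading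
      -- term alone has vanishing tlog there.
      have h₁ : tlogCoeff (oneSub hk a) (p ^ i) = 0 := by
        have h := congrArg (fun v => (tlogW p n B v ⟨i, by omega⟩ : Cyc B (p ^ i))) hya
        dsimp only at h
        rw [map_sub, h0, zero_sub] at h
        change tlogCoeff y (p ^ i) = -tlogCoeff (oneSub hk a) (p ^ i) at h
        rwa [tlogCoeff_of_mem_congSub hy, eq_comm, neg_eq_zero] at h
      rw [tlogCoeff_oneSub hk a hk, if_pos dvd_rfl, Nat.div_self (Nat.pos_of_ne_zero hk), pow_one,
        cycComp_tof] at h₁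
      obtain ⟨z, hz⟩ := hB _ hk _ h₁
      have h₂ := add_mem (wMk_mem_wFil (p := p) (n := n) hy)
        (mem_leadSub.1 (mem_leadSub_of_rot hk hz))
      rw [hya, sub_add_cancel] at h₂
      exact ih w h₂ h0
    · exact fun k hk h ih w hw => ih w (wFil_le_succ hk h hw)
  rw [injective_iff_map_eq_zero]
  exact fun w => h w (by rw [wFil_one]; exact AddSubgroup.mem_top w)

end

/-! ### Vanishing of Tate cohomology for pairs with a basis -/

section

variable {B C D : BimodPair.{u}}

/-! ### Permutation modules -/

theorem basis_induction {ι A : Type*} [AddCommGroup A] (b : Module.Basis ι ℤ A) {P : A → Prop}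
    (zero : P 0) (add : ∀ x y, P x → P y → P (x + y)) (smul : ∀ (c : ℤ) x, P x → P (c • x))
    (basis : ∀ i, P (b i)) (x : A) : P x := by
  refine Submodule.span_induction (p := fun x _ => P x) ?_ zero (fun x y _ _ => add x y)
    (fun c x _ => smul c x) (b.mem_span x)
  rintro _ ⟨i, rfl⟩
  exact basis i

/-- The Tate cohomology group `Ĥ⁻¹` of a cyclic group vanishes on permutation modules. -/
theorem exists_eq_sub_of_sum_iterate_eq_zero {ι A : Type*} [AddCommGroup A]
    (b : Module.Basis ι ℤ A) (σ : A →+ A) (π : ι → ι) (h : ∀ i, σ (b i) = b (π i)) {k : ℕ}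
    (hk : k ≠ 0) {x : A} (hx : ∑ s ∈ Finset.range k, σ^[s] x = 0) : ∃ y, x = y - σ y := by
  let r : ι → ι → Prop := fun i j => j = π i
  -- The map ρ sends each basis vector to a chosen representative of its orbit: it is insensitive to
  -- σ, and it is the identity modulo the image of 1 - σ.
  let ρ : A →ₗ[ℤ] A := b.constr ℤ fun i => b (Quot.mk r i).out
  have hρ : ∀ i, ρ (b i) = b (Quot.mk r i).out := fun i => b.constr_basis ℤ _ i
  have h₁ : ∀ y, ρ (σ y) = ρ y := fun y => by
    refine LinearMap.congr_fun (f := ρ.comp σ.toIntLinearMap) (b.ext fun i => ?_) y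
    change ρ (σ (b i)) = _
    rw [h, hρ, hρ, Quot.sound (show r i (π i) from rfl)]
  have h₂ : ∀ s y, ρ (σ^[s] y) = ρ y := fun s y => by
    induction s generalizing y with
    | zero => rfl
    | succ s ih => rw [Function.iterate_succ_apply, ih, h₁]
  have h₃ : ∀ i j, Relation.EqvGen r i j → b i - b j ∈ (AddMonoidHom.id A - σ).range := by
    intro i j hij
    induction hij with
    | rel i j hij =>
      refine ⟨b i, ?_⟩
      rw [AddMonoidHom.sub_apply, h, hij]; rfl
    | refl i => rw [sub_self]; exact zero_mem _
    | symm i j _ ih =>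
      have := neg_mem ih
      rwa [neg_sub] at this
    | trans i j l _ _ ih ih' =>
      have := add_mem ih ih'
      rwa [sub_add_sub_cancel] at this
  have h₄ : ∀ y, y - ρ y ∈ (AddMonoidHom.id A - σ).range := fun y => by
    induction y using basis_induction b with
    | zero => rw [map_zero, sub_zero]; exact zero_mem _
    | add y z hy hz => rw [map_add, add_sub_add_comm]; exact add_mem hy hz
    | smul c y hy => rw [map_smul, ← smul_sub]; exact zsmul_mem hy c
    | basis i =>
      rw [hρ]
      exact h₃ _ _ (Quot.eqvGen_exact (Quot.out_eq _).symm)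
  -- Applied to the vanishing norm, ρ turns all k summands into ρ x; since A is torsion-free, ρ x =
  -- 0 and x = x - ρ x lies in the image of 1 - σ.
  have h₅ : (k : ℤ) • ρ x = 0 := by
    have := congrArg ρ hx
    rw [map_sum, map_zero] at this
    simpa only [h₂, Finset.sum_const, Finset.card_range, natCast_zsmul] using this
  have : Module.Free ℤ A := Module.Free.of_basis b
  have h₆ := (smul_eq_zero.1 h₅).resolve_left (Nat.cast_ne_zero.2 hk)
  obtain ⟨y, hy⟩ := h₄ x
  rw [h₆, sub_zero] at hy
  exact ⟨y, hy.symm⟩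

/-! ### Pairs that are free over `ℤ` and as bimodules -/

/-- The ring `R` is a free abelian group with basis `α`, and `M` is a free bimodule with
basis `b`. -/
structure BimodBasis (B : BimodPair.{u}) : Type (u + 1) where
  A : Type u
  Y : Type u
  α : Module.Basis A ℤ B.R
  b : Y → B.M
  e : (Y →₀ B.R ⊗[ℤ] B.R) ≃+ B.M
  e_single : ∀ y l r, e (Finsupp.single y (l ⊗ₜ r)) = l • op r • b y

namespace BimodBasis

variable (G : BimodBasis B)

/-- The coordinate of index `y`. -/
def comp (y : G.Y) : B.M →+ B.R ⊗[ℤ] B.R := (Finsupp.applyAddHom y).comp G.e.symm.toAddMonoidHom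

theorem comp_apply (y : G.Y) (m : B.M) : G.comp y m = G.e.symm m y := rfl

theorem induction {P : B.M → Prop} (zero : P 0) (add : ∀ x y, P x → P y → P (x + y))
    (single : ∀ y l r, P (G.e (Finsupp.single y (l ⊗ₜ r)))) (m : B.M) : P m := by
  obtain ⟨f, rfl⟩ := G.e.surjective m
  induction f using Finsupp.induction_linear with
  | zero => rw [map_zero]; exact zero
  | add f g hf hg => rw [map_add]; exact add _ _ hf hg
  | single y x =>
    induction x with
    | zero => rw [Finsupp.single_zero, map_zero]; exact zero
    | add x y hx hy => rw [Finsupp.single_add, map_add]; exact add _ _ hx hy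
    | tmul l r => exact single y l r

theorem smul_e_single (s : B.R) (y : G.Y) (l r : B.R) :
    s • G.e (Finsupp.single y (l ⊗ₜ r)) = G.e (Finsupp.single y ((s * l) ⊗ₜ r)) := by
  rw [e_single, e_single, mul_smul]

theorem op_smul_e_single (s : B.R) (y : G.Y) (l r : B.R) :
    op s • G.e (Finsupp.single y (l ⊗ₜ r)) = G.e (Finsupp.single y (l ⊗ₜ (r * s))) := by
  rw [e_single, e_single, op_mul, mul_smul, smul_comm l (op s)]

theorem comp_e_single (y y' : G.Y) (x : B.R ⊗[ℤ] B.R) [Decidable (y' = y)] :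
    G.comp y (G.e (Finsupp.single y' x)) = if y' = y then x else 0 := by
  classical
  rw [comp_apply, AddEquiv.symm_apply_apply, Finsupp.single_apply]

theorem comp_smul (y : G.Y) (s : B.R) (m : B.M) :
    G.comp y (s • m) = (s ⊗ₜ 1) * G.comp y m := by
  classical
  induction m using G.induction with
  | zero => rw [smul_zero, map_zero, mul_zero]
  | add x y hx hy => rw [smul_add, map_add, hx, hy, map_add, mul_add]
  | single y' l r =>
    rw [smul_e_single, comp_e_single, comp_e_single]
    split_ifs
    · rw [Algebra.TensorProduct.tmul_mul_tmul, one_mul]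
    · rw [mul_zero]

theorem comp_op_smul (y : G.Y) (s : B.R) (m : B.M) :
    G.comp y (op s • m) = G.comp y m * (1 ⊗ₜ s) := by
  classical
  induction m using G.induction with
  | zero => rw [smul_zero, map_zero, zero_mul]
  | add x y hx hy => rw [smul_add, map_add, hx, hy, map_add, add_mul]
  | single y' l r =>
    rw [op_smul_e_single, comp_e_single, comp_e_single]
    split_ifs
    · rw [Algebra.TensorProduct.tmul_mul_tmul, mul_one]
    · rw [zero_mul]

/-- The map `l ⊗ r ↦ (t ↦ c(t l) r)`, where `c` is the coordinate of index `a`. -/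
def contract (a : G.A) : B.R ⊗[ℤ] B.R →ₗ[ℤ] B.R →ₗ[ℤ] B.R :=
  TensorProduct.lift (LinearMap.mk₂ ℤ
    (fun l r => (LinearMap.toSpanSingleton ℤ B.R r).comp
      ((G.α.coord a).comp (LinearMap.mulRight ℤ l)))
    (fun l l' r => by ext t; simp [mul_add, add_smul])
    (fun c l r => LinearMap.ext fun t => by
      change G.α.coord a (t * c • l) • r = c • G.α.coord a (t * l) • r
      rw [mul_smul_comm, map_smul, smul_assoc])
    (fun l r r' => by ext t; simp)
    (fun c l r => LinearMap.ext fun t => smul_comm (G.α.coord a (t * l)) c r))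

theorem contract_tmul (a : G.A) (l r t : B.R) :
    G.contract a (l ⊗ₜ r) t = G.α.coord a (t * l) • r := rfl

theorem contract_tmul_one_mul (a : G.A) (s : B.R) (x : B.R ⊗[ℤ] B.R) (t : B.R) :
    G.contract a ((s ⊗ₜ 1) * x) t = G.contract a x (t * s) := by
  induction x with
  | zero => rw [mul_zero, map_zero]; rfl
  | add x y hx hy => rw [mul_add, map_add, map_add, LinearMap.add_apply, hx, hy]; rfl
  | tmul l r =>
    rw [Algebra.TensorProduct.tmul_mul_tmul, one_mul, contract_tmul, contract_tmul, mul_assoc]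

theorem contract_mul_one_tmul (a : G.A) (s : B.R) (x : B.R ⊗[ℤ] B.R) (t : B.R) :
    G.contract a (x * (1 ⊗ₜ s)) t = G.contract a x t * s := by
  induction x with
  | zero => rw [zero_mul, map_zero]; simp
  | add x y hx hy =>
    rw [add_mul, map_add, map_add, LinearMap.add_apply, hx, hy, LinearMap.add_apply, add_mul]
  | tmul l r =>
    rw [Algebra.TensorProduct.tmul_mul_tmul, mul_one, contract_tmul, contract_tmul, smul_mul_assoc]

/-- The coordinate of index `(a, y)` of the right module `M`, after left multiplication by a
variable element of `R`. -/
def coef (e : G.A × G.Y) (m : B.M) : B.R →ₗ[ℤ] B.R := G.contract e.1 (G.comp e.2 m)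

theorem coef_smul (e : G.A × G.Y) (s : B.R) (m : B.M) (t : B.R) :
    G.coef e (s • m) t = G.coef e m (t * s) := by
  rw [coef, comp_smul, contract_tmul_one_mul]; rfl

theorem coef_op_smul (e : G.A × G.Y) (s : B.R) (m : B.M) (t : B.R) :
    G.coef e (op s • m) t = G.coef e m t * s := by
  rw [coef, comp_op_smul, contract_mul_one_tmul]; rfl

theorem coef_add (e : G.A × G.Y) (m m' : B.M) : G.coef e (m + m') = G.coef e m + G.coef e m' := by
  rw [coef, map_add, map_add]; rfl

/-- The balancing relation over R that lets `word` be extended by one more tensor factor. -/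
theorem lTensor_coef_mul (e : G.A × G.Y) (s : B.R) (m : B.M) (x : B.R ⊗[ℤ] B.R) :
    (G.coef e m).lTensor B.R (x * (1 ⊗ₜ s)) = (G.coef e (s • m)).lTensor B.R x := by
  induction x with
  | zero => rw [zero_mul, map_zero, map_zero]
  | add x y hx hy => rw [add_mul, map_add, map_add, hx, hy]
  | tmul l r =>
    rw [Algebra.TensorProduct.tmul_mul_tmul, mul_one, LinearMap.lTensor_tmul,
      LinearMap.lTensor_tmul, coef_smul]

theorem lTensor_coef_op_smul (e : G.A × G.Y) (s : B.R) (m : B.M) (x : B.R ⊗[ℤ] B.R) :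
    (G.coef e (op s • m)).lTensor B.R x = (G.coef e m).lTensor B.R x * (1 ⊗ₜ s) := by
  induction x with
  | zero => rw [map_zero, map_zero, zero_mul]
  | add x y hx hy => rw [map_add, map_add, hx, hy, add_mul]
  | tmul l r =>
    rw [LinearMap.lTensor_tmul, LinearMap.lTensor_tmul, coef_op_smul,
      Algebra.TensorProduct.tmul_mul_tmul, mul_one]

/-- The component of index `(w 0).2` in the first factor, with the other factors contracted by the
coordinates of index `w 1, …, w k`. -/
def word (w : ℕ → G.A × G.Y) : ∀ k : ℕ,
    { φ : Tens B (k + 1) →+ B.R ⊗[ℤ] B.R // ∀ (s : B.R) a, φ (op s • a) = φ a * (1 ⊗ₜ s) }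
  | 0 => ⟨snocLift (fun r m => G.comp (w 0).2 (scal r • m))
      (fun r r' m => by
        rw [← map_add, ← add_smul]; rfl)
      (fun r m m' => by rw [smul_add, map_add])
      (fun r s m => by
        rw [← mul_smul]; rfl), fun s a => by
      induction a using snoc_induction with
      | zero => rw [smul_zero, map_zero, zero_mul]
      | add x y hx hy => rw [smul_add, map_add, hx, hy, map_add, add_mul]
      | snoc a m => rw [op_smul_snoc, snocLift_snoc, snocLift_snoc, smul_comm, comp_op_smul]⟩
  | k + 1 => ⟨snocLift (fun a m => (G.coef (w (k + 1)) m).lTensor B.R ((word w k).1 a))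
      (fun a a' m => by rw [map_add, map_add])
      (fun a m m' => by rw [coef_add, LinearMap.lTensor_add, LinearMap.add_apply])
      (fun a s m => by rw [(word w k).2, lTensor_coef_mul]), fun s a => by
      induction a using snoc_induction with
      | zero => rw [smul_zero, map_zero, zero_mul]
      | add x y hx hy => rw [smul_add, map_add, hx, hy, map_add, add_mul]
      | snoc a m => rw [op_smul_snoc, snocLift_snoc, snocLift_snoc, lTensor_coef_op_smul]⟩

theorem word_zero_snoc (w : ℕ → G.A × G.Y) (r : Tens B 0) (m : B.M) :
    (G.word w 0).1 (snoc r m) = G.comp (w 0).2 (scal r • m) := by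
  rw [word, snocLift_snoc]

theorem word_succ_snoc (w : ℕ → G.A × G.Y) {k : ℕ} (a : Tens B (k + 1)) (m : B.M) :
    (G.word w (k + 1)).1 (snoc a m) = (G.coef (w (k + 1)) m).lTensor B.R ((G.word w k).1 a) := by
  rw [word, snocLift_snoc]

theorem lTensor_tmul_one_mul (f : B.R →ₗ[ℤ] B.R) (s : B.R) (x : B.R ⊗[ℤ] B.R) :
    f.lTensor B.R ((s ⊗ₜ 1) * x) = (s ⊗ₜ 1) * f.lTensor B.R x := by
  induction x with
  | zero => rw [mul_zero, map_zero, mul_zero]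
  | add x y hx hy => rw [mul_add, map_add, map_add, hx, hy, mul_add]
  | tmul l r =>
    rw [Algebra.TensorProduct.tmul_mul_tmul, one_mul, LinearMap.lTensor_tmul,
      LinearMap.lTensor_tmul, Algebra.TensorProduct.tmul_mul_tmul, one_mul]

theorem word_smul (w : ℕ → G.A × G.Y) : ∀ (k : ℕ) (s : B.R) (a : Tens B (k + 1)),
    (G.word w k).1 (s • a) = (s ⊗ₜ 1) * (G.word w k).1 a
  | 0, s, a => by
    induction a using snoc_induction with
    | zero => rw [smul_zero, map_zero, mul_zero]
    | add x y hx hy => rw [smul_add, map_add, hx, hy, map_add, mul_add]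
    | snoc a m =>
      rw [smul_snoc, word_zero_snoc, word_zero_snoc, ← comp_smul, ← mul_smul]; rfl
  | k + 1, s, a => by
    induction a using snoc_induction with
    | zero => rw [smul_zero, map_zero, mul_zero]
    | add x y hx hy => rw [smul_add, map_add, hx, hy, map_add, mul_add]
    | snoc a m =>
      rw [smul_snoc, word_succ_snoc, word_succ_snoc, word_smul w k, lTensor_tmul_one_mul]

/-- The map `l ⊗ r ↦ r l`. -/
def mulSwap (R : Type u) [Ring R] : R ⊗[ℤ] R →ₗ[ℤ] R :=
  TensorProduct.lift (LinearMap.mul ℤ R).flip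

theorem mulSwap_tmul {R : Type u} [Ring R] (l r : R) : mulSwap R (l ⊗ₜ r) = r * l := rfl

/-- Closing up l ⊗ r to r l identifies left multiplication on the first factor with right
multiplication on the last, so `cycCoord` descends to the cyclic quotient. -/
theorem mulSwap_comm {R : Type u} [Ring R] (s : R) (x : R ⊗[ℤ] R) :
    mulSwap R ((s ⊗ₜ 1) * x) = mulSwap R (x * (1 ⊗ₜ s)) := by
  induction x with
  | zero => rw [mul_zero, zero_mul]
  | add x y hx hy => rw [mul_add, add_mul, map_add, map_add, hx, hy]
  | tmul l r =>
    rw [Algebra.TensorProduct.tmul_mul_tmul, Algebra.TensorProduct.tmul_mul_tmul, mulSwap_tmul,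
      mulSwap_tmul, one_mul, mul_one, mul_assoc]

/-- The coordinate of index `(w 0, …, w k)` on the cyclic tensor power. -/
def cycCoord (w : ℕ → G.A × G.Y) (k : ℕ) : Cyc B (k + 1) →+ ℤ :=
  QuotientAddGroup.lift (commSub B (k + 1))
    (((G.α.coord (w 0).1).toAddMonoidHom.comp (mulSwap B.R).toAddMonoidHom).comp (G.word w k).1)
    (by
      intro x hx
      refine (AddSubgroup.closure_le (AddMonoidHom.ker _)).2 ?_ hx
      rintro _ ⟨s, a, rfl⟩
      rw [SetLike.mem_coe, AddMonoidHom.mem_ker, map_sub, sub_eq_zero]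
      change G.α.coord _ (mulSwap B.R _) = G.α.coord _ (mulSwap B.R _)
      rw [word_smul, (G.word w k).2, mulSwap_comm])

theorem cycCoord_mk (w : ℕ → G.A × G.Y) (k : ℕ) (a : Tens B (k + 1)) :
    G.cycCoord w k (cycMk a) = G.α.coord (w 0).1 (mulSwap B.R ((G.word w k).1 a)) := rfl

/-- The element `α_a b_y`. -/
def elt (e : G.A × G.Y) : B.M := G.α e.1 • G.b e.2

theorem elt_eq (e : G.A × G.Y) : G.elt e = G.e (Finsupp.single e.2 (G.α e.1 ⊗ₜ 1)) := by
  rw [e_single, op_one, one_smul]; rfl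

open Classical in
theorem coef_elt (e e' : G.A × G.Y) : G.coef e (G.elt e') 1 = if e' = e then 1 else 0 := by
  rw [coef, elt_eq, comp_e_single, if_congr Prod.ext_iff rfl rfl]
  by_cases h : e'.2 = e.2
  · rw [if_pos h, contract_tmul, one_mul, Module.Basis.coord_apply, Module.Basis.repr_self,
      Finsupp.single_apply]
    simp only [h, and_true]
    split_ifs
    · rw [one_smul]
    · rw [zero_smul]
  · rw [if_neg h, map_zero, if_neg (fun h' => h h'.2)]; rfl

open Classical in
-- Every index is compared except the ring index of the first letter: its element of R stays in the
-- left tensor factor until the word is closed up.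
theorem word_tprod (w w' : ℕ → G.A × G.Y) : ∀ k : ℕ,
    (G.word w k).1 (tprod (fun i => G.elt (w' i)) (k + 1)) =
      if (w' 0).2 = (w 0).2 ∧ ∀ i, i ≠ 0 → i < k + 1 → w' i = w i then G.α (w' 0).1 ⊗ₜ 1 else 0
  | 0 => by
    rw [tprod, word_zero_snoc, elt_eq]
    change G.comp _ ((1 : B.R) • _) = _
    rw [one_smul, comp_e_single]
    congr 1
    refine propext (iff_self_and.2 fun _ i hi hi' => absurd hi' (by omega))
  | k + 1 => by
    rw [tprod, word_succ_snoc, word_tprod w w' k]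
    have h : (∀ i, i ≠ 0 → i < k + 1 + 1 → w' i = w i) ↔
        (∀ i, i ≠ 0 → i < k + 1 → w' i = w i) ∧ w' (k + 1) = w (k + 1) := by
      refine ⟨fun h => ⟨fun i hi hi' => h i hi (by omega), h _ (by omega) (by omega)⟩,
        fun h i hi hi' => ?_⟩
      rcases eq_or_ne i (k + 1) with rfl | h'
      · exact h.2
      · exact h.1 i hi (by omega)
    rw [if_congr ((and_congr_right' h).trans and_assoc.symm) rfl rfl]
    by_cases h₁ : (w' 0).2 = (w 0).2 ∧ ∀ i, i ≠ 0 → i < k + 1 → w' i = w i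
    · rw [if_pos h₁, LinearMap.lTensor_tmul, coef_elt]
      by_cases h₂ : w' (k + 1) = w (k + 1)
      · rw [if_pos h₂, if_pos ⟨h₁, h₂⟩]
      · rw [if_neg h₂, if_neg fun h => h₂ h.2, tmul_zero]
    · rw [if_neg h₁, if_neg fun h => h₁ h.1, map_zero]

open Classical in
-- After closing up, the outer coordinate reads off the ring index of the first letter that `word`
-- left open. The functionals are thus dual to the words.
theorem cycCoord_tprod (w w' : ℕ → G.A × G.Y) (k : ℕ) :
    G.cycCoord w k (cycMk (tprod (fun i => G.elt (w' i)) (k + 1))) =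
      if ∀ i < k + 1, w' i = w i then 1 else 0 := by
  rw [cycCoord_mk, word_tprod]
  by_cases h : ∀ i < k + 1, w' i = w i
  · rw [if_pos h, if_pos ⟨congrArg Prod.snd (h 0 (by omega)), fun i _ hi => h i hi⟩, mulSwap_tmul,
      one_mul, h 0 (by omega), Module.Basis.coord_apply, Module.Basis.repr_self,
      Finsupp.single_eq_same]
  · rw [if_neg h]
    split_ifs with h₁
    · rw [mulSwap_tmul, one_mul, Module.Basis.coord_apply, Module.Basis.repr_self,
        Finsupp.single_apply, if_neg]
      intro h₂
      refine h fun i hi => ?_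
      rcases eq_or_ne i 0 with rfl | hi'
      · exact Prod.ext h₂ h₁.1
      · exact h₁.2 i hi' hi
    · rw [map_zero, map_zero]

/-! #### Generation -/

theorem elt_induction {P : B.M → Prop} (zero : P 0) (add : ∀ x y, P x → P y → P (x + y))
    (elt : ∀ (r : B.R) e, P (op r • G.elt e)) (m : B.M) : P m := by
  induction m using G.induction with
  | zero => exact zero
  | add x y hx hy => exact add x y hx hy
  | single y l r =>
    rw [e_single]
    induction l using basis_induction G.α generalizing r with
    | zero => rw [zero_smul]; exact zero
    | add x y hx hy => rw [add_smul]; exact add _ _ (hx r) (hy r)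
    | smul c x hx =>
      -- The predicate is only assumed closed under addition, so the integer is absorbed into r.
      have := hx (c • r)
      rwa [op_smul, smul_assoc c, smul_comm x c, ← smul_assoc c] at this
    | basis i => rw [smul_comm]; exact elt r (i, y)

/-- Ring elements are pushed to the right: the scalar trailing a word is absorbed by the next
factor, which is expanded again, so only one scalar at the far end remains. -/
theorem tens_induction {k : ℕ} {P : Tens B (k + 1) → Prop} (zero : P 0)
    (add : ∀ x y, P x → P y → P (x + y))
    (tprod : ∀ (r : B.R) (w : ℕ → G.A × G.Y),
      P (op r • tprod (fun i => G.elt (w i)) (k + 1))) (x : Tens B (k + 1)) : P x := by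
  induction k with
  | zero =>
    induction x using snoc_induction with
    | zero => exact zero
    | add x y hx hy => exact add x y hx hy
    | snoc a m =>
      have h : a = op (scal a) • tensOne B := (one_mul (scal a)).symm
      rw [h, snoc_op_smul]
      induction scal a • m using G.elt_induction with
      | zero =>
        have : snoc (tensOne B) (0 : B.M) = 0 := tm_zero_right _
        rw [this]; exact zero
      | add x y hx hy => rw [snoc_add_right]; exact add _ _ hx hy
      | elt r e => rw [← op_smul_snoc]; exact tprod r fun _ => e
  | succ k ih =>
    induction x using snoc_induction with
    | zero => exact zero
    | add x y hx hy => exact add x y hx hy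
    | snoc a m =>
      refine ih (P := fun a => ∀ m, P (snoc a m)) (fun m => ?_) (fun x y hx hy m => ?_)
        (fun r w m => ?_) a m
      · have : snoc (0 : Tens B (k + 1)) m = 0 := tm_zero_left m
        rw [this]; exact zero
      · rw [snoc_add_left]; exact add _ _ (hx m) (hy m)
      · rw [snoc_op_smul]
        induction r • m using G.elt_induction with
        | zero =>
          have : snoc (WittCoeff.tprod (fun i => G.elt (w i)) (k + 1)) (0 : B.M) = 0 :=
            tm_zero_right _
          rw [this]; exact zero
        | add x y hx hy => rw [snoc_add_right]; exact add _ _ hx hy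
        | elt r e =>
          have := tprod r fun i => if i < k + 1 then w i else e
          rw [WittCoeff.tprod, if_neg (lt_irrefl _),
            tprod_congr (m' := fun i => G.elt (w i)) fun i hi => by rw [if_pos hi],
            op_smul_snoc] at this
          exact this

/-- The index set of a basis of a cyclic tensor power. -/
abbrev Word (k : ℕ) : Type u := Fin (k + 1) → G.A × G.Y

/-- The elements of a basis of a cyclic tensor power. -/
def wordElt (k : ℕ) (w : G.Word k) : Cyc B (k + 1) :=
  cycMk (tprod (fun i => G.elt (w (Fin.ofNat (k + 1) i))) (k + 1))

theorem wordElt_restrict (k : ℕ) (w : ℕ → G.A × G.Y) :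
    G.wordElt k (fun i => w i) = cycMk (tprod (fun i => G.elt (w i)) (k + 1)) := by
  refine congrArg cycMk (tprod_congr fun i hi => ?_)
  change G.elt (w (i % (k + 1))) = _
  rw [Nat.mod_eq_of_lt hi]

/-- In the cyclic quotient the trailing scalar r moves around to the first letter α_a b_y, and r α_a
is expanded in the ℤ-basis of R. -/
theorem span_wordElt (k : ℕ) : ⊤ ≤ Submodule.span ℤ (Set.range (G.wordElt k)) := by
  rintro x -
  obtain ⟨a, rfl⟩ := cycMk_surjective _ x
  induction a using G.tens_induction with
  | zero => rw [map_zero]; exact zero_mem _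
  | add x y hx hy => rw [map_add]; exact add_mem hx hy
  | tprod r w =>
    have h : ∀ m : B.M, cons m (tprod (fun i => G.elt (w (i + 1))) k) =
        tprod (fun i => if i = 0 then m else G.elt (w i)) (k + 1) := fun m => by
      rw [cons_tprod]
      refine tprod_congr fun i _ => ?_
      split_ifs with hi
      · rfl
      · rw [Nat.sub_add_cancel (Nat.pos_of_ne_zero hi)]
    have h' : tprod (fun i => G.elt (w i)) (k + 1) =
        cons (G.elt (w 0)) (tprod (fun i => G.elt (w (i + 1))) k) := by
      rw [h]
      exact tprod_congr fun i _ => by split_ifs with hi <;> simp [hi]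
    rw [← cycMk_smul, h', ← smul_cons, elt, ← mul_smul]
    induction r * G.α (w 0).1 using basis_induction G.α with
    | zero =>
      rw [zero_smul]
      have : cons (0 : B.M) (tprod (fun i => G.elt (w (i + 1))) k) = 0 := by
        have := add_cons (0 : B.M) 0 (tprod (fun i => G.elt (w (i + 1))) k)
        simpa using this
      rw [this, map_zero]; exact zero_mem _
    | add x y hx hy => rw [add_smul, add_cons, map_add]; exact add_mem hx hy
    | smul c x hx =>
      have : ∀ m : B.M, cycMk (cons (c • m) (tprod (fun i => G.elt (w (i + 1))) k)) =
          c • cycMk (cons m (tprod (fun i => G.elt (w (i + 1))) k)) := fun m =>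
        map_zsmul (AddMonoidHom.mk'
          (fun m => cycMk (cons m (tprod (fun i => G.elt (w (i + 1))) k)))
          (fun m m' => by rw [add_cons, map_add])) c m
      rw [smul_assoc, this]
      exact Submodule.smul_mem _ c hx
    | basis a =>
      refine Submodule.subset_span ⟨fun i => if (i : ℕ) = 0 then (a, (w 0).2) else w i, ?_⟩
      rw [G.wordElt_restrict k fun i => if i = 0 then (a, (w 0).2) else w i, h]
      refine congrArg cycMk (tprod_congr fun i _ => ?_)
      split_ifs <;> rfl

open Classical in
theorem cycCoord_wordElt (k : ℕ) (w w' : G.Word k) :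
    G.cycCoord (fun i => w (Fin.ofNat (k + 1) i)) k (G.wordElt k w') =
      if w' = w then 1 else 0 := by
  rw [wordElt, cycCoord_tprod]
  congr 1
  refine propext ⟨fun h => funext fun i => ?_, fun h i _ => h ▸ rfl⟩
  have := h i i.2
  rwa [Fin.ofNat_eq_cast, Fin.cast_val_eq_self] at this

theorem linearIndependent_wordElt (k : ℕ) : LinearIndependent ℤ (G.wordElt k) := by
  classical
  rw [linearIndependent_iff']
  intro s g hg w hw
  have := congrArg (G.cycCoord (fun i => w (Fin.ofNat (k + 1) i)) k) hg
  rw [map_sum, map_zero, Finset.sum_eq_single w] at this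
  · rwa [map_zsmul, cycCoord_wordElt, if_pos rfl, smul_eq_mul, mul_one] at this
  · intro w' _ h
    rw [map_zsmul, cycCoord_wordElt, if_neg h, smul_zero]
  · exact fun h => absurd hw h

/-- The words are a ℤ-basis, by generation and the dual functionals, and rotation permutes their
letters; so this is a permutation module. -/
theorem normExact (G : BimodBasis B) : NormExact B := by
  intro k hk x hx
  obtain ⟨k, rfl⟩ := Nat.exists_eq_succ_of_ne_zero hk
  let b := Module.Basis.mk (G.linearIndependent_wordElt k) (G.span_wordElt k)
  refine exists_eq_sub_of_sum_iterate_eq_zero b (rot B (k + 1))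
    (fun w i => w (Fin.ofNat (k + 1) (if (i : ℕ) = 0 then k else i - 1))) (fun w => ?_) hk hx
  rw [Module.Basis.mk_apply, Module.Basis.mk_apply, wordElt, rot_tprod _ hk,
    G.wordElt_restrict k fun i => w (Fin.ofNat (k + 1) (if i = 0 then k else i - 1))]
  congr 2
  ext i
  split_ifs <;> rfl

end BimodBasis

end

section

variable {B C D : BimodPair.{u}}

/-! ### Bases of free pairs, of tensor products and of the unit -/

/-- The monomials are a ℤ-basis of a free ring. A basis over R ⊗ Rᵐᵒᵖ becomes a bimodule basis once
the second factor is identified with R. -/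
theorem nonempty_bimodBasis_of_isFree (hB : B.IsFree) : Nonempty (BimodBasis B) := by
  obtain ⟨⟨X, ⟨φ⟩⟩, hM⟩ := hB
  let : Module (B.R ⊗[ℤ] B.Rᵐᵒᵖ) B.M := TensorProduct.Algebra.module
  have : Module.Free ℤ B.R := Module.Free.of_basis
    ((FreeAlgebra.basisFreeMonoid ℤ X).map { φ.toAddEquiv with
      map_smul' := fun c x => by
        refine (congrArg φ (Algebra.smul_def c x)).trans ?_
        rw [map_mul, eq_intCast, map_intCast]
        exact (zsmul_eq_mul _ _).symm })
  let b := Module.Free.chooseBasis (B.R ⊗[ℤ] B.Rᵐᵒᵖ) B.M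
  refine ⟨⟨_, _, Module.Free.chooseBasis ℤ B.R, b, (Finsupp.mapRange.addEquiv
    (TensorProduct.congr (LinearEquiv.refl ℤ B.R)
      (MulOpposite.opLinearEquiv ℤ : B.R ≃ₗ[ℤ] B.Rᵐᵒᵖ)).toAddEquiv).trans
    b.repr.symm.toAddEquiv, fun y l r => ?_⟩⟩
  refine Eq.trans (b := b.repr.symm (Finsupp.single y (l ⊗ₜ op r)))
    (congrArg b.repr.symm (Finsupp.mapRange_single (hf := (TensorProduct.congr _ _).map_zero))) ?_
  refine (b.repr_symm_single y _).trans ?_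
  exact TensorProduct.Algebra.smul_def l (op r) (b y)

theorem sum_smul_mtmul_ext {X : Type*} [AddCommGroup X]
    {φ ψ : (B.tensor C).R ⊗[ℤ] (B.tensor C).R →+ X}
    (h : ∀ l l' r r', φ (rtmul l l' ⊗ₜ rtmul r r') = ψ (rtmul l l' ⊗ₜ rtmul r r')) : φ = ψ := by
  ext x
  induction x with
  | zero => rw [map_zero, map_zero]
  | add x y hx hy => rw [map_add, map_add, hx, hy]
  | tmul l r =>
    induction l using rtmul_induction with
    | zero => rw [zero_tmul, map_zero, map_zero]
    | add x y hx hy => rw [add_tmul, map_add, map_add, hx, hy]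
    | tmul l l' =>
      induction r using rtmul_induction with
      | zero => rw [tmul_zero, map_zero, map_zero]
      | add x y hx hy => rw [tmul_add, map_add, map_add, hx, hy]
      | tmul r r' => exact h l l' r r'

/-- The equivalence underlying the basis of a tensor product. -/
def BimodBasis.tensorEquiv (G : BimodBasis B) (H : BimodBasis C) :
    (G.Y × H.Y →₀ (B.tensor C).R ⊗[ℤ] (B.tensor C).R) ≃+ (B.tensor C).M :=
  ((Finsupp.mapRange.linearEquiv
      (TensorProduct.tensorTensorTensorComm ℤ B.R C.R B.R C.R)).trans
    ((finsuppTensorFinsupp ℤ ℤ (B.R ⊗[ℤ] B.R) (C.R ⊗[ℤ] C.R) G.Y H.Y).symm.trans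
      (TensorProduct.congr G.e.toIntLinearEquiv H.e.toIntLinearEquiv))).toAddEquiv

/-- The basis of a tensor product. -/
def BimodBasis.tensor (G : BimodBasis B) (H : BimodBasis C) : BimodBasis (B.tensor C) where
  A := G.A × H.A
  Y := G.Y × H.Y
  α := G.α.tensorProduct H.α
  b y := mtmul (G.b y.1) (H.b y.2)
  e := G.tensorEquiv H
  e_single y l r := by
    -- Both sides are additive in l ⊗ r, so it is enough to take l and r elementary, where the
    -- middle two factors are interchanged explicitly.
    have h := sum_smul_mtmul_ext (B := B) (C := C)
      (φ := (G.tensorEquiv H).toAddMonoidHom.comp (Finsupp.singleAddHom y))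
      (ψ := (TensorProduct.lift (LinearMap.mk₂ ℤ
        (fun l r : (B.tensor C).R => l • op r • mtmul (G.b y.1) (H.b y.2))
        (fun l l' r => add_smul _ _ _) (fun c l r => smul_assoc _ _ _)
        (fun l r r' => by rw [MulOpposite.op_add, add_smul, smul_add])
        (fun c l r => by rw [MulOpposite.op_smul, smul_assoc, smul_comm]))).toAddMonoidHom) ?_
    · exact DFunLike.congr_fun h (l ⊗ₜ r)
    · intro l l' r r'
      change TensorProduct.congr G.e.toIntLinearEquiv H.e.toIntLinearEquiv
        ((finsuppTensorFinsupp ℤ ℤ (B.R ⊗[ℤ] B.R) (C.R ⊗[ℤ] C.R) G.Y H.Y).symm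
          (Finsupp.mapRange.linearEquiv (TensorProduct.tensorTensorTensorComm ℤ B.R C.R B.R C.R)
            (Finsupp.single y ((l ⊗ₜ l') ⊗ₜ (r ⊗ₜ r'))))) =
        rtmul l l' • op (rtmul r r') • mtmul (G.b y.1) (H.b y.2)
      rw [Finsupp.mapRange.linearEquiv_apply, Finsupp.mapRange_single, op_rtmul_smul,
        rtmul_smul, ← G.e_single, ← H.e_single]
      change TensorProduct.congr G.e.toIntLinearEquiv H.e.toIntLinearEquiv
        ((finsuppTensorFinsupp ℤ ℤ (B.R ⊗[ℤ] B.R) (C.R ⊗[ℤ] C.R) G.Y H.Y).symm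
          (Finsupp.single (y.1, y.2) ((l ⊗ₜ r) ⊗ₜ (l' ⊗ₜ r')))) = _
      rw [finsuppTensorFinsupp_symm_single]
      rfl

/-- The equivalence underlying the basis of the unit. -/
def unitEquiv : (PUnit.{u + 1} →₀ ULift.{u} ℤ ⊗[ℤ] ULift.{u} ℤ) ≃+ ULift.{u} ℤ :=
  (Finsupp.uniqueAddEquiv (M := ULift.{u} ℤ ⊗[ℤ] ULift.{u} ℤ) PUnit.unit.{u + 1}).trans
    ((TensorProduct.congr ULift.moduleEquiv (LinearEquiv.refl ℤ (ULift.{u} ℤ))).trans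
      (TensorProduct.lid ℤ (ULift.{u} ℤ))).toAddEquiv

theorem unitEquiv_single (y : PUnit.{u + 1}) (l r : ULift.{u} ℤ) :
    unitEquiv (Finsupp.single y (l ⊗ₜ r)) = l * r := by
  change TensorProduct.lid ℤ (ULift.{u} ℤ) (TensorProduct.congr ULift.moduleEquiv
    (LinearEquiv.refl ℤ (ULift.{u} ℤ)) (Finsupp.single y (l ⊗ₜ[ℤ] r) PUnit.unit)) = l * r
  rw [Finsupp.single_eq_same]
  exact ULift.ext _ _ rfl

/-- The basis of the unit. -/
def unitBasis : BimodBasis unitPair.{u} where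
  A := _
  Y := PUnit
  α := Module.Free.chooseBasis ℤ (ULift.{u} ℤ)
  b _ := (1 : ULift.{u} ℤ)
  e := unitEquiv
  e_single y l r := (unitEquiv_single y l r).trans
    (congrArg (HMul.hMul (show ULift.{u} ℤ from l)) (one_mul (show ULift.{u} ℤ from r)).symm)

end

/-! ### Existence of free resolutions -/

section

variable {B C D : BimodPair.{u}}

/-! ### Free pairs -/

section BimodOf

variable (R E : Type u) [Ring R] [AddCommGroup E] [Module (R ⊗[ℤ] Rᵐᵒᵖ) E]

/-- A module over `R ⊗ Rᵐᵒᵖ`, seen as a bimodule over `R`. -/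
def bimodOf : BimodPair.{u} :=
  letI : Module R E :=
    Module.compHom E (Algebra.TensorProduct.includeLeftRingHom : R →+* R ⊗[ℤ] Rᵐᵒᵖ)
  letI : Module Rᵐᵒᵖ E :=
    Module.compHom E (Algebra.TensorProduct.includeRight : Rᵐᵒᵖ →ₐ[ℤ] R ⊗[ℤ] Rᵐᵒᵖ).toRingHom
  { R := R
    M := E
    smulComm := ⟨fun r s m => by
      change (r ⊗ₜ[ℤ] (1 : Rᵐᵒᵖ) : R ⊗[ℤ] Rᵐᵒᵖ) • ((1 : R) ⊗ₜ[ℤ] s : R ⊗[ℤ] Rᵐᵒᵖ) • m =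
        ((1 : R) ⊗ₜ[ℤ] s : R ⊗[ℤ] Rᵐᵒᵖ) • (r ⊗ₜ[ℤ] (1 : Rᵐᵒᵖ) : R ⊗[ℤ] Rᵐᵒᵖ) • m
      rw [← mul_smul, ← mul_smul, Algebra.TensorProduct.tmul_mul_tmul,
        Algebra.TensorProduct.tmul_mul_tmul, one_mul, one_mul, mul_one, mul_one]⟩ }

variable {R E}

theorem tmul_smul_bimodOf (l : R) (r : Rᵐᵒᵖ) (m : E) :
    (l ⊗ₜ[ℤ] r : R ⊗[ℤ] Rᵐᵒᵖ) • m =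
      @HSMul.hSMul (bimodOf R E).R (bimodOf R E).M _ _ l
        (@HSMul.hSMul (bimodOf R E).Rᵐᵒᵖ (bimodOf R E).M _ _ r m) := by
  refine Eq.trans (b := (l ⊗ₜ[ℤ] (1 : Rᵐᵒᵖ) : R ⊗[ℤ] Rᵐᵒᵖ) •
    ((1 : R) ⊗ₜ[ℤ] r : R ⊗[ℤ] Rᵐᵒᵖ) • m) ?_ rfl
  rw [← mul_smul, Algebra.TensorProduct.tmul_mul_tmul, one_mul, mul_one]

/-- The action of R ⊗ Rᵐᵒᵖ rebuilt from the two one-sided actions equals the original one, and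
freeness is transported along this equality of module structures. -/
theorem free_bimodOf [hE : Module.Free (R ⊗[ℤ] Rᵐᵒᵖ) E] :
    letI : Module ((bimodOf R E).R ⊗[ℤ] (bimodOf R E).Rᵐᵒᵖ) (bimodOf R E).M :=
      TensorProduct.Algebra.module
    Module.Free ((bimodOf R E).R ⊗[ℤ] (bimodOf R E).Rᵐᵒᵖ) (bimodOf R E).M := by
  let inst' : Module ((bimodOf R E).R ⊗[ℤ] (bimodOf R E).Rᵐᵒᵖ) (bimodOf R E).M :=
    TensorProduct.Algebra.module
  have h : ∀ (x : R ⊗[ℤ] Rᵐᵒᵖ) (m : E), x • m =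
      @HSMul.hSMul ((bimodOf R E).R ⊗[ℤ] (bimodOf R E).Rᵐᵒᵖ) (bimodOf R E).M _ _ x m := by
    intro x m
    induction x with
    | zero =>
      exact (zero_smul (R ⊗[ℤ] Rᵐᵒᵖ) m).trans
        (zero_smul ((bimodOf R E).R ⊗[ℤ] (bimodOf R E).Rᵐᵒᵖ) (show (bimodOf R E).M from m)).symm
    | add x y hx hy =>
      exact (add_smul x y m).trans ((congrArg₂ _ hx hy).trans
        (add_smul (R := (bimodOf R E).R ⊗[ℤ] (bimodOf R E).Rᵐᵒᵖ) x y
          (show (bimodOf R E).M from m)).symm)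
    | tmul l r =>
      exact (tmul_smul_bimodOf l r m).trans (TensorProduct.Algebra.smul_def
        (A := (bimodOf R E).R) (B := (bimodOf R E).Rᵐᵒᵖ) l r (show (bimodOf R E).M from m)).symm
  have e : inst' = (inferInstance : Module (R ⊗[ℤ] Rᵐᵒᵖ) E) :=
    Module.ext' _ _ fun x m => (h x m).symm
  change @Module.Free (R ⊗[ℤ] Rᵐᵒᵖ) E _ _ inst'
  rw [e]
  exact hE

end BimodOf

/-- The free bimodule on a set `Y` over a ring. -/
def freeBimod (R : Type u) [Ring R] (Y : Type u) : BimodPair.{u} :=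
  bimodOf R (Y →₀ R ⊗[ℤ] Rᵐᵒᵖ)

section FreeBimod

variable {R : Type u} [Ring R] {Y : Type u}

/-- The bimodule generators. -/
def bimodGen (R : Type u) [Ring R] {Y : Type u} (y : Y) : (freeBimod R Y).M :=
  (Finsupp.single y 1 : Y →₀ R ⊗[ℤ] Rᵐᵒᵖ)

theorem smul_smul_bimodGen (l r : (freeBimod R Y).R) (y : Y) :
    l • op r • bimodGen R y =
      (Finsupp.single y ((l : R) ⊗ₜ[ℤ] (op r : Rᵐᵒᵖ)) : Y →₀ R ⊗[ℤ] Rᵐᵒᵖ) := by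
  refine (tmul_smul_bimodOf (R := R) (E := Y →₀ R ⊗[ℤ] Rᵐᵒᵖ) l (op r)
    (Finsupp.single y 1)).symm.trans ?_
  exact (Finsupp.smul_single _ _ _).trans (congrArg _ (mul_one _))

theorem freeBimod_induction {P : (freeBimod R Y).M → Prop} (zero : P 0)
    (add : ∀ x y, P x → P y → P (x + y)) (gen : ∀ (l r : (freeBimod R Y).R) y,
      P (l • op r • bimodGen R y)) (m : (freeBimod R Y).M) : P m := by
  refine Finsupp.induction_linear (motive := P) (show Y →₀ R ⊗[ℤ] Rᵐᵒᵖ from m) zero add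
    fun y x => ?_
  induction x with
  | zero => rw [Finsupp.single_zero]; exact zero
  | add x y hx hy => rw [Finsupp.single_add]; exact add _ _ hx hy
  | tmul l r =>
    exact (smul_smul_bimodGen (R := R) l r.unop y) ▸ gen l r.unop y

/-- The additive map underlying a morphism out of a free bimodule. -/
def freeBimodLiftAdd (α : R →+* C.R) (ψ : Y → C.M) : (Y →₀ R ⊗[ℤ] Rᵐᵒᵖ) →+ C.M :=
  Finsupp.liftAddHom fun y => (TensorProduct.lift
    (LinearMap.mk₂ ℤ (fun (l : R) (r : Rᵐᵒᵖ) => α l • op (α r.unop) • ψ y)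
      (fun l l' r => by rw [map_add, add_smul])
      (fun c l r => by rw [map_zsmul, smul_assoc])
      (fun l r r' => by
        rw [MulOpposite.unop_add, map_add, MulOpposite.op_add, add_smul, smul_add])
      (fun c l r => by
        rw [MulOpposite.unop_smul, map_zsmul, MulOpposite.op_smul, smul_assoc,
          smul_comm]))).toAddMonoidHom

theorem freeBimodLiftAdd_gen (α : R →+* C.R) (ψ : Y → C.M) (l r : (freeBimod R Y).R) (y : Y) :
    freeBimodLiftAdd α ψ (l • op r • bimodGen R y) =
      α (show R from l) • op (α (show R from r)) • ψ y := by
  rw [smul_smul_bimodGen]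
  exact Finsupp.liftAddHom_apply_single _ _ _

/-- The morphism out of a free bimodule that is given on the ring and on the generators. -/
def freeBimodLift (α : R →+* C.R) (ψ : Y → C.M) : freeBimod R Y ⟶ C where
  ringHom := α
  addHom := freeBimodLiftAdd α ψ
  map_smul := fun s m => by
    induction m using freeBimod_induction with
    | zero =>
      rw [smul_zero]
      exact (map_zero _).trans ((congrArg _ (map_zero _)).trans (smul_zero _)).symm
    | add x y hx hy =>
      rw [smul_add]
      exact (map_add _ _ _).trans ((congrArg₂ _ hx hy).trans
        ((smul_add _ _ _).symm.trans (congrArg _ (map_add _ _ _).symm)))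
    | gen l r y =>
      rw [← mul_smul]
      refine (freeBimodLiftAdd_gen α ψ _ r y).trans ?_
      refine Eq.trans ?_ (congrArg _ (freeBimodLiftAdd_gen α ψ l r y)).symm
      rw [← mul_smul]
      exact congrArg (· • _) (map_mul α s l)
  map_op_smul := fun s m => by
    induction m using freeBimod_induction with
    | zero =>
      rw [smul_zero]
      exact (map_zero _).trans ((congrArg _ (map_zero _)).trans (smul_zero _)).symm
    | add x y hx hy =>
      rw [smul_add]
      exact (map_add _ _ _).trans ((congrArg₂ _ hx hy).trans
        ((smul_add _ _ _).symm.trans (congrArg _ (map_add _ _ _).symm)))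
    | gen l r y =>
      rw [← smul_comm l (op s), ← mul_smul, ← MulOpposite.op_mul]
      refine (freeBimodLiftAdd_gen α ψ l _ y).trans ?_
      refine Eq.trans ?_ (congrArg _ (freeBimodLiftAdd_gen α ψ l r y)).symm
      refine Eq.trans ?_ (smul_comm (α l) (op (α s)) _)
      refine congrArg (fun x => α l • x) ?_
      refine Eq.trans ?_ (mul_smul (op (α s)) (op (α r)) (ψ y))
      exact congrArg (fun x => op x • ψ y) (map_mul α r s)

theorem freeBimodLift_gen (α : R →+* C.R) (ψ : Y → C.M) (y : Y) :
    (freeBimodLift α ψ).addHom (bimodGen R y) = ψ y := by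
  have h := freeBimodLiftAdd_gen α ψ 1 1 y
  rw [MulOpposite.op_one, one_smul, one_smul] at h
  refine h.trans ?_
  refine (congrArg₂ (fun a b => a • op b • ψ y) (map_one α) (map_one α)).trans ?_
  rw [MulOpposite.op_one, one_smul, one_smul]

theorem freeBimod_hom_ext {f g : freeBimod R Y ⟶ C} (h : f.ringHom = g.ringHom)
    (h' : ∀ y, f.addHom (bimodGen R y) = g.addHom (bimodGen R y)) : f = g := by
  refine BimodPair.Hom.ext h (AddMonoidHom.ext fun m => ?_)
  induction m using freeBimod_induction with
  | zero => rw [map_zero, map_zero]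
  | add x y hx hy => rw [map_add, map_add, hx, hy]
  | gen l r y => rw [f.map_smul, f.map_op_smul, g.map_smul, g.map_op_smul, h', h]

end FreeBimod

/-- The free pair on a set `X` of ring generators and a set `Y` of bimodule generators. -/
abbrev freePair (X Y : Type u) : BimodPair.{u} := freeBimod (FreeAlgebra ℤ X) Y

section FreePair

variable {X Y : Type u}

/-- The ring generators. -/
def ringGen (x : X) : (freePair X Y).R := FreeAlgebra.ι ℤ x

/-- The bimodule generators. -/
def modGen (y : Y) : (freePair X Y).M := bimodGen _ y

theorem isFree_freePair (X Y : Type u) : (freePair X Y).IsFree :=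
  ⟨⟨X, ⟨RingEquiv.refl (FreeAlgebra ℤ X)⟩⟩, free_bimodOf⟩

/-- The morphism out of a free pair with given values on the generators. -/
def freeLift (φ : X → C.R) (ψ : Y → C.M) : freePair X Y ⟶ C :=
  freeBimodLift (FreeAlgebra.lift ℤ φ).toRingHom ψ

theorem freeLift_ringGen (φ : X → C.R) (ψ : Y → C.M) (x : X) :
    (freeLift φ ψ).ringHom (ringGen x) = φ x := FreeAlgebra.lift_ι_apply φ x

theorem freeLift_modGen (φ : X → C.R) (ψ : Y → C.M) (y : Y) :
    (freeLift φ ψ).addHom (modGen y) = ψ y := freeBimodLift_gen _ ψ y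

theorem freePair_hom_ext {f g : freePair X Y ⟶ C}
    (h : ∀ x, f.ringHom (ringGen x) = g.ringHom (ringGen x))
    (h' : ∀ y, f.addHom (modGen y) = g.addHom (modGen y)) : f = g := by
  refine freeBimod_hom_ext (RingHom.ext fun x => ?_) h'
  have : (show FreeAlgebra ℤ X →+* C.R from f.ringHom).toIntAlgHom =
      (show FreeAlgebra ℤ X →+* C.R from g.ringHom).toIntAlgHom :=
    FreeAlgebra.hom_ext (funext h)
  exact DFunLike.congr_fun this x

end FreePair

theorem comp_ringHom_apply (f : B ⟶ C) (g : C ⟶ D) (r : B.R) :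
    (f ≫ g).ringHom r = g.ringHom (f.ringHom r) := rfl

theorem comp_addHom_apply (f : B ⟶ C) (g : C ⟶ D) (m : B.M) :
    (f ≫ g).addHom m = g.addHom (f.addHom m) := rfl

/-- The free pair on the elements of a pair. -/
abbrev freeCover (B : BimodPair.{u}) : BimodPair.{u} := freePair B.R B.M

/-- The canonical projection from the free cover. -/
def counit (B : BimodPair.{u}) : freeCover B ⟶ B := freeLift (fun r => r) (fun m => m)

theorem counit_ringGen (r : B.R) : (counit B).ringHom (ringGen r) = r := freeLift_ringGen _ _ r

theorem counit_modGen (m : B.M) : (counit B).addHom (modGen m) = m := freeLift_modGen _ _ m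

/-- The functoriality of the free cover. -/
def freeMap (f : B ⟶ C) : freeCover B ⟶ freeCover C :=
  freeLift (C := freePair C.R C.M) (fun r => ringGen (f.ringHom r)) (fun m => modGen (f.addHom m))

theorem freeMap_ringGen (f : B ⟶ C) (r : B.R) :
    (freeMap f).ringHom (ringGen r) = (ringGen (f.ringHom r) : (freePair C.R C.M).R) :=
  freeLift_ringGen _ _ r

theorem freeMap_modGen (f : B ⟶ C) (m : B.M) :
    (freeMap f).addHom (modGen m) = (modGen (f.addHom m) : (freePair C.R C.M).M) :=
  freeLift_modGen _ _ m

theorem freeMap_counit (f : B ⟶ C) : freeMap f ≫ counit C = counit B ≫ f :=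
  freePair_hom_ext
    (fun x => by
      rw [comp_ringHom_apply, comp_ringHom_apply, freeMap_ringGen, counit_ringGen]
      exact congrArg f.ringHom (counit_ringGen x).symm)
    (fun y => by
      rw [comp_addHom_apply, comp_addHom_apply, freeMap_modGen, counit_modGen]
      exact congrArg f.addHom (counit_modGen y).symm)

/-- The fork condition on the generator indexed by r says that h cannot distinguish r from the
generator named after its value in B. Therefore h, restricted to generators, respects the operations
of B. -/
theorem ringHom_eq_of_fork {h : freeCover B ⟶ C}
    (hh : counit (freeCover B) ≫ h = freeMap (counit B) ≫ h) (r : (freeCover B).R) :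
    h.ringHom (ringGen ((counit B).ringHom r) : (freePair B.R B.M).R) = h.ringHom r := by
  have := congrArg (fun f => BimodPair.Hom.ringHom f
    (ringGen r : (freePair (freeCover B).R (freeCover B).M).R)) hh
  rw [comp_ringHom_apply, comp_ringHom_apply, counit_ringGen, freeMap_ringGen] at this
  exact this.symm

theorem addHom_eq_of_fork {h : freeCover B ⟶ C}
    (hh : counit (freeCover B) ≫ h = freeMap (counit B) ≫ h) (m : (freeCover B).M) :
    h.addHom (modGen ((counit B).addHom m) : (freePair B.R B.M).M) = h.addHom m := by
  have := congrArg (fun f => BimodPair.Hom.addHom f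
    (modGen m : (freePair (freeCover B).R (freeCover B).M).M)) hh
  rw [comp_addHom_apply, comp_addHom_apply, counit_modGen, freeMap_modGen] at this
  exact this.symm

/-- The morphism out of `B` induced by a morphism out of its free cover. -/
def barDesc (h : freeCover B ⟶ C) (hh : counit (freeCover B) ≫ h = freeMap (counit B) ≫ h) :
    B ⟶ C where
  ringHom :=
    { toFun := fun r => h.ringHom (ringGen r : (freePair B.R B.M).R)
      map_one' := by
        -- The generator named after 1 is not the unit of the free ring; writing 1 as the value of
        -- the unit under the counit lets h see the latter.
        rw [← map_one (counit B).ringHom, ringHom_eq_of_fork hh, map_one]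
      map_zero' := by
        rw [← map_zero (counit B).ringHom, ringHom_eq_of_fork hh, map_zero]
      map_mul' := fun r s => by
        obtain ⟨r, rfl⟩ : ∃ r', (counit B).ringHom r' = r := ⟨_, counit_ringGen r⟩
        obtain ⟨s, rfl⟩ : ∃ s', (counit B).ringHom s' = s := ⟨_, counit_ringGen s⟩
        rw [← map_mul, ringHom_eq_of_fork hh, ringHom_eq_of_fork hh, ringHom_eq_of_fork hh,
          map_mul]
      map_add' := fun r s => by
        obtain ⟨r, rfl⟩ : ∃ r', (counit B).ringHom r' = r := ⟨_, counit_ringGen r⟩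
        obtain ⟨s, rfl⟩ : ∃ s', (counit B).ringHom s' = s := ⟨_, counit_ringGen s⟩
        rw [← map_add, ringHom_eq_of_fork hh, ringHom_eq_of_fork hh, ringHom_eq_of_fork hh,
          map_add] }
  addHom := AddMonoidHom.mk' (fun m => h.addHom (modGen m : (freePair B.R B.M).M))
    (fun m m' => by
      obtain ⟨m, rfl⟩ : ∃ r', (counit B).addHom r' = m := ⟨_, counit_modGen m⟩
      obtain ⟨m', rfl⟩ : ∃ r', (counit B).addHom r' = m' := ⟨_, counit_modGen m'⟩
      rw [← map_add, addHom_eq_of_fork hh, addHom_eq_of_fork hh, addHom_eq_of_fork hh, map_add])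
  map_smul r m := by
    obtain ⟨r, rfl⟩ : ∃ r', (counit B).ringHom r' = r := ⟨_, counit_ringGen r⟩
    obtain ⟨m, rfl⟩ : ∃ r', (counit B).addHom r' = m := ⟨_, counit_modGen m⟩
    change h.addHom (modGen _ : (freePair B.R B.M).M) =
      h.ringHom (ringGen _ : (freePair B.R B.M).R) • h.addHom (modGen _ : (freePair B.R B.M).M)
    rw [← (counit B).map_smul, addHom_eq_of_fork hh, addHom_eq_of_fork hh, ringHom_eq_of_fork hh,
      h.map_smul]
  map_op_smul r m := by
    obtain ⟨r, rfl⟩ : ∃ r', (counit B).ringHom r' = r := ⟨_, counit_ringGen r⟩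
    obtain ⟨m, rfl⟩ : ∃ r', (counit B).addHom r' = m := ⟨_, counit_modGen m⟩
    change h.addHom (modGen _ : (freePair B.R B.M).M) =
      op (h.ringHom (ringGen _ : (freePair B.R B.M).R)) •
        h.addHom (modGen _ : (freePair B.R B.M).M)
    rw [← (counit B).map_op_smul, addHom_eq_of_fork hh, addHom_eq_of_fork hh,
      ringHom_eq_of_fork hh, h.map_op_smul]

/-- The bar resolution. -/
def barResolution (B : BimodPair.{u}) : FreeResolution B where
  S₁ := freeCover (freeCover B)
  S₀ := freeCover B
  free₁ := isFree_freePair _ _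
  free₀ := isFree_freePair _ _
  -- Of the two layers of generators, `f` evaluates the outer one and `g` the inner one; `s` sends
  -- each generator to the generator named after it.
  f := counit (freeCover B)
  g := freeMap (counit B)
  s := freeLift (C := freeCover (freeCover B))
    (fun r => (ringGen (ringGen r : (freePair B.R B.M).R) :
      (freePair (freeCover B).R (freeCover B).M).R))
    (fun m => (modGen (modGen m : (freePair B.R B.M).M) :
      (freePair (freeCover B).R (freeCover B).M).M))
  ε := counit B
  s_f := freePair_hom_ext
    (fun x => by rw [comp_ringHom_apply, freeLift_ringGen, counit_ringGen]; rfl)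
    (fun x => by rw [comp_addHom_apply, freeLift_modGen, counit_modGen]; rfl)
  s_g := freePair_hom_ext
    (fun x => by
      rw [comp_ringHom_apply, freeLift_ringGen, freeMap_ringGen, counit_ringGen]; rfl)
    (fun x => by rw [comp_addHom_apply, freeLift_modGen, freeMap_modGen, counit_modGen]; rfl)
  w := (freeMap_counit (counit B)).symm
  isCoequalizer := ⟨Limits.Cofork.IsColimit.mk _
    (fun s => barDesc s.π s.condition)
    (fun s => BimodPair.Hom.ext
      (RingHom.ext fun r => ringHom_eq_of_fork s.condition r)
      (AddMonoidHom.ext fun m => addHom_eq_of_fork s.condition m))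
    (fun s m hm => by
      refine BimodPair.Hom.ext (RingHom.ext fun r => ?_) (AddMonoidHom.ext fun x => ?_)
      · have := congrArg (fun f => BimodPair.Hom.ringHom f (ringGen r : (freePair B.R B.M).R)) hm
        refine Eq.trans ?_ this
        exact congrArg m.ringHom (counit_ringGen r).symm
      · have := congrArg (fun f => BimodPair.Hom.addHom f (modGen x : (freePair B.R B.M).M)) hm
        refine Eq.trans ?_ this
        exact congrArg m.addHom (counit_modGen x).symm)⟩

end

/-! ### Witt vectors and reflexive coequalisers -/

section

variable {B C D : BimodPair.{u}}

/-! ### Kernels of reflexive coequalisers -/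

namespace FreeResolution

variable (P : FreeResolution B)

theorem s_f_ringHom (r : P.S₀.R) : P.f.ringHom (P.s.ringHom r) = r :=
  congrArg (fun h : P.S₀ ⟶ P.S₀ => BimodPair.Hom.ringHom h r) P.s_f

theorem s_g_ringHom (r : P.S₀.R) : P.g.ringHom (P.s.ringHom r) = r :=
  congrArg (fun h : P.S₀ ⟶ P.S₀ => BimodPair.Hom.ringHom h r) P.s_g

theorem s_f_addHom (m : P.S₀.M) : P.f.addHom (P.s.addHom m) = m :=
  congrArg (fun h : P.S₀ ⟶ P.S₀ => BimodPair.Hom.addHom h m) P.s_f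

theorem s_g_addHom (m : P.S₀.M) : P.g.addHom (P.s.addHom m) = m :=
  congrArg (fun h : P.S₀ ⟶ P.S₀ => BimodPair.Hom.addHom h m) P.s_g

/-- The ring congruence generated by the two maps of a free resolution. -/
def ringCon : RingCon P.S₀.R where
  r a b := ∃ r, P.f.ringHom r = a ∧ P.g.ringHom r = b
  iseqv :=
    { refl := fun a => ⟨P.s.ringHom a, P.s_f_ringHom a, P.s_g_ringHom a⟩
      -- A reflexive relation that is a subgroup of the product is symmetric and transitive; the
      -- correcting terms come from the common section `s`.
      symm := by
        rintro _ _ ⟨r, rfl, rfl⟩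
        refine ⟨P.s.ringHom (P.f.ringHom r) + P.s.ringHom (P.g.ringHom r) - r, ?_, ?_⟩
        · rw [map_sub, map_add, s_f_ringHom, s_f_ringHom]; abel
        · rw [map_sub, map_add, s_g_ringHom, s_g_ringHom]; abel
      trans := by
        rintro _ _ _ ⟨r, rfl, rfl⟩ ⟨r', h, rfl⟩
        refine ⟨r + r' - P.s.ringHom (P.g.ringHom r), ?_, ?_⟩
        · rw [map_sub, map_add, s_f_ringHom, h]; abel
        · rw [map_sub, map_add, s_g_ringHom]; abel }
  add' := by
    rintro _ _ _ _ ⟨r, rfl, rfl⟩ ⟨r', rfl, rfl⟩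
    exact ⟨r + r', map_add _ _ _, map_add _ _ _⟩
  mul' := by
    rintro _ _ _ _ ⟨r, rfl, rfl⟩ ⟨r', rfl, rfl⟩
    exact ⟨r * r', map_mul _ _ _, map_mul _ _ _⟩

/-- The congruence on bimodules generated by the two maps of a free resolution. -/
def addCon : AddCon P.S₀.M where
  r a b := ∃ r, P.f.addHom r = a ∧ P.g.addHom r = b
  iseqv :=
    { refl := fun a => ⟨P.s.addHom a, P.s_f_addHom a, P.s_g_addHom a⟩
      symm := by
        rintro _ _ ⟨r, rfl, rfl⟩
        refine ⟨P.s.addHom (P.f.addHom r) + P.s.addHom (P.g.addHom r) - r, ?_, ?_⟩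
        · rw [map_sub, map_add, s_f_addHom, s_f_addHom]; abel
        · rw [map_sub, map_add, s_g_addHom, s_g_addHom]; abel
      trans := by
        rintro _ _ _ ⟨r, rfl, rfl⟩ ⟨r', h, rfl⟩
        refine ⟨r + r' - P.s.addHom (P.g.addHom r), ?_, ?_⟩
        · rw [map_sub, map_add, s_f_addHom, h]; abel
        · rw [map_sub, map_add, s_g_addHom]; abel }
  add' := by
    rintro _ _ _ _ ⟨r, rfl, rfl⟩ ⟨r', rfl, rfl⟩
    exact ⟨r + r', map_add _ _ _, map_add _ _ _⟩

/-- Left multiplication on the quotient. -/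
def quotSMul : P.ringCon.Quotient → P.addCon.Quotient → P.addCon.Quotient :=
  Quotient.map₂ (fun r m => r • m) (by
    rintro _ _ ⟨r, rfl, rfl⟩ _ _ ⟨m, rfl, rfl⟩
    exact ⟨r • m, P.f.map_smul r m, P.g.map_smul r m⟩)

/-- Right multiplication on the quotient. -/
def quotOpSMul : P.ringCon.Quotient → P.addCon.Quotient → P.addCon.Quotient :=
  Quotient.map₂ (fun r m => op r • m) (by
    rintro _ _ ⟨r, rfl, rfl⟩ _ _ ⟨m, rfl, rfl⟩
    exact ⟨op r • m, P.f.map_op_smul r m, P.g.map_op_smul r m⟩)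

/-- The explicit quotient of `P.S₀`. -/
def quot : BimodPair.{u} :=
  letI : Module P.ringCon.Quotient P.addCon.Quotient :=
    { smul := P.quotSMul
      one_smul := fun x => Quotient.inductionOn x fun x => congrArg (Quotient.mk _) (one_smul _ x)
      mul_smul := fun r s x => Quotient.inductionOn₃ r s x fun r s x =>
        congrArg (Quotient.mk _) (mul_smul r s x)
      smul_zero := fun r => Quotient.inductionOn r fun r => congrArg (Quotient.mk _) (smul_zero r)
      smul_add := fun r x y => Quotient.inductionOn₃ r x y fun r x y =>
        congrArg (Quotient.mk _) (smul_add r x y)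
      add_smul := fun r s x => Quotient.inductionOn₃ r s x fun r s x =>
        congrArg (Quotient.mk _) (add_smul r s x)
      zero_smul := fun x => Quotient.inductionOn x fun x =>
        congrArg (Quotient.mk _) (zero_smul _ x) }
  letI : Module P.ringCon.Quotientᵐᵒᵖ P.addCon.Quotient :=
    { smul := fun r => P.quotOpSMul r.unop
      one_smul := fun x => Quotient.inductionOn x fun x =>
        congrArg (Quotient.mk _) (one_smul P.S₀.Rᵐᵒᵖ x)
      mul_smul := fun r s x => r.rec' fun r => s.rec' fun s =>
        Quotient.inductionOn₃ r s x fun r s x =>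
        congrArg (Quotient.mk _) (mul_smul (op r) (op s) x)
      smul_zero := fun r => r.rec' fun r => Quotient.inductionOn r fun r =>
        congrArg (Quotient.mk _) (smul_zero (op r))
      smul_add := fun r x y => r.rec' fun r => Quotient.inductionOn₃ r x y fun r x y =>
        congrArg (Quotient.mk _) (smul_add (op r) x y)
      add_smul := fun r s x => r.rec' fun r => s.rec' fun s =>
        Quotient.inductionOn₃ r s x fun r s x =>
        congrArg (Quotient.mk _) (add_smul (op r) (op s) x)
      zero_smul := fun x => Quotient.inductionOn x fun x =>
        congrArg (Quotient.mk _) (zero_smul P.S₀.Rᵐᵒᵖ x) }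
  { R := P.ringCon.Quotient
    M := P.addCon.Quotient
    smulComm := ⟨fun r s x => s.rec' fun s => Quotient.inductionOn₃ r s x fun r s x =>
        congrArg (Quotient.mk _) (smul_comm r (op s) x)⟩ }

/-- The projection to the explicit quotient. -/
def quotMk : P.S₀ ⟶ P.quot where
  ringHom := P.ringCon.mk'
  addHom := P.addCon.mk'
  map_smul _ _ := rfl
  map_op_smul _ _ := rfl

theorem quotMk_w : P.f ≫ P.quotMk = P.g ≫ P.quotMk :=
  BimodPair.Hom.ext (RingHom.ext fun r => (RingCon.eq _).2 ⟨r, rfl, rfl⟩)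
    (AddMonoidHom.ext fun m => (AddCon.eq _).2 ⟨m, rfl, rfl⟩)

/-- The map from the explicit quotient. -/
def quotDesc : P.quot ⟶ B where
  ringHom := P.ringCon.lift P.ε.ringHom (by
    rintro _ _ ⟨r, rfl, rfl⟩
    exact congrArg (fun h : P.S₁ ⟶ B => BimodPair.Hom.ringHom h r) P.w)
  addHom := P.addCon.lift P.ε.addHom (by
    rintro _ _ ⟨r, rfl, rfl⟩
    exact congrArg (fun h : P.S₁ ⟶ B => BimodPair.Hom.addHom h r) P.w)
  map_smul r m := Quotient.inductionOn₂ r m P.ε.map_smul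
  map_op_smul r m := Quotient.inductionOn₂ r m P.ε.map_op_smul

theorem quotMk_quotDesc : P.quotMk ≫ P.quotDesc = P.ε := rfl

theorem exists_desc {Z : BimodPair.{u}} (h : P.S₀ ⟶ Z) (hh : P.f ≫ h = P.g ≫ h) :
    ∃ d : B ⟶ Z, P.ε ≫ d = h := by
  obtain ⟨hP⟩ := P.isCoequalizer
  exact ⟨hP.desc (Limits.Cofork.ofπ h hh), hP.fac _ Limits.WalkingParallelPair.one⟩

theorem hom_ext {Z : BimodPair.{u}} {h h' : B ⟶ Z} (hh : P.ε ≫ h = P.ε ≫ h') : h = h' := by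
  obtain ⟨hP⟩ := P.isCoequalizer
  exact Limits.Cofork.IsColimit.hom_ext hP hh

/-- The projection to the explicit quotient coequalises f and g, hence factors through ε. So
equality under ε implies congruence, which means a common preimage in `P.S₁`. -/
theorem exists_of_ringHom_eq {a b : P.S₀.R} (h : P.ε.ringHom a = P.ε.ringHom b) :
    ∃ r, P.f.ringHom r = a ∧ P.g.ringHom r = b := by
  obtain ⟨d, hd⟩ := P.exists_desc P.quotMk P.quotMk_w
  have key : ∀ x, d.ringHom (P.ε.ringHom x) = P.quotMk.ringHom x := fun x =>
    congrArg (fun h : P.S₀ ⟶ P.quot => BimodPair.Hom.ringHom h x) hd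
  exact (RingCon.eq P.ringCon).1 ((key a).symm.trans ((congrArg _ h).trans (key b)))

theorem exists_of_addHom_eq {a b : P.S₀.M} (h : P.ε.addHom a = P.ε.addHom b) :
    ∃ r, P.f.addHom r = a ∧ P.g.addHom r = b := by
  obtain ⟨d, hd⟩ := P.exists_desc P.quotMk P.quotMk_w
  have key : ∀ x, d.addHom (P.ε.addHom x) = P.quotMk.addHom x := fun x =>
    congrArg (fun h : P.S₀ ⟶ P.quot => BimodPair.Hom.addHom h x) hd
  exact (AddCon.eq P.addCon).1 ((key a).symm.trans ((congrArg _ h).trans (key b)))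

/-- This is how surjectivity of ε is obtained: being an epimorphism would not suffice, as
epimorphisms of rings need not be surjective. -/
theorem exists_section : ∃ d : B ⟶ P.quot, d ≫ P.quotDesc = 𝟙 B := by
  obtain ⟨d, hd⟩ := P.exists_desc P.quotMk P.quotMk_w
  refine ⟨d, P.hom_ext ?_⟩
  rw [← Category.assoc, hd, quotMk_quotDesc, Category.comp_id]

theorem ringHom_surjective : Function.Surjective P.ε.ringHom := by
  obtain ⟨d, hd⟩ := P.exists_section
  intro b
  obtain ⟨a, ha⟩ := Quotient.exists_rep (d.ringHom b)
  refine ⟨a, ?_⟩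
  refine Eq.trans (congrArg P.quotDesc.ringHom ha) ?_
  exact congrArg (fun h : B ⟶ B => BimodPair.Hom.ringHom h b) hd

theorem addHom_surjective : Function.Surjective P.ε.addHom := by
  obtain ⟨d, hd⟩ := P.exists_section
  intro b
  obtain ⟨a, ha⟩ := Quotient.exists_rep (d.addHom b)
  refine ⟨a, ?_⟩
  refine Eq.trans (congrArg P.quotDesc.addHom ha) ?_
  exact congrArg (fun h : B ⟶ B => BimodPair.Hom.addHom h b) hd

theorem tensMap_surjective : ∀ k, Function.Surjective (tensMap P.ε k)
  | 0 => P.ringHom_surjective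
  | k + 1 => fun x => by
    induction x using snoc_induction with
    | zero => exact ⟨0, map_zero _⟩
    | snoc a m =>
      obtain ⟨a, rfl⟩ := tensMap_surjective k a
      obtain ⟨m, rfl⟩ := P.addHom_surjective m
      exact ⟨snoc a m, tensMap_snoc _ _ _⟩
    | add x y hx hy =>
      obtain ⟨x, rfl⟩ := hx
      obtain ⟨y, rfl⟩ := hy
      exact ⟨x + y, map_add _ _ _⟩

theorem tensMap_s_f : ∀ {k : ℕ} (x : Tens P.S₀ k), tensMap P.f k (tensMap P.s k x) = x
  | 0, x => P.s_f_ringHom x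
  | k + 1, x => by
    induction x using snoc_induction with
    | zero => rw [map_zero, map_zero]
    | add x y hx hy => rw [map_add, map_add, hx, hy]
    | snoc a m => rw [tensMap_snoc, tensMap_snoc, tensMap_s_f, s_f_addHom]

theorem tensMap_s_g : ∀ {k : ℕ} (x : Tens P.S₀ k), tensMap P.g k (tensMap P.s k x) = x
  | 0, x => P.s_g_ringHom x
  | k + 1, x => by
    induction x using snoc_induction with
    | zero => rw [map_zero, map_zero]
    | add x y hx hy => rw [map_add, map_add, hx, hy]
    | snoc a m => rw [tensMap_snoc, tensMap_snoc, tensMap_s_g, s_g_addHom]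

/-- The elements of `P.S₀` that are related to zero. -/
def tensKer (k : ℕ) : AddSubgroup (Tens P.S₀ k) := (tensMap P.g k).ker.map (tensMap P.f k)

theorem mk_tensKer_eq {k : ℕ} {x y : Tens P.S₀ k} :
    QuotientAddGroup.mk' (P.tensKer k) x = QuotientAddGroup.mk' (P.tensKer k) y ↔
      ∃ z, tensMap P.f k z = x ∧ tensMap P.g k z = y := by
  refine QuotientAddGroup.eq.trans ⟨?_, ?_⟩
  · rintro ⟨z, hz, h⟩
    refine ⟨tensMap P.s k y - z, ?_, ?_⟩
    · rw [map_sub, tensMap_s_f, h]; abel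
    · rw [map_sub, tensMap_s_g, AddMonoidHom.mem_ker.1 hz, sub_zero]
  · rintro ⟨z, rfl, rfl⟩
    refine ⟨tensMap P.s k (tensMap P.g k z) - z, ?_, ?_⟩
    · exact AddMonoidHom.mem_ker.2 (by rw [map_sub, tensMap_s_g, sub_self])
    · rw [map_sub, tensMap_s_f]; abel

/-- Tensor powers preserve the reflexive coequaliser: a map from the tensor power over B back to the
quotient by `tensKer` is built from chosen lifts. -/
theorem exists_of_tensMap_eq : ∀ {k : ℕ} {x y : Tens P.S₀ k}, tensMap P.ε k x = tensMap P.ε k y →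
    ∃ z, tensMap P.f k z = x ∧ tensMap P.g k z = y
  | 0, _, _, h => P.exists_of_ringHom_eq h
  | k + 1, x, y, h => by
    choose la hla using P.tensMap_surjective k
    choose lm hlm using P.addHom_surjective
    -- Both tensor factors may change at once, since elements of `P.S₁` relating each of them can be
    -- tensored together. This makes the choice of lifts immaterial.
    have key : ∀ (a a' : Tens P.S₀ k) (m m' : P.S₀.M), tensMap P.ε k a = tensMap P.ε k a' →
        P.ε.addHom m = P.ε.addHom m' →
        QuotientAddGroup.mk' (P.tensKer (k + 1)) (snoc a m) =
          QuotientAddGroup.mk' (P.tensKer (k + 1)) (snoc a' m') := by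
      intro a a' m m' ha hm
      obtain ⟨z, rfl, rfl⟩ := exists_of_tensMap_eq ha
      obtain ⟨w, rfl, rfl⟩ := P.exists_of_addHom_eq hm
      exact P.mk_tensKer_eq.2 ⟨snoc z w, tensMap_snoc _ _ _, tensMap_snoc _ _ _⟩
    let φ : Tens B (k + 1) →+ Tens P.S₀ (k + 1) ⧸ P.tensKer (k + 1) :=
      snocLift (fun a m => QuotientAddGroup.mk' (P.tensKer (k + 1)) (snoc (la a) (lm m)))
        (fun a a' m => by
          rw [← map_add, ← snoc_add_left]
          exact key _ _ _ _ (by rw [map_add, hla, hla, hla]) rfl)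
        (fun a m m' => by
          rw [← map_add, ← snoc_add_right]
          exact key _ _ _ _ rfl (by rw [map_add, hlm, hlm, hlm]))
        (fun a r m => by
          obtain ⟨r, rfl⟩ := P.ringHom_surjective r
          refine Eq.trans (b := QuotientAddGroup.mk' (P.tensKer (k + 1))
            (snoc (op r • la a) (lm m))) ?_ ?_
          · exact key _ _ _ _ (by rw [hla, tensMap_op_smul, hla]) rfl
          · rw [snoc_op_smul]
            exact key _ _ _ _ rfl (by rw [hlm, P.ε.map_smul, hlm]))
    have hφ : φ.comp (tensMap P.ε (k + 1)) = QuotientAddGroup.mk' (P.tensKer (k + 1)) := by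
      refine snoc_hom_ext fun a m => ?_
      rw [AddMonoidHom.comp_apply, tensMap_snoc]
      refine (snocLift_snoc _ _ _ _ _ _).trans (key _ _ _ _ (hla _) (hlm _))
    refine P.mk_tensKer_eq.1 ?_
    rw [← hφ, AddMonoidHom.comp_apply, AddMonoidHom.comp_apply, h]

end FreeResolution

/-- The special unit with given coefficients. -/
def suMk (a : ∀ k, Tens B k) : specialUnits B :=
  ⟨PowerSeries.mk fun k => if k = 0 then 1 else tof k (a k), by
    refine ⟨by rw [PowerSeries.coeff_mk, if_pos rfl], fun k => ?_⟩
    rw [PowerSeries.coeff_mk]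
    split_ifs with h
    · subst h; exact ⟨tensOne B, rfl⟩
    · exact ⟨a k, rfl⟩⟩

theorem coeff_suMk (a : ∀ k, Tens B k) {k : ℕ} (hk : k ≠ 0) :
    PowerSeries.coeff k (suMk a).1 = tof k (a k) := by
  rw [suMk, PowerSeries.coeff_mk, if_neg hk]

theorem exists_suMk_eq (x : specialUnits B) : ∃ a, suMk a = x := by
  choose a ha using exists_coeff_eq x
  refine ⟨a, Subtype.ext (PowerSeries.ext fun k => ?_)⟩
  rcases eq_or_ne k 0 with rfl | hk
  · exact (suMk a).2.1.trans x.2.1.symm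
  · rw [coeff_suMk a hk, ha]

theorem suMap_suMk (f : B ⟶ C) (a : ∀ k, Tens B k) :
    suMap f (suMk a) = suMk fun k => tensMap f k (a k) := by
  refine Subtype.ext (PowerSeries.ext fun k => ?_)
  rcases eq_or_ne k 0 with rfl | hk
  · exact (suMap f (suMk a)).2.1.trans (suMk _).2.1.symm
  · rw [coeff_suMk _ hk]
    change PowerSeries.coeff k (PowerSeries.map (tAlgMap f) (suMk a).1) = _
    rw [PowerSeries.coeff_map, coeff_suMk a hk, tAlgMap_of]

theorem suMk_mem_congSub {N : ℕ} {a : ∀ k, Tens B k} :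
    suMk a ∈ congSub B N ↔ ∀ k < N, k ≠ 0 → a k = 0 := by
  rw [mem_congSub]
  refine forall_congr' fun k => forall_congr' fun _ => forall_congr' fun hk => ?_
  rw [coeff_suMk a hk]
  exact map_eq_zero_iff _ (DirectSum.of_injective k)

namespace FreeResolution

variable (P : FreeResolution B)

theorem exists_suMap_eq_of_mem_congSub {N : ℕ} {x : specialUnits B} (hx : x ∈ congSub B N) :
    ∃ y ∈ congSub P.S₀ N, suMap P.ε y = x := by
  obtain ⟨a, rfl⟩ := exists_suMk_eq x
  rw [suMk_mem_congSub] at hx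
  -- Zero coefficients are lifted to zero, so that the lift stays in the same step of the
  -- filtration.
  have : ∀ k, ∃ b : Tens P.S₀ k, tensMap P.ε k b = a k ∧ (a k = 0 → b = 0) := fun k => by
    by_cases h : a k = 0
    · exact ⟨0, by rw [map_zero, h], fun _ => rfl⟩
    · obtain ⟨b, hb⟩ := P.tensMap_surjective k (a k)
      exact ⟨b, hb, fun h' => (h h').elim⟩
  choose b hb hb' using this
  refine ⟨suMk b, suMk_mem_congSub.2 fun k hk hk' => hb' k (hx k hk hk'), ?_⟩
  rw [suMap_suMk]
  exact congrArg suMk (funext hb)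

theorem suMap_surjective : Function.Surjective (suMap P.ε) := fun x => by
  obtain ⟨y, -, hy⟩ := P.exists_suMap_eq_of_mem_congSub (N := 0) (x := x)
    (mem_congSub.2 fun k hk => (Nat.not_lt_zero k hk).elim)
  exact ⟨y, hy⟩

theorem exists_of_suMap_eq {x y : specialUnits P.S₀} (h : suMap P.ε x = suMap P.ε y) :
    ∃ z, suMap P.f z = x ∧ suMap P.g z = y := by
  obtain ⟨a, rfl⟩ := exists_suMk_eq x
  obtain ⟨b, rfl⟩ := exists_suMk_eq y
  rw [suMap_suMk, suMap_suMk] at h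
  -- The entry of index 0 is ignored by `suMk`, so 0 serves as a default there.
  have : ∀ k, ∃ z, k ≠ 0 → tensMap P.f k z = a k ∧ tensMap P.g k z = b k := fun k => by
    rcases eq_or_ne k 0 with rfl | hk
    · exact ⟨0, fun h => (h rfl).elim⟩
    · have h := congrArg (fun x : specialUnits B => PowerSeries.coeff k x.1) h
      rw [coeff_suMk _ hk, coeff_suMk _ hk] at h
      obtain ⟨z, hz⟩ := P.exists_of_tensMap_eq (DirectSum.of_injective k h)
      exact ⟨z, fun _ => hz⟩
  choose z hz using this
  refine ⟨suMk z, ?_, ?_⟩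
  all_goals
    refine Subtype.ext (PowerSeries.ext fun k => ?_)
    rcases eq_or_ne k 0 with rfl | hk
    · exact (suMap _ _).2.1.trans (suMk _).2.1.symm
    · rw [suMap_suMk, coeff_suMk _ hk, coeff_suMk _ hk]
      first | rw [(hz k hk).1] | rw [(hz k hk).2]

variable {p n : ℕ}

/-- Every relation over B lifts to a relation over `P.S₀`. The image is normal because ε is
surjective on special units, and closed because it contains all units that are 1 modulo t^{p^n+1}.
-/
theorem wittSub_le_map [hp : Fact p.Prime] :
    wittSub p n B ≤ (wittSub p n P.S₀).map (suMap P.ε) := by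
  have : ((wittSub p n P.S₀).map (suMap P.ε)).Normal :=
    Subgroup.Normal.map (H := wittSub p n P.S₀) inferInstance _ P.suMap_surjective
  refine wittSub_le (H := (wittSub p n P.S₀).map (suMap P.ε)) (N := p ^ n + 1) p n ?_ ?_
  · intro x hx
    obtain ⟨y, hy, rfl⟩ := P.exists_suMap_eq_of_mem_congSub hx
    exact ⟨y, congSub_le_wittSub p n _ hy, rfl⟩
  · rintro _ (⟨a, b, rfl⟩ | ⟨r, m, rfl⟩ | ⟨k, hk, m, h, rfl⟩)
    · obtain ⟨a, rfl⟩ := P.suMap_surjective a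
      obtain ⟨b, rfl⟩ := P.suMap_surjective b
      exact ⟨_, wittRel_subset p n _ (Or.inl ⟨a, b, rfl⟩), by
        simp only [map_mul, map_inv]⟩
    · obtain ⟨r, rfl⟩ := P.ringHom_surjective r
      obtain ⟨m, rfl⟩ := P.addHom_surjective m
      exact ⟨_, wittRel_subset p n _ (Or.inr (Or.inl ⟨r, m, rfl⟩)), by
        rw [map_mul, map_inv, suMap_tau, suMap_tau, P.ε.map_smul, P.ε.map_op_smul]⟩
    · choose l hl using P.addHom_surjective
      refine ⟨_, wittRel_subset p n _ (Or.inr (Or.inr ⟨k, hk, fun i => l (m i), h, rfl⟩)), ?_⟩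
      rw [suMap_oneSub, tensMap_tprod]
      simp only [hl]

theorem wMap_surjective : Function.Surjective (wMap p n P.ε) := fun w => by
  obtain ⟨x, rfl⟩ := wMk_surjective w
  obtain ⟨y, rfl⟩ := P.suMap_surjective x
  exact ⟨wMk p n y, rfl⟩

/-- The images of two representatives differ by a relation; it lifts to `P.S₀` and is absorbed into
y. The special units then have equal images, and the coefficientwise statement applies. -/
theorem exists_of_wMap_eq [hp : Fact p.Prime] {x y : WittTrunc p n P.S₀}
    (h : wMap p n P.ε x = wMap p n P.ε y) :
    ∃ z, wMap p n P.f z = x ∧ wMap p n P.g z = y := by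
  obtain ⟨x, rfl⟩ := wMk_surjective x
  obtain ⟨y, rfl⟩ := wMk_surjective y
  have h₁ : (suMap P.ε y)⁻¹ * suMap P.ε x ∈ wittSub p n B := QuotientGroup.eq.1 h.symm
  obtain ⟨d, hd, h₂⟩ := P.wittSub_le_map h₁
  obtain ⟨z, hz, hz'⟩ := P.exists_of_suMap_eq (x := x) (y := y * d) (by
    rw [map_mul, h₂, mul_inv_cancel_left])
  refine ⟨wMk p n z, by rw [wMap_wMk, hz], ?_⟩
  rw [wMap_wMk, hz', wMk_mul, wMk_eq_zero.2 hd, add_zero]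

end FreeResolution

end

section

variable {B C D : BimodPair.{u}}

/-! ### The shuffle pairing on cyclic tensor powers -/

theorem shuffle_tprod (x : ℕ → B.M) (y : ℕ → C.M) : ∀ k : ℕ,
    shuffle k (tprod x k) (tprod y k) = tprod (fun i => mtmul (x i) (y i)) k
  | 0 => rfl
  | k + 1 => by rw [tprod, tprod, shuffle_snoc, shuffle_tprod x y k, tprod]

theorem cycShuffle_tprod (x : ℕ → B.M) (y : ℕ → C.M) (k : ℕ) :
    cycShuffle k (cycMk (tprod x k)) (cycMk (tprod y k)) =
      cycMk (tprod (fun i => mtmul (x i) (y i)) k) := by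
  rw [cycShuffle_mk, shuffle_tprod]

theorem cyc_biadd_ext {k : ℕ} (hk : k ≠ 0) {X : Type*} [AddCommGroup X]
    {φ ψ : Cyc B k → Cyc C k → X} (hφ : ∀ x x' y, φ (x + x') y = φ x y + φ x' y)
    (hψ : ∀ x x' y, ψ (x + x') y = ψ x y + ψ x' y)
    (hφ' : ∀ x y y', φ x (y + y') = φ x y + φ x y')
    (hψ' : ∀ x y y', ψ x (y + y') = ψ x y + ψ x y')
    (h : ∀ a b, φ (cycMk (tprod a k)) (cycMk (tprod b k)) =
      ψ (cycMk (tprod a k)) (cycMk (tprod b k))) (x : Cyc B k) (y : Cyc C k) : φ x y = ψ x y := by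
  induction x using cyc_induction hk with
  | zero =>
    have h₁ : φ 0 y = 0 := by simpa using hφ 0 0 y
    have h₂ : ψ 0 y = 0 := by simpa using hψ 0 0 y
    rw [h₁, h₂]
  | add x x' hx hx' => rw [hφ, hψ, hx, hx']
  | tprod a =>
    exact DFunLike.congr_fun (f := AddMonoidHom.mk' (φ _) (hφ' _))
      (g := AddMonoidHom.mk' (ψ _) (hψ' _)) (cyc_hom_ext hk (h a)) y

theorem cycMap_cycShuffle {B' C' : BimodPair.{u}} (f : B ⟶ B') (g : C ⟶ C') {k : ℕ} (hk : k ≠ 0)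
    (x : Cyc B k) (y : Cyc C k) :
    cycMap (tensorHom f g) k (cycShuffle k x y) = cycShuffle k (cycMap f k x) (cycMap g k y) := by
  refine cyc_biadd_ext hk (φ := fun x y => cycMap (tensorHom f g) k (cycShuffle k x y))
    (ψ := fun x y => cycShuffle k (cycMap f k x) (cycMap g k y)) ?_ ?_ ?_ ?_ (fun a b => ?_) x y
  any_goals intros; simp only [map_add, AddMonoidHom.add_apply]
  simp only [cycShuffle_tprod, cycMap_tprod]
  rfl

theorem rot_cycShuffle {k : ℕ} (hk : k ≠ 0) (x : Cyc B k) (y : Cyc C k) :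
    rot (B.tensor C) k (cycShuffle k x y) = cycShuffle k (rot B k x) (rot C k y) := by
  refine cyc_biadd_ext hk (φ := fun x y => rot (B.tensor C) k (cycShuffle k x y))
    (ψ := fun x y => cycShuffle k (rot B k x) (rot C k y)) ?_ ?_ ?_ ?_ (fun a b => ?_) x y
  any_goals intros; simp only [map_add, AddMonoidHom.add_apply]
  simp only [cycShuffle_tprod, rot_tprod _ hk]
  refine congrArg _ (tprod_congr fun i _ => ?_)
  split_ifs <;> rfl

theorem cycMap_braiding_cycShuffle {k : ℕ} (hk : k ≠ 0) (x : Cyc B k) (y : Cyc C k) :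
    cycMap (braiding B C) k (cycShuffle k x y) = cycShuffle k y x := by
  refine cyc_biadd_ext hk (φ := fun x y => cycMap (braiding B C) k (cycShuffle k x y))
    (ψ := fun x y => cycShuffle k y x) ?_ ?_ ?_ ?_ (fun a b => ?_) x y
  any_goals intros; simp only [map_add, AddMonoidHom.add_apply]
  simp only [cycShuffle_tprod, cycMap_tprod]
  rfl

theorem cycMap_associator_cycShuffle {k : ℕ} (hk : k ≠ 0) (x : Cyc B k) (y : Cyc C k)
    (z : Cyc D k) :
    cycMap (associator B C D) k (cycShuffle k (cycShuffle k x y) z) =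
      cycShuffle k x (cycShuffle k y z) := by
  refine cyc_biadd_ext hk
    (φ := fun x y => cycMap (associator B C D) k (cycShuffle k (cycShuffle k x y) z))
    (ψ := fun x y => cycShuffle k x (cycShuffle k y z)) ?_ ?_ ?_ ?_ (fun a b => ?_) x y
  any_goals intros; simp only [map_add, AddMonoidHom.add_apply]
  induction z using cyc_induction hk with
  | zero => simp only [map_zero]
  | add z z' hz hz' => simp only [map_add, hz, hz']
  | tprod c =>
    simp only [cycShuffle_tprod, cycMap_tprod]
    rfl

theorem cycMap_leftUnitor_cycShuffle {k : ℕ} (hk : k ≠ 0) (x : Cyc B k) :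
    cycMap (leftUnitor B) k (cycShuffle k (cycOne k) x) = x := by
  induction x using cyc_induction hk with
  | zero => rw [map_zero, map_zero]
  | add x y hx hy => rw [map_add, map_add, hx, hy]
  | tprod a =>
    refine (congrArg (cycMap (leftUnitor B) k)
      (cycShuffle_tprod (B := unitPair) _ a k)).trans ?_
    rw [cycMap_tprod]
    exact congrArg _ (tprod_congr fun i _ => one_smul ℤ (a i))

theorem iterate_rot_cycShuffle {k : ℕ} (hk : k ≠ 0) {x : Cyc B k} (hx : rot B k x = x)
    (y : Cyc C k) (s : ℕ) :
    (rot (B.tensor C) k)^[s] (cycShuffle k x y) = cycShuffle k x ((rot C k)^[s] y) := by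
  induction s with
  | zero => rfl
  | succ s ih =>
    rw [Function.iterate_succ_apply', ih, rot_cycShuffle hk, hx, Function.iterate_succ_apply']

/-- Frobenius reciprocity: σ acts diagonally on a shuffle, so an invariant factor comes out of the
transfer. -/
theorem transfer_cycShuffle {k : ℕ} (hk : k ≠ 0) (d : ℕ) {x : Cyc B k} (hx : rot B k x = x)
    (y : Cyc C k) :
    transfer (B.tensor C) k d (cycShuffle k x y) = cycShuffle k x (transfer C k d y) := by
  rw [transfer, transfer, map_sum]
  exact Finset.sum_congr rfl fun s _ => iterate_rot_cycShuffle hk hx y s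

/-- The cyclic tensor with periodic entries, shifted by `s`. -/
def periodic (c N : ℕ) (x : ℕ → B.M) (s : ℕ) : Cyc B N :=
  cycMk (tprod (fun l => x ((l + s) % c)) N)

theorem rot_periodic {c N : ℕ} (hN : N ≠ 0) (hc : c ∣ N) (x : ℕ → B.M) (s : ℕ) :
    rot B N (periodic c N x (s + 1)) = periodic c N x s := by
  rw [periodic, rot_tprod _ hN]
  refine congrArg _ (tprod_congr fun i _ => ?_)
  split_ifs with hi
  · subst hi
    obtain ⟨e, rfl⟩ := hc
    -- The letter that wraps around fits the period because c divides N.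
    rw [show c * e - 1 + (s + 1) = s + c * e by omega, Nat.add_mul_mod_self_left, zero_add]
  · rw [show i - 1 + (s + 1) = i + s by omega]

theorem iterate_rot_periodic {c N : ℕ} (hN : N ≠ 0) (hc : c ∣ N) (x : ℕ → B.M) (s r : ℕ) :
    (rot B N)^[s] (periodic c N x (r + s)) = periodic c N x r := by
  induction s with
  | zero => rfl
  | succ s ih => rw [Function.iterate_succ_apply, ← add_assoc, rot_periodic hN hc, ih]

theorem periodic_self (c N : ℕ) (x : ℕ → B.M) : periodic c N x c = periodic c N x 0 := by
  simp only [periodic, Nat.add_mod_right, add_zero]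

theorem rot_transfer_periodic {c N : ℕ} (hN : N ≠ 0) (hc : c ∣ N) (x : ℕ → B.M) :
    rot B N (transfer B N c (periodic c N x 0)) = transfer B N c (periodic c N x 0) := by
  have h := iterate_rot_periodic hN hc x c 0
  rw [zero_add, periodic_self] at h
  rw [← sub_eq_zero, rot_transfer_sub, h, sub_self]

/-- Rotations lower the shift, so starting from the shift 0, which equals the shift c, the transfer
runs through c, …, 1 in reverse order. -/
theorem transfer_periodic {c N : ℕ} (hN : N ≠ 0) (hc : c ∣ N) (x : ℕ → B.M) :
    transfer B N c (periodic c N x 0) = ∑ s ∈ Finset.range c, periodic c N x s := by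
  have h : transfer B N c (periodic c N x 0) =
      ∑ s ∈ Finset.range c, periodic c N x (c - 1 - s + 1) := by
    refine Finset.sum_congr rfl fun s hs => ?_
    have hs := Finset.mem_range.1 hs
    have := iterate_rot_periodic hN hc x s (c - 1 - s + 1)
    rwa [show c - 1 - s + 1 + s = c by omega, periodic_self] at this
  rw [h, Finset.sum_range_reflect (fun s => periodic c N x (s + 1)) c]
  have h₁ := Finset.sum_range_succ (periodic c N x) c
  rw [Finset.sum_range_succ', periodic_self] at h₁
  exact add_right_cancel h₁

theorem tlogCoeff_oneSub_tprod {k : ℕ} (hk : k ≠ 0) (x : ℕ → B.M) {N : ℕ} (hN : N ≠ 0)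
    (h : k ∣ N) :
    tlogCoeff (oneSub hk (tprod x k)) N = transfer B N k (periodic k N x 0) := by
  rw [tlogCoeff_oneSub hk _ hN, if_pos h, tof_tprod_pow, Nat.mul_div_cancel' h, cycComp_tof]
  rfl

theorem tlogCoeff_oneSub_of_not_dvd {k : ℕ} (hk : k ≠ 0) (a : Tens B k) {N : ℕ} (hN : N ≠ 0)
    (h : ¬k ∣ N) : tlogCoeff (oneSub hk a) N = 0 := by
  rw [tlogCoeff_oneSub hk _ hN, if_neg h, map_zero, transfer_zero_apply]

/-- The tlog of 1 - x t^c is the invariant sum of the c shifts of the periodic word x. Reciprocity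
moves it into the transfer over d rotations that gives the tlog of 1 - y t^d, one summand for each
shift. If d does not divide N, both sides vanish. -/
theorem sum_tlogCoeff_eq_cycShuffle {c d : ℕ} (hc : c ≠ 0) (hd : d ≠ 0) (hcd : c ∣ d)
    (x : ℕ → B.M) (y : ℕ → C.M) {N : ℕ} (hN : N ≠ 0) :
    ∑ s ∈ Finset.range c,
        tlogCoeff (oneSub hd (tprod (fun l => mtmul (x ((l + s) % c)) (y l)) d)) N =
      cycShuffle N (tlogCoeff (oneSub hc (tprod x c)) N)
        (tlogCoeff (oneSub hd (tprod y d)) N) := by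
  by_cases h : d ∣ N
  · rw [tlogCoeff_oneSub_tprod hc x hN (hcd.trans h), tlogCoeff_oneSub_tprod hd y hN h,
      ← transfer_cycShuffle hN d (rot_transfer_periodic hN (hcd.trans h) x),
      transfer_periodic hN (hcd.trans h), map_sum, AddMonoidHom.finsetSum_apply,
      ← transferHom_apply, map_sum]
    refine Finset.sum_congr rfl fun s _ => ?_
    rw [tlogCoeff_oneSub_tprod hd _ hN h, transferHom_apply]
    simp only [periodic, cycShuffle_tprod]
    refine congrArg (fun z => transfer _ N d (cycMk z)) (tprod_congr fun l _ => ?_)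
    obtain ⟨e, rfl⟩ := hcd
    -- Since c divides d, reducing an index modulo d first does not affect its residue modulo c.
    rw [add_zero, Nat.add_mod, Nat.mod_mul_right_mod, ← Nat.add_mod]
  · rw [tlogCoeff_oneSub_of_not_dvd hd _ hN h, map_zero]
    exact Finset.sum_eq_zero fun s _ => tlogCoeff_oneSub_of_not_dvd hd _ hN h

end

/-! ### The lax symmetric monoidal structure on Witt vectors -/

section

variable {B C D : BimodPair.{u}} {p n : ℕ}

/-! ### Identities between morphisms -/

theorem tensor_hom_ext {f g : B.tensor C ⟶ D}
    (h : ∀ r s, f.ringHom (rtmul r s) = g.ringHom (rtmul r s))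
    (h' : ∀ m m', f.addHom (mtmul m m') = g.addHom (mtmul m m')) : f = g := by
  refine BimodPair.Hom.ext (RingHom.ext fun x => ?_) (AddMonoidHom.ext fun x => ?_)
  · induction x using rtmul_induction with
    | zero => rw [map_zero, map_zero]
    | add x y hx hy => rw [map_add, map_add, hx, hy]
    | tmul r s => exact h r s
  · induction x using mtmul_induction with
    | zero => rw [map_zero, map_zero]
    | add x y hx hy => rw [map_add, map_add, hx, hy]
    | tmul r s => exact h' r s

theorem tensorHom_comp {B' B'' C' C'' : BimodPair.{u}} (f : B ⟶ B') (f' : B' ⟶ B'') (g : C ⟶ C')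
    (g' : C' ⟶ C'') :
    tensorHom (f ≫ f') (g ≫ g') = tensorHom f g ≫ tensorHom f' g' :=
  tensor_hom_ext (fun _ _ => rfl) (fun _ _ => rfl)

theorem braiding_naturality {B' C' : BimodPair.{u}} (f : B ⟶ B') (g : C ⟶ C') :
    tensorHom f g ≫ braiding B' C' = braiding B C ≫ tensorHom g f :=
  tensor_hom_ext (fun _ _ => rfl) (fun _ _ => rfl)

theorem associator_naturality {B' C' D' : BimodPair.{u}} (f : B ⟶ B') (g : C ⟶ C') (h : D ⟶ D') :
    tensorHom (tensorHom f g) h ≫ associator B' C' D' =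
      associator B C D ≫ tensorHom f (tensorHom g h) := by
  refine tensor_hom_ext (fun r s => ?_) (fun m m' => ?_)
  · induction r using rtmul_induction with
    | zero => rw [zero_rtmul, map_zero, map_zero]
    | add x y hx hy => rw [add_rtmul, map_add, map_add, hx, hy]
    | tmul r r' => rfl
  · induction m using mtmul_induction with
    | zero => rw [zero_mtmul, map_zero, map_zero]
    | add x y hx hy => rw [add_mtmul, map_add, map_add, hx, hy]
    | tmul r r' => rfl

theorem leftUnitor_naturality (f : B ⟶ C) :
    tensorHom (𝟙 unitPair) f ≫ leftUnitor C = leftUnitor B ≫ f := by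
  refine tensor_hom_ext (fun r s => ?_) (fun m m' => ?_)
  · exact (map_zsmul f.ringHom (ULift.down r) s).symm
  · exact (map_zsmul f.addHom (ULift.down m) m').symm

theorem tensMap_comp (f : B ⟶ C) (g : C ⟶ D) : ∀ {k : ℕ} (x : Tens B k),
    tensMap (f ≫ g) k x = tensMap g k (tensMap f k x)
  | 0, _ => rfl
  | k + 1, x => by
    induction x using snoc_induction with
    | zero => rw [map_zero, map_zero, map_zero]
    | add x y hx hy => rw [map_add, map_add, map_add, hx, hy]
    | snoc a m => rw [tensMap_snoc, tensMap_snoc, tensMap_snoc, tensMap_comp]; rfl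

theorem tensMap_id : ∀ {k : ℕ} (x : Tens B k), tensMap (𝟙 B) k x = x
  | 0, _ => rfl
  | k + 1, x => by
    induction x using snoc_induction with
    | zero => rw [map_zero]
    | add x y hx hy => rw [map_add, hx, hy]
    | snoc a m => rw [tensMap_snoc, tensMap_id]; rfl

theorem wMap_comp (f : B ⟶ C) (g : C ⟶ D) (x : WittTrunc p n B) :
    wMap p n (f ≫ g) x = wMap p n g (wMap p n f x) := by
  obtain ⟨x, rfl⟩ := wMk_surjective x
  obtain ⟨a, rfl⟩ := exists_suMk_eq x
  simp only [wMap_wMk, suMap_suMk, tensMap_comp]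

theorem wMap_id (x : WittTrunc p n B) : wMap p n (𝟙 B) x = x := by
  obtain ⟨x, rfl⟩ := wMk_surjective x
  obtain ⟨a, rfl⟩ := exists_suMk_eq x
  simp only [wMap_wMk, suMap_suMk, tensMap_id]

theorem wMap_counit_surjective (B : BimodPair.{u}) :
    Function.Surjective (wMap p n (counit B)) := (barResolution B).wMap_surjective

theorem wMap_tensorHom_eq {f₁ f₂ : B ⟶ D} {E : BimodPair.{u}} {g₁ g₂ : C ⟶ E}
    {D' E' : BimodPair.{u}}
    {d : D ⟶ D'} {e : E ⟶ E'} (h : f₁ ≫ d = f₂ ≫ d) (h' : g₁ ≫ e = g₂ ≫ e)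
    (v : WittTrunc p n (B.tensor C)) :
    wMap p n (tensorHom d e) (wMap p n (tensorHom f₁ g₁) v) =
      wMap p n (tensorHom d e) (wMap p n (tensorHom f₂ g₂) v) := by
  rw [← wMap_comp, ← wMap_comp, ← tensorHom_comp, ← tensorHom_comp, h, h']

/-! ### The product of Witt vectors -/

variable [hp : Fact p.Prime]

/-- The logarithmic derivative of `u` is the shuffle product of those of `x` and `y`. -/
def IsProduct (x : WittTrunc p n B) (y : WittTrunc p n C) (u : WittTrunc p n (B.tensor C)) : Prop :=
  ∀ j : Fin (n + 1), (tlogW p n _ u j : Cyc (B.tensor C) (p ^ (j : ℕ))) =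
    cycShuffle _ (tlogW p n B x j : Cyc B (p ^ (j : ℕ))) (tlogW p n C y j : Cyc C (p ^ (j : ℕ)))

theorem pow_prime_ne_zero (i : ℕ) : p ^ i ≠ 0 := pow_ne_zero i hp.out.ne_zero

theorem tlogW_add_apply (x y : WittTrunc p n B) (j : Fin (n + 1)) :
    (tlogW p n B (x + y) j : Cyc B (p ^ (j : ℕ))) = tlogW p n B x j + tlogW p n B y j := by
  rw [map_add]; rfl

theorem tlogW_neg_apply (x : WittTrunc p n B) (j : Fin (n + 1)) :
    (tlogW p n B (-x) j : Cyc B (p ^ (j : ℕ))) = -tlogW p n B x j := by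
  rw [map_neg]; rfl

theorem tlogW_zero_apply (j : Fin (n + 1)) :
    (tlogW p n B 0 j : Cyc B (p ^ (j : ℕ))) = 0 := by
  rw [map_zero]; rfl

theorem tlogW_ext (hB : NormExact B) {x y : WittTrunc p n B}
    (h : ∀ j : Fin (n + 1), (tlogW p n B x j : Cyc B (p ^ (j : ℕ))) = tlogW p n B y j) : x = y :=
  tlogW_injective hB (funext fun j => Subtype.ext (h j))

namespace IsProduct

variable {x x' : WittTrunc p n B} {y y' : WittTrunc p n C} {u u' : WittTrunc p n (B.tensor C)}

theorem add_left (h : IsProduct x y u) (h' : IsProduct x' y u') :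
    IsProduct (x + x') y (u + u') := fun j => by
  rw [tlogW_add_apply, tlogW_add_apply, h j, h' j, map_add, AddMonoidHom.add_apply]

theorem add_right (h : IsProduct x y u) (h' : IsProduct x y' u') :
    IsProduct x (y + y') (u + u') := fun j => by
  rw [tlogW_add_apply, tlogW_add_apply, h j, h' j, map_add]

theorem neg_left (h : IsProduct x y u) : IsProduct (-x) y (-u) := fun j => by
  rw [tlogW_neg_apply, tlogW_neg_apply, h j, map_neg, AddMonoidHom.neg_apply]

theorem neg_right (h : IsProduct x y u) : IsProduct x (-y) (-u) := fun j => by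
  rw [tlogW_neg_apply, tlogW_neg_apply, h j, map_neg]

theorem zero_left (y : WittTrunc p n C) : IsProduct (0 : WittTrunc p n B) y 0 := fun j => by
  rw [tlogW_zero_apply, tlogW_zero_apply, map_zero, AddMonoidHom.zero_apply]

theorem zero_right (x : WittTrunc p n B) : IsProduct x (0 : WittTrunc p n C) 0 := fun j => by
  rw [tlogW_zero_apply, tlogW_zero_apply, map_zero]

theorem map {B' C' : BimodPair.{u}} (h : IsProduct x y u) (f : B ⟶ B') (g : C ⟶ C') :
    IsProduct (wMap p n f x) (wMap p n g y) (wMap p n (tensorHom f g) u) := fun j => by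
  rw [tlogW_wMap, tlogW_wMap, tlogW_wMap, h j, cycMap_cycShuffle _ _ (pow_prime_ne_zero _)]

theorem braiding (h : IsProduct x y u) :
    IsProduct y x (wMap p n (WittCoeff.braiding B C) u) := fun j => by
  rw [tlogW_wMap, h j, cycMap_braiding_cycShuffle (pow_prime_ne_zero _)]

theorem eq (hB : NormExact (B.tensor C)) (h : IsProduct x y u) (h' : IsProduct x y u') : u = u' :=
  tlogW_ext hB fun j => (h j).trans (h' j).symm

end IsProduct

theorem isProduct_oneSub {i j : ℕ} (hij : i ≤ j) (x : ℕ → B.M) (y : ℕ → C.M) :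
    IsProduct (wMk p n (oneSub (pow_ne_zero i hp.out.ne_zero) (tprod x (p ^ i))))
      (wMk p n (oneSub (pow_ne_zero j hp.out.ne_zero) (tprod y (p ^ j))))
      (∑ s ∈ Finset.range (p ^ i), wMk p n (oneSub (pow_ne_zero j hp.out.ne_zero)
        (tprod (fun l => mtmul (x ((l + s) % p ^ i)) (y l)) (p ^ j)))) := fun J => by
  rw [map_sum, Finset.sum_apply, AddSubgroup.val_finsetSum]
  exact sum_tlogCoeff_eq_cycShuffle _ _ (pow_dvd_pow p hij) x y (pow_prime_ne_zero _)

/-- Being a product is biadditive, so generators suffice; the case i > j is reflected by the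
braiding. Existence needs no condition on the pairs, only uniqueness does. -/
theorem exists_isProduct (x : WittTrunc p n B) (y : WittTrunc p n C) : ∃ u, IsProduct x y u := by
  induction x using witt_induction with
  | zero => exact ⟨0, IsProduct.zero_left y⟩
  | add x x' hx hx' =>
    obtain ⟨u, hu⟩ := hx
    obtain ⟨u', hu'⟩ := hx'
    exact ⟨_, hu.add_left hu'⟩
  | neg x hx =>
    obtain ⟨u, hu⟩ := hx
    exact ⟨_, hu.neg_left⟩
  | tprod i hi x =>
    induction y using witt_induction with
    | zero => exact ⟨0, IsProduct.zero_right _⟩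
    | add x x' hx hx' =>
      obtain ⟨u, hu⟩ := hx
      obtain ⟨u', hu'⟩ := hx'
      exact ⟨_, hu.add_right hu'⟩
    | neg x hx =>
      obtain ⟨u, hu⟩ := hx
      exact ⟨_, hu.neg_right⟩
    | tprod j hj y =>
      rcases le_total i j with h | h
      · exact ⟨_, isProduct_oneSub h x y⟩
      · exact ⟨_, (isProduct_oneSub h y x).braiding⟩

/-- The basis of a free cover. -/
def coverBasis (B : BimodPair.{u}) : BimodBasis (freeCover B) :=
  (nonempty_bimodBasis_of_isFree (isFree_freePair _ _)).some

/-- Two lifts of the same class come from one class in the second stage of the bar resolution. A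
product formed there maps under f and g to the two given products, by uniqueness over the tensor
product of the free covers, and both push forward to the same class. -/
theorem wMap_counit_eq_of_isProduct {x x' : WittTrunc p n (freeCover B)}
    {y y' : WittTrunc p n (freeCover C)} {u u' : WittTrunc p n ((freeCover B).tensor (freeCover C))}
    (hx : wMap p n (counit B) x = wMap p n (counit B) x')
    (hy : wMap p n (counit C) y = wMap p n (counit C) y')
    (h : IsProduct x y u) (h' : IsProduct x' y' u') :
    wMap p n (tensorHom (counit B) (counit C)) u =
      wMap p n (tensorHom (counit B) (counit C)) u' := by
  obtain ⟨z, rfl, rfl⟩ := (barResolution B).exists_of_wMap_eq hx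
  obtain ⟨w, rfl, rfl⟩ := (barResolution C).exists_of_wMap_eq hy
  obtain ⟨v, hv⟩ := exists_isProduct z w
  have hN := ((coverBasis B).tensor (coverBasis C)).normExact
  have h₁ := IsProduct.eq hN h (hv.map (barResolution B).f (barResolution C).f)
  have h₂ := IsProduct.eq hN h' (hv.map (barResolution B).g (barResolution C).g)
  rw [h₁, h₂]
  exact wMap_tensorHom_eq (barResolution B).w (barResolution C).w v

/-- The product of Witt vectors. -/
def wMul (x : WittTrunc p n B) (y : WittTrunc p n C) : WittTrunc p n (B.tensor C) :=
  wMap p n (tensorHom (counit B) (counit C))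
    (exists_isProduct (wMap_counit_surjective B x).choose
      (wMap_counit_surjective C y).choose).choose

/-- The arbitrary choices in `wMul` may be replaced by any lifts and any product of them; the axioms
are deduced from this form. -/
theorem wMul_eq_of_isProduct {x : WittTrunc p n (freeCover B)} {y : WittTrunc p n (freeCover C)}
    {u : WittTrunc p n ((freeCover B).tensor (freeCover C))} (h : IsProduct x y u) :
    wMul (wMap p n (counit B) x) (wMap p n (counit C) y) =
      wMap p n (tensorHom (counit B) (counit C)) u :=
  wMap_counit_eq_of_isProduct (wMap_counit_surjective B _).choose_spec
    (wMap_counit_surjective C _).choose_spec (exists_isProduct _ _).choose_spec h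

theorem isProduct_wMul (x : WittTrunc p n B) (y : WittTrunc p n C) : IsProduct x y (wMul x y) := by
  obtain ⟨x, rfl⟩ := wMap_counit_surjective B x
  obtain ⟨y, rfl⟩ := wMap_counit_surjective C y
  obtain ⟨u, hu⟩ := exists_isProduct x y
  rw [wMul_eq_of_isProduct hu]
  exact hu.map _ _

theorem wMap_wMul {B' C' : BimodPair.{u}} (f : B ⟶ B') (g : C ⟶ C') (x : WittTrunc p n B)
    (y : WittTrunc p n C) :
    wMap p n (tensorHom f g) (wMul x y) = wMul (wMap p n f x) (wMap p n g y) := by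
  obtain ⟨x, rfl⟩ := wMap_counit_surjective B x
  obtain ⟨y, rfl⟩ := wMap_counit_surjective C y
  obtain ⟨u, hu⟩ := exists_isProduct x y
  rw [wMul_eq_of_isProduct hu, ← wMap_comp, ← wMap_comp, ← wMap_comp, ← freeMap_counit,
    ← freeMap_counit, wMap_comp (freeMap f), wMap_comp (freeMap g),
    wMul_eq_of_isProduct (hu.map (freeMap f) (freeMap g)),
    ← wMap_comp, ← tensorHom_comp, ← tensorHom_comp, freeMap_counit, freeMap_counit]

theorem add_wMul (x x' : WittTrunc p n B) (y : WittTrunc p n C) :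
    wMul (x + x') y = wMul x y + wMul x' y := by
  obtain ⟨x, rfl⟩ := wMap_counit_surjective B x
  obtain ⟨x', rfl⟩ := wMap_counit_surjective B x'
  obtain ⟨y, rfl⟩ := wMap_counit_surjective C y
  obtain ⟨u, hu⟩ := exists_isProduct x y
  obtain ⟨u', hu'⟩ := exists_isProduct x' y
  rw [← map_add, wMul_eq_of_isProduct hu, wMul_eq_of_isProduct hu',
    wMul_eq_of_isProduct (hu.add_left hu'), map_add]

theorem wMul_comm (x : WittTrunc p n B) (y : WittTrunc p n C) :
    wMap p n (braiding B C) (wMul x y) = wMul y x := by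
  obtain ⟨x, rfl⟩ := wMap_counit_surjective B x
  obtain ⟨y, rfl⟩ := wMap_counit_surjective C y
  obtain ⟨u, hu⟩ := exists_isProduct x y
  rw [wMul_eq_of_isProduct hu, wMul_eq_of_isProduct hu.braiding, ← wMap_comp, ← wMap_comp,
    braiding_naturality]

theorem wMul_add (x : WittTrunc p n B) (y y' : WittTrunc p n C) :
    wMul x (y + y') = wMul x y + wMul x y' := by
  rw [← wMul_comm, add_wMul, map_add, wMul_comm, wMul_comm]

theorem wMul_assoc (x : WittTrunc p n B) (y : WittTrunc p n C) (z : WittTrunc p n D) :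
    wMap p n (associator B C D) (wMul (wMul x y) z) = wMul x (wMul y z) := by
  obtain ⟨x, rfl⟩ := wMap_counit_surjective B x
  obtain ⟨y, rfl⟩ := wMap_counit_surjective C y
  obtain ⟨z, rfl⟩ := wMap_counit_surjective D z
  rw [← wMap_wMul, ← wMap_wMul, ← wMap_wMul, ← wMap_wMul, ← wMap_comp, associator_naturality,
    wMap_comp]
  -- Both sides are now images of classes over a triple tensor product of free covers, where tlog
  -- detects equality.
  refine congrArg _ (tlogW_ext
    ((coverBasis B).tensor ((coverBasis C).tensor (coverBasis D))).normExact fun j => ?_)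
  rw [tlogW_wMap, isProduct_wMul _ _ j, isProduct_wMul _ _ j, isProduct_wMul _ _ j,
    isProduct_wMul _ _ j, cycMap_associator_cycShuffle (pow_prime_ne_zero _)]

/-- The unit for the product of Witt vectors. -/
def wUnit (p n : ℕ) : WittTrunc p n unitPair.{u} :=
  wMk p n (tau (B := unitPair.{u}) (⟨1⟩ : ULift.{u} ℤ))

theorem tlogW_wUnit (j : Fin (n + 1)) :
    (tlogW p n unitPair.{u} (wUnit p n) j : Cyc unitPair (p ^ (j : ℕ))) = cycOne _ := by
  have h := tlogCoeff_oneSub_tprod one_ne_zero (B := unitPair.{u})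
    (fun _ => (⟨1⟩ : ULift.{u} ℤ)) (pow_prime_ne_zero (p := p) (j : ℕ)) (one_dvd _)
  rw [transfer, Finset.sum_range_one] at h
  exact h

theorem wUnit_wMul (x : WittTrunc p n B) : wMap p n (leftUnitor B) (wMul (wUnit p n) x) = x := by
  obtain ⟨x, rfl⟩ := wMap_counit_surjective B x
  have h := wMap_wMul (𝟙 unitPair) (counit B) (wUnit p n) x
  rw [wMap_id] at h
  rw [← h, ← wMap_comp, leftUnitor_naturality, wMap_comp]
  refine congrArg _ (tlogW_ext (coverBasis B).normExact fun j => ?_)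
  rw [tlogW_wMap, isProduct_wMul _ _ j, tlogW_wUnit,
    cycMap_leftUnitor_cycShuffle (pow_prime_ne_zero _)]

/-- The standard lax symmetric monoidal structure on Witt vectors. -/
def wittLax (p n : ℕ) [hp : Fact p.Prime] :
    LaxStructure (WittTrunc.{u} p n) (fun f => wMap p n f) where
  addCommGroup _ := inferInstance
  map_add f x y := map_add (wMap p n f) x y
  unit := wUnit p n
  mul := wMul
  add_mul := add_wMul
  mul_add := wMul_add
  map_mul := wMap_wMul
  mul_assoc := wMul_assoc
  unit_mul := wUnit_wMul
  mul_unit x := by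
    change wMap p n (braiding _ _ ≫ leftUnitor _) (wMul x (wUnit p n)) = x
    rw [wMap_comp, wMul_comm, wUnit_wMul]
  mul_comm := wMul_comm

theorem wittLax_isStandard : (wittLax.{u} p n).IsStandard where
  addCommGroup_eq _ := rfl
  unit_eq := rfl
  mul_eq B C i j hij hj x y := by
    -- Elementary tensors are lifted to elementary tensors of generators, for which the formula
    -- upstairs is known to be a product.
    have h := wMul_eq_of_isProduct (isProduct_oneSub (n := n) (p := p) hij
      (fun l => (modGen (x l) : (freeCover B).M)) (fun l => (modGen (y l) : (freeCover C).M)))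
    have key : ∀ (D : BimodPair.{u}) (i : ℕ) (z : ℕ → D.M), wMap p n (counit D)
        (wMk p n (oneSub (pow_ne_zero i hp.out.ne_zero)
          (tprod (fun l => (modGen (z l) : (freeCover D).M)) (p ^ i)))) =
        wMk p n (oneSub (pow_ne_zero i hp.out.ne_zero) (tprod z (p ^ i))) := fun D i z => by
      rw [wMap_wMk, suMap_oneSub, tensMap_tprod]
      simp only [counit_modGen]
    rw [key, key, map_sum] at h
    refine h.trans (Finset.sum_congr rfl fun s _ => ?_)
    rw [wMap_wMk, suMap_oneSub, tensMap_tprod]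
    refine congrArg (fun z => wMk p n (oneSub _ z)) (tprod_congr fun l _ => ?_)
    exact congrArg₂ mtmul (counit_modGen _) (counit_modGen _)

theorem wittLax_isCompatible :
    (wittLax.{u} p n).IsCompatible p (n + 1) (fun B => tlogW p n B) where
  map_add B x y := map_add (tlogW p n B) x y
  map_unit := tlogW_wUnit
  map_mul _ _ x y := isProduct_wMul x y

end

/-! ### The bijection γ and the uniqueness of the structures -/

section

variable {B C D : BimodPair.{u}} {p n : ℕ}

/-! ### Comparison with Witt coordinates -/

theorem wMap_gammaRep [hp : Fact p.Prime] (f : B ⟶ C) (a : Coord p (n + 1) B) :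
    wMap p n f (gammaRep p n a) = gammaRep p n (coordMap p (n + 1) f a) := by
  rw [gammaRep_eq_sum, gammaRep_eq_sum, map_sum]
  refine Finset.sum_congr rfl fun i _ => ?_
  rw [wMap_wMk, suMap_oneSub]
  rfl

/-- Ghost vectors are the tlogs of the classes, and tlog is injective under `NormExact`. -/
theorem gammaRep_eq_iff [hp : Fact p.Prime] (hB : NormExact B) {a b : Coord p (n + 1) B} :
    gammaRep p n a = gammaRep p n b ↔ ghost p (n + 1) a = ghost p (n + 1) b := by
  refine ⟨fun h => funext fun j => ?_, fun h => tlogW_ext hB fun j => ?_⟩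
  · rw [← tlogW_gammaRep, h, tlogW_gammaRep]
  · rw [tlogW_gammaRep, h, tlogW_gammaRep]

namespace FreeResolution

variable (P : FreeResolution B)

theorem normExact : NormExact P.S₀ := (nonempty_bimodBasis_of_isFree P.free₀).some.normExact

theorem wMap_w (z : WittTrunc p n P.S₁) :
    wMap p n P.ε (wMap p n P.f z) = wMap p n P.ε (wMap p n P.g z) := by
  rw [← wMap_comp, P.w, wMap_comp]

theorem coordMap_surjective : Function.Surjective (coordMap p (n + 1) P.ε) := fun a => by
  choose q hq using fun i : Fin (n + 1) => P.tensMap_surjective _ (a i)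
  exact ⟨q, funext hq⟩

/-- Over `P.S₀` ghost equations are equations of Witt vectors. The relation thus says that lifts of
the two classes are the images under f and g of a class over `P.S₁`, which by the coequaliser
property means that the classes agree. In particular the relation is already an equivalence. -/
theorem coordRel_iff [hp : Fact p.Prime] {a b : Coord p (n + 1) B} :
    coordRel p (n + 1) P a b ↔ gammaRep p n a = gammaRep p n b := by
  constructor
  · rintro ⟨q, v, z, rfl, rfl, hq, hv⟩
    rw [← wMap_gammaRep, ← wMap_gammaRep, (gammaRep_eq_iff P.normExact).2 hq,
      (gammaRep_eq_iff P.normExact).2 hv, ← wMap_gammaRep, ← wMap_gammaRep, wMap_w]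
  · intro h
    obtain ⟨q, rfl⟩ := P.coordMap_surjective a
    obtain ⟨v, rfl⟩ := P.coordMap_surjective b
    rw [← wMap_gammaRep, ← wMap_gammaRep] at h
    obtain ⟨z, hq, hv⟩ := P.exists_of_wMap_eq h
    obtain ⟨z, rfl⟩ := gammaRep_surjective z
    rw [wMap_gammaRep] at hq hv
    exact ⟨q, v, z, rfl, rfl, (gammaRep_eq_iff P.normExact).1 hq.symm,
      (gammaRep_eq_iff P.normExact).1 hv.symm⟩

/-- The bijection between the two models of Witt vectors. -/
def gammaEquiv (p n : ℕ) [hp : Fact p.Prime] : WittCoord p (n + 1) P ≃ WittTrunc p n B :=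
  Equiv.ofBijective (Quot.lift (gammaRep p n) fun _ _ h => P.coordRel_iff.1 h) (by
    constructor
    · rintro ⟨a⟩ ⟨b⟩ h
      exact Quot.sound (P.coordRel_iff.2 h)
    · intro w
      obtain ⟨a, rfl⟩ := gammaRep_surjective w
      exact ⟨Quot.mk _ a, rfl⟩)

theorem gammaEquiv_coordMk [hp : Fact p.Prime] (a : Coord p (n + 1) B) :
    P.gammaEquiv p n (coordMk p (n + 1) P a) = gammaRep p n a := rfl

end FreeResolution

/-- The transport of a lax symmetric monoidal structure along bijections. -/
def LaxStructure.transport {F F' : BimodPair.{u} → Type u}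
    {map : ∀ {B C : BimodPair.{u}}, (B ⟶ C) → F B → F C} (L : LaxStructure F @map)
    (e : ∀ B, F' B ≃ F B) :
    LaxStructure F' (fun {B C} f x => (e C).symm (map f (e B x))) where
  addCommGroup B := letI := L.addCommGroup B; (e B).addCommGroup
  map_add {B C} f x y := by
    let := L.addCommGroup B
    let := L.addCommGroup C
    change (e C).symm (map f (e B ((e B).symm (e B x + e B y)))) =
      (e C).symm (e C ((e C).symm _) + e C ((e C).symm _))
    rw [Equiv.apply_symm_apply, Equiv.apply_symm_apply, Equiv.apply_symm_apply, L.map_add]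
  unit := (e _).symm L.unit
  mul x y := (e _).symm (L.mul (e _ x) (e _ y))
  add_mul {B C} x x' y := by
    let := L.addCommGroup B
    let := L.addCommGroup (B.tensor C)
    change (e _).symm (L.mul (e B ((e B).symm (e B x + e B x'))) (e C y)) =
      (e _).symm (e _ ((e _).symm _) + e _ ((e _).symm _))
    rw [Equiv.apply_symm_apply, Equiv.apply_symm_apply, Equiv.apply_symm_apply, L.add_mul]
  mul_add {B C} x y y' := by
    let := L.addCommGroup C
    let := L.addCommGroup (B.tensor C)
    change (e _).symm (L.mul (e B x) (e C ((e C).symm (e C y + e C y')))) =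
      (e _).symm (e _ ((e _).symm _) + e _ ((e _).symm _))
    rw [Equiv.apply_symm_apply, Equiv.apply_symm_apply, Equiv.apply_symm_apply, L.mul_add]
  map_mul f g x y := by simp only [Equiv.apply_symm_apply, L.map_mul]
  mul_assoc x y z := by simp only [Equiv.apply_symm_apply, L.mul_assoc]
  unit_mul x := by simp only [Equiv.apply_symm_apply, L.unit_mul, Equiv.symm_apply_apply]
  mul_unit x := by simp only [Equiv.apply_symm_apply, L.mul_unit, Equiv.symm_apply_apply]
  mul_comm x y := by simp only [Equiv.apply_symm_apply, L.mul_comm]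

theorem LaxStructure.transport_isCompatible {F F' : BimodPair.{u} → Type u}
    {map : ∀ {B C : BimodPair.{u}}, (B ⟶ C) → F B → F C} (L : LaxStructure F @map)
    (e : ∀ B, F' B ≃ F B) {N : ℕ} {w : ∀ B, F B → ∀ j : Fin N, cycInv B (p ^ (j : ℕ))}
    (h : L.IsCompatible p N w) : (L.transport e).IsCompatible p N fun B x => w B (e B x) where
  map_add B x y :=
    (congrArg (w B) ((e B).apply_symm_apply _)).trans (h.map_add B (e B x) (e B y))
  map_unit j := by
    rw [← h.map_unit j]
    exact congrArg (fun x => (w unitPair x j).1) ((e _).apply_symm_apply _)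
  map_mul B C x y j := by
    rw [← h.map_mul]
    exact congrArg (fun x => (w (B.tensor C) x j).1)
      ((e _).apply_symm_apply _)

section Uniqueness

variable {F : BimodPair.{u} → Type u} {map : ∀ {B C : BimodPair.{u}}, (B ⟶ C) → F B → F C} {N : ℕ}
  {w : ∀ B, F B → ∀ j : Fin N, cycInv B (p ^ (j : ℕ))}

/-- Both summands lift to the free cover, where additivity and injectivity of w determine the sum;
naturality along the counit carries this down. -/
theorem addCommGroup_eq_of_natural (hw : ∀ B, NormExact B → Function.Injective (w B))
    (hmap : ∀ B, Function.Surjective (map (counit B))) {G G' : ∀ B, AddCommGroup (F B)}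
    (hG : ∀ (B C : BimodPair.{u}) (f : B ⟶ C) (x y : F B),
      map f (letI := G B; x + y) = (letI := G C; map f x + map f y))
    (hG' : ∀ (B C : BimodPair.{u}) (f : B ⟶ C) (x y : F B),
      map f (letI := G' B; x + y) = (letI := G' C; map f x + map f y))
    (hGw : ∀ (B : BimodPair.{u}) (x y : F B), w B (letI := G B; x + y) = w B x + w B y)
    (hGw' : ∀ (B : BimodPair.{u}) (x y : F B), w B (letI := G' B; x + y) = w B x + w B y)
    (B : BimodPair.{u}) : G B = G' B := by
  refine AddCommGroup.ext (funext fun x => funext fun y => ?_)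
  obtain ⟨x, rfl⟩ := hmap B x
  obtain ⟨y, rfl⟩ := hmap B y
  refine (hG _ _ (counit B) x y).symm.trans (Eq.trans ?_ (hG' _ _ (counit B) x y))
  exact congrArg _ (hw _ (coverBasis B).normExact ((hGw _ x y).trans (hGw' _ x y).symm))

theorem LaxStructure.eq_of_isCompatible (hw : ∀ B, NormExact B → Function.Injective (w B))
    (hmap : ∀ B, Function.Surjective (map (counit B))) {L L' : LaxStructure F @map}
    (h : L.IsCompatible p N w) (h' : L'.IsCompatible p N w) : L = L' := by
  refine LaxStructure.ext ?_ ?_ ?_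
  · exact funext fun B => addCommGroup_eq_of_natural hw hmap (fun _ _ => L.map_add)
      (fun _ _ => L'.map_add) h.map_add h'.map_add B
  -- The unit is a single element over (ℤ; ℤ), which itself has a basis, so no lifting is needed.
  · exact hw _ unitBasis.normExact (funext fun j => Subtype.ext
      ((h.map_unit j).trans (h'.map_unit j).symm))
  · funext B C x y
    obtain ⟨x, rfl⟩ := hmap B x
    obtain ⟨y, rfl⟩ := hmap C y
    rw [← L.map_mul, ← L'.map_mul]
    exact congrArg _ (hw _ ((coverBasis B).tensor (coverBasis C)).normExact
      (funext fun j => Subtype.ext ((h.map_mul _ _ x y j).trans (h'.map_mul _ _ x y j).symm)))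

end Uniqueness

end

end WittCoeff

end

theorem mainTheorem1 (p : ℕ) [Fact p.Prime] (n : ℕ) :
    (∀ B : BimodPair.{u}, Nonempty (FreeResolution B)) ∧
    ∃ (tlog : ∀ B : BimodPair.{u}, WittTrunc p n B → ∀ j : Fin (n + 1), cycInv B (p ^ (j : ℕ)))
      (LW : LaxStructure (WittTrunc.{u} p n) (fun f => wMap p n f)),
      -- `tlog` is the map induced by the logarithmic derivative
      (∀ (B : BimodPair.{u}) (x : specialUnits B) (j : Fin (n + 1)),
        (tlog B (wMk p n x) j : Cyc B (p ^ (j : ℕ))) = tlogCoeff x (p ^ (j : ℕ))) ∧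
      -- `LW` is the lax symmetric monoidal structure of `W_{⟨p^n⟩}`, and `tlog` respects it
      LW.IsStandard ∧ LW.IsCompatible p (n + 1) tlog ∧
      ∀ P : ∀ B : BimodPair.{u}, FreeResolution B,
        ∃ (map : ∀ {B C : BimodPair.{u}}, (B ⟶ C) →
              WittCoord p (n + 1) (P B) → WittCoord p (n + 1) (P C))
          (w : ∀ B : BimodPair.{u}, WittCoord p (n + 1) (P B) →
              ∀ j : Fin (n + 1), cycInv B (p ^ (j : ℕ)))
          (γ : ∀ B : BimodPair.{u}, WittCoord p (n + 1) (P B) ≃ WittTrunc p n B)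
          (L : LaxStructure (fun B => WittCoord p (n + 1) (P B)) @map),
          -- the induced maps, the ghost map and `γ` are well defined on `W_{n+1,p}`
          (∀ (B C : BimodPair.{u}) (f : B ⟶ C) (a : Coord p (n + 1) B),
            map f (coordMk p (n + 1) (P B) a) = coordMk p (n + 1) (P C) (coordMap p (n + 1) f a)) ∧
          (∀ (B : BimodPair.{u}) (a : Coord p (n + 1) B) (j : Fin (n + 1)),
            (w B (coordMk p (n + 1) (P B) a) j : Cyc B (p ^ (j : ℕ))) = ghost p (n + 1) a j) ∧
          (∀ (B : BimodPair.{u}) (a : Coord p (n + 1) B),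
            γ B (coordMk p (n + 1) (P B) a) = gammaRep p n a) ∧
          -- `γ` is natural, and the ghost map corresponds to `tlog`
          (∀ (B C : BimodPair.{u}) (f : B ⟶ C) (x : WittCoord p (n + 1) (P B)),
            γ C (map f x) = wMap p n f (γ B x)) ∧
          (∀ (B : BimodPair.{u}) (x : WittCoord p (n + 1) (P B)), tlog B (γ B x) = w B x) ∧
          -- `L` corresponds to `LW` under `γ`
          (∀ (B : BimodPair.{u}) (x y : WittCoord p (n + 1) (P B)),
            γ B (letI := L.addCommGroup B; x + y) = γ B x + γ B y) ∧
          γ unitPair L.unit = LW.unit ∧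
          (∀ (B C : BimodPair.{u}) (x : WittCoord p (n + 1) (P B))
            (y : WittCoord p (n + 1) (P C)),
            γ (B.tensor C) (L.mul x y) = LW.mul (γ B x) (γ C y)) ∧
          -- the ghost maps are additive and symmetric monoidal for `L`, and `L` is unique
          L.IsCompatible p (n + 1) w ∧
          (∀ L' : LaxStructure (fun B => WittCoord p (n + 1) (P B)) @map,
            L'.IsCompatible p (n + 1) w → L' = L) ∧
          -- already the abelian group structure is the unique natural one with `w` additive
          (∀ G : ∀ B : BimodPair.{u}, AddCommGroup (WittCoord p (n + 1) (P B)),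
            (∀ (B C : BimodPair.{u}) (f : B ⟶ C) (x y : WittCoord p (n + 1) (P B)),
              map f (letI := G B; x + y) = (letI := G C; map f x + map f y)) →
            (∀ (B : BimodPair.{u}) (x y : WittCoord p (n + 1) (P B)),
              w B (letI := G B; x + y) = w B x + w B y) →
            ∀ B : BimodPair.{u}, G B = L.addCommGroup B) := by
  refine ⟨fun B => ⟨barResolution B⟩, fun B => tlogW p n B, wittLax p n, fun _ _ _ => rfl,
    wittLax_isStandard, wittLax_isCompatible, fun P => ?_⟩
  have hw : ∀ B, NormExact B →
      Function.Injective fun x : WittCoord p (n + 1) (P B) =>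
        tlogW p n B ((P B).gammaEquiv p n x) :=
    fun B hB => (tlogW_injective hB).comp ((P B).gammaEquiv p n).injective
  have hmap : ∀ B, Function.Surjective fun x : WittCoord p (n + 1) (P (freeCover B)) =>
      ((P B).gammaEquiv p n).symm (wMap p n (counit B) ((P (freeCover B)).gammaEquiv p n x)) :=
    fun B => ((P B).gammaEquiv p n).symm.surjective.comp
      ((wMap_counit_surjective B).comp ((P (freeCover B)).gammaEquiv p n).surjective)
  have hL := (wittLax p n).transport_isCompatible (fun B => (P B).gammaEquiv p n)
    (wittLax_isCompatible (p := p) (n := n))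
  -- Functoriality is transported from `wMap` along γ, which makes γ natural by construction; what
  -- is left is that it is induced by `coordMap` on representatives.
  refine ⟨_, fun B x => tlogW p n B ((P B).gammaEquiv p n x), fun B => (P B).gammaEquiv p n,
    (wittLax p n).transport fun B => (P B).gammaEquiv p n, fun B C f a => ?_,
    fun B a j => tlogW_gammaRep a j, fun _ _ => rfl, fun B C f x => Equiv.apply_symm_apply _ _,
    fun _ _ => rfl, fun B x y => Equiv.apply_symm_apply _ _, Equiv.apply_symm_apply _ _,
    fun B C x y => Equiv.apply_symm_apply _ _, hL,
    fun L' hL' => LaxStructure.eq_of_isCompatible hw hmap hL' hL,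
    fun G hG hGw => addCommGroup_eq_of_natural
      (map := fun {B C} f x =>
        ((P C).gammaEquiv p n).symm (wMap p n f ((P B).gammaEquiv p n x))) hw hmap hG
      (fun _ _ => ((wittLax p n).transport fun B => (P B).gammaEquiv p n).map_add) hGw hL.map_add⟩
  rw [Equiv.symm_apply_eq, FreeResolution.gammaEquiv_coordMk, FreeResolution.gammaEquiv_coordMk,
    wMap_gammaRep]
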